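/- Let $m\ge 2$ be an integer, let $1\le p\le\infty$, and define $q>0$ by $\frac1q=\frac m2+\frac1p$ (so $q=2/m$ if $p=\infty$). A triangle $T\subset\mathbb R^2$ is always closed and nondegenerate, and $|T|$ is its area. For a continuous function $v$ on $T$ let $I_{m,T}v$ be the unique polynomial of total degree at most $m-1$ which agrees with $v$ at all points of $T$ whose barycentric coordinates belong to $\{0,\frac1{m-1},\frac2{m-1},\dots,1\}$, and put $e_{m,T}(v)_p=\|v-I_{m,T}v\|_{L^p(T)}$. For a finite set $\mathcal T$ of triangles with pairwise disjoint interiors put $e_{m,\mathcal T}(v)_p=\big(\sum_{T\in\mathcal T}e_{m,T}(v)_p^p\big)^{1/p}$, and $e_{m,\mathcal T}(v)_\infty=\max_{T\in\mathcal T}e_{m,T}(v)_\infty$; this is the $L^p$ norm of $v-I_{m,\mathcal T}v$, where $I_{m,\mathcal T}v$ is equal to $I_{m,T}v$ on each $T\in\mathcal T$. For a homogeneous polynomial $\pi$ of degree $m$ in two variables let $$K_{m,p}(\pi)=\inf_{|T|=1}e_{m,T}(\pi)_p ,$$ the infimum being over all triangles of area $1$. Let $\Omega\subset\mathbb R^2$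 be a compact polygonal domain, that is, a nonempty finite union of triangles, and let $f\in C^m(\Omega)$ (up to the boundary). For $z\in\Omega$ regard $\frac{d^mf(z)}{m!}$ as the homogeneous polynomial $\sum_{k+l=m}\frac{\partial^m f}{\partial x^k\partial y^l}(z)\,\frac{x^k}{k!}\frac{y^l}{l!}$. **Theorem.** There are an $N_0$ and a sequence $(\mathcal T_N)_{N\ge N_0}$ of triangulations of $\Omega$ (finite sets of triangles with pairwise disjoint interiors and union $\Omega$) such that $\#(\mathcal T_N)=N$ for all $N\ge N_0$ and $$\limsup_{N\to\infty}N^{m/2}\,e_{m,\mathcal T_N}(f)_p\le\Big\|K_{m,p}\Big(\frac{d^mf}{m!}\Big)\Big\|_{L^q(\Omega)} .$$ If $p<\infty$, the triangulations $\mathcal T_N$ can moreover be chosen conforming: the intersection of any two distinct triangles of $\mathcal T_N$ is empty, a common vertex, or a common edge. -/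

import Mathlib

open MeasureTheory Filter
open scoped ENNReal Nat

noncomputable section

/-- The Euclidean plane `ℝ²`, with its Euclidean norm and Lebesgue measure. -/
abbrev Plane : Type := EuclideanSpace ℝ (Fin 2)

/-- Nondegenerate triangles: three affinely independent vertices `T.points 0, 1, 2`. -/
abbrev Tri : Type := Affine.Triangle ℝ Plane

/-- The set of vertices of a triangle. -/
def triVertices (T : Tri) : Set Plane := Set.range T.points

/-- The closed triangle, as a subset of the plane. -/
def triSet (T : Tri) : Set Plane := convexHull ℝ (triVertices T)

/-- Compact polygonal domains: nonempty finite unions of closed nondegenerate triangles (the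
triangles used in such a representation may overlap and need not fit together). -/
def IsPolygonal (Ω : Set Plane) : Prop :=
  ∃ S : Finset Tri, S.Nonempty ∧ Ω = ⋃ T ∈ S, triSet T

/-- A finite family of triangles is a triangulation (partition into triangles) of `Ω` if the closed
triangles cover exactly `Ω` and distinct members have disjoint interiors. -/
structure IsTriangulation (Ω : Set Plane) (𝒯 : Finset Tri) : Prop where
  covers : (⋃ T ∈ 𝒯, triSet T) = Ω
  nonoverlapping : ∀ T ∈ 𝒯, ∀ T' ∈ 𝒯, T ≠ T' →
    Disjoint (interior (triSet T)) (interior (triSet T'))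

/-- Conformity: two distinct triangles meet exactly in the convex hull of their common vertices,
i.e. in the empty set, a common vertex or a common edge. -/
def IsConforming (𝒯 : Finset Tri) : Prop :=
  ∀ T ∈ 𝒯, ∀ T' ∈ 𝒯, T ≠ T' →
    triSet T ∩ triSet T' = convexHull ℝ (triVertices T ∩ triVertices T')

/-- Value of the bivariate polynomial `P` at the point `z`. -/
def polyVal (P : MvPolynomial (Fin 2) ℝ) (z : Plane) : ℝ := MvPolynomial.eval (fun i => z i) P

/-- The point of `T` with barycentric coordinates `a i / (m - 1)`; it is a Lagrange node of degree
`m - 1` when the natural numbers `a 0, a 1, a 2` sum to `m - 1`. -/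
def lagrangeNode (m : ℕ) (T : Tri) (a : Fin 3 → ℕ) : Plane :=
  ∑ i, ((a i : ℝ) / ((m : ℝ) - 1)) • T.points i

/-- `P` has total degree at most `m - 1` and agrees with `v` at all points of `T` whose barycentric
coordinates lie in `{0, 1/(m-1), …, 1}`. -/
def IsLagrangeInterpolant (m : ℕ) (T : Tri) (v : Plane → ℝ) (P : MvPolynomial (Fin 2) ℝ) : Prop :=
  P.totalDegree ≤ m - 1 ∧
    ∀ a : Fin 3 → ℕ, ∑ i, a i = m - 1 → polyVal P (lagrangeNode m T a) = v (lagrangeNode m T a)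

open Classical in
/-- The local interpolant `I_{m,T} v`, the unique polynomial satisfying
`IsLagrangeInterpolant m T v` (it exists for every `m ≥ 2`; the value `0` is never used). -/
def lagrangeInterp (m : ℕ) (T : Tri) (v : Plane → ℝ) : MvPolynomial (Fin 2) ℝ :=
  if h : ∃ P, IsLagrangeInterpolant m T v P then h.choose else 0

/-- The local error `e_{m,T}(v)_p`, the `L^p(T)` norm of `v - I_{m,T} v`. -/
def localError (m : ℕ) (p : ℝ≥0∞) (T : Tri) (v : Plane → ℝ) : ℝ≥0∞ :=
  eLpNorm (fun z => v z - polyVal (lagrangeInterp m T v) z) p (volume.restrict (triSet T))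

open Classical in
/-- The global error `e_{m,𝒯}(v)_p = (∑_T e_{m,T}(v)_p ^ p) ^ (1/p)`, and `max_T e_{m,T}(v)_∞` for
`p = ∞`. -/
def globalError (m : ℕ) (p : ℝ≥0∞) (𝒯 : Finset Tri) (v : Plane → ℝ) : ℝ≥0∞ :=
  if p = ∞ then ⨆ T ∈ 𝒯, localError m p T v
  else (∑ T ∈ 𝒯, localError m p T v ^ p.toReal) ^ (1 / p.toReal)

/-- The shape function `K_{m,p}(π)`: the infimum of `e_{m,T}(π)_p` over the triangles `T` of
area `1`. -/
def shapeFunction (m : ℕ) (p : ℝ≥0∞) (π : Plane → ℝ) : ℝ≥0∞ :=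
  ⨅ (T : Tri) (_ : volume (triSet T) = 1), localError m p T π

/-- The homogeneous polynomial `d^m f_z / m!` of degree `m`, that is
`u ↦ (1/m!) D^m f(z)[u, …, u] = ∑_{k+l=m} ∂^m f/∂x^k∂y^l (z) (u₀^k/k!) (u₁^l/l!)`.
On the interior of `Ω` the derivative within `Ω` is the usual one. -/
def derivPoly (m : ℕ) (Ω : Set Plane) (f : Plane → ℝ) (z : Plane) : Plane → ℝ :=
  fun u => iteratedFDerivWithin ℝ m f Ω z (fun _ => u) / (m ! : ℝ)

/-- The exponent `q` with `1/q = m/2 + 1/p` (so `q = 2/m` if `p = ∞`). -/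
def dualExponent (m : ℕ) (p : ℝ≥0∞) : ℝ≥0∞ := ((m : ℝ≥0∞) / 2 + 1 / p)⁻¹

end

/-! ### Barycentric coordinates and basic geometry of triangles -/

/-! The interpolation error ignores polynomials of degree less than `m`. Replacing `f` on a small
triangle by the homogeneous part `d^m f / m!`, frozen at a nearby point, therefore costs little
(`localError_le_of_deriv`). For a homogeneous polynomial, translating the triangle changes nothing,
and dilating it by `s` multiplies the error by `|s| ^ (m + 2/p) = |s| ^ (2r)`, where `r = m/2 + 1/p
= 1/q` is `dualRate`.

Let `I` be the integral of `K ^ (1/r)` over `Ω`, so that the right-hand side of the theorem is `I ^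
r`, and let `J > I`. Partition `Ω` into triangles `R` so small that `d^m f` is almost constant on
each. For each `R` take an almost optimal triangle of area 1 and dilate it to a triangle `τ R` whose
error is at most 1 in the normalization above. All copies of `h • τ R` placed inside `R` then have
error at most `h ^ (2r)`, so the error is equidistributed. Moreover the sum of `|R| / |τ R|` is a
Riemann sum for the integral of `K ^ (1/r)` and stays below `J` (`exists_shapes`). To keep the
estimates uniform, `K` is first replaced by its truncations `shapeTrunc`, the infima over triangles
of bounded diameter. These are Lipschitz in the polynomial and decrease to `K`, so their integrals
converge.

Each `R` is tiled by translates of `h • τ R` and `-h • τ R`. At most `(∑ |R| / |τ R|) / h ^ 2` of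
them lie inside, and the tiles meeting the boundary are cut into `O(1/h)` pieces (`exists_tiling`,
`exists_mesh`). With `N h ^ 2 = J` there is room for these pieces when `N` is large. For `p = ∞`
they are made smaller by a fixed factor, so that their crude error is also at most `h ^ m`. For `p <
∞` they have total area `O(h)` and are negligible. In that case conformity comes from bisecting
triangles at hanging vertices: there are `O(1/h)` of these, each adds one triangle, and the thin
triangles so produced are harmless because Lagrange interpolation is bounded in the sup norm
independently of the shape of the triangle. Bisections at further boundary points bring the number
of triangles to exactly `N`.

This gives `N ^ (m/2) * error ≤ J ^ r` for all large `N` and each finite `J > I`; `exists_limsup_le`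
extracts one sequence serving all `J`. -/

theorem affineSpan_tri (T : Tri) : affineSpan ℝ (Set.range T.points) = ⊤ := by
  rw [T.independent.affineSpan_eq_top_iff_card_eq_finrank_add_one]
  simp

/-- The affine basis formed by the vertices of a triangle. -/
noncomputable def triBasis (T : Tri) : AffineBasis (Fin 3) ℝ Plane :=
  ⟨T.points, T.independent, affineSpan_tri T⟩

/-- The barycentric coordinates of a triangle. -/
noncomputable def bary (T : Tri) (i : Fin 3) : Plane →ᵃ[ℝ] ℝ := (triBasis T).coord i

theorem bary_sum (T : Tri) (x : Plane) : bary T 0 x + bary T 1 x + bary T 2 x = 1 := by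
  have := (triBasis T).sum_coord_apply_eq_one x
  rwa [Fin.sum_univ_three] at this

theorem bary_points (T : Tri) (i j : Fin 3) : bary T i (T.points j) = if i = j then 1 else 0 :=
  (triBasis T).coord_apply i j

@[simp] theorem bary_self (T : Tri) (i : Fin 3) : bary T i (T.points i) = 1 := by
  simp [bary_points]

theorem bary_ne (T : Tri) {i j : Fin 3} (h : i ≠ j) : bary T i (T.points j) = 0 := by
  simp [bary_points, h]

theorem sum_bary_smul (T : Tri) (x : Plane) :
    ∑ i, bary T i x • T.points i = x :=
  (triBasis T).linear_combination_coord_eq_self x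

theorem bary_ext {T : Tri} {x y : Plane} (h : ∀ i, bary T i x = bary T i y) : x = y :=
  (triBasis T).ext_elem h

theorem affineMap_sum {E : Type*} [AddCommGroup E] [Module ℝ E] (g : Plane →ᵃ[ℝ] E)
    {ι : Type*} (s : Finset ι) (c : ι → ℝ) (p : ι → Plane)
    (hc : ∑ i ∈ s, c i = 1) : g (∑ i ∈ s, c i • p i) = ∑ i ∈ s, c i • g (p i) := by
  have h : ∀ x, g x = g.linear x + g 0 := fun x => by
    have := congrFun (AffineMap.decomp g) x
    simpa using this
  rw [h, map_sum]
  simp_rw [map_smul]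
  have : ∑ i ∈ s, c i • g (p i) = ∑ i ∈ s, (c i • g.linear (p i) + c i • g 0) := by
    refine Finset.sum_congr rfl fun i _ => ?_
    rw [h (p i), smul_add]
  rw [this, Finset.sum_add_distrib, ← Finset.sum_smul, hc, one_smul]

theorem affineMap_eq_sum_bary {E : Type*} [AddCommGroup E] [Module ℝ E] (g : Plane →ᵃ[ℝ] E)
    (T : Tri) (x : Plane) : g x = ∑ i, bary T i x • g (T.points i) := by
  conv_lhs => rw [← sum_bary_smul T x]
  exact affineMap_sum g _ _ _ ((triBasis T).sum_coord_apply_eq_one x)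

theorem bary_sum_smul (T : Tri) (c : Fin 3 → ℝ) (hc : ∑ i, c i = 1) (k : Fin 3) :
    bary T k (∑ i, c i • T.points i) = c k := by
  rw [affineMap_sum _ _ _ _ hc]
  simp [bary_points]

theorem continuous_affineMap (g : Plane →ᵃ[ℝ] ℝ) : Continuous g :=
  g.continuous_of_finiteDimensional

theorem mem_triSet {T : Tri} {x : Plane} : x ∈ triSet T ↔ ∀ i, 0 ≤ bary T i x := by
  have := (triBasis T).convexHull_eq_nonneg_coord
  exact Set.ext_iff.mp this x

theorem mem_interior_triSet {T : Tri} {x : Plane} :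
    x ∈ interior (triSet T) ↔ ∀ i, 0 < bary T i x := by
  have := (triBasis T).interior_convexHull
  exact Set.ext_iff.mp this x

theorem points_mem (T : Tri) (i : Fin 3) : T.points i ∈ triSet T :=
  subset_convexHull ℝ _ ⟨i, rfl⟩

theorem points_mem_triVertices (T : Tri) (i : Fin 3) : T.points i ∈ triVertices T := ⟨i, rfl⟩

theorem triVertices_subset (T : Tri) : triVertices T ⊆ triSet T := subset_convexHull ℝ _

theorem convex_triSet (T : Tri) : Convex ℝ (triSet T) := convex_convexHull ℝ _

theorem finite_triVertices (T : Tri) : (triVertices T).Finite := Set.finite_range _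

theorem isCompact_triSet (T : Tri) : IsCompact (triSet T) :=
  (finite_triVertices T).isCompact_convexHull (𝕜 := ℝ)

theorem interior_triSet_nonempty (T : Tri) : (interior (triSet T)).Nonempty := by
  refine ⟨∑ i, (1 / 3 : ℝ) • T.points i, mem_interior_triSet.2 fun i => ?_⟩
  rw [bary_sum_smul T (fun _ => 1 / 3) (by norm_num)]
  norm_num

theorem closure_interior_triSet (T : Tri) : closure (interior (triSet T)) = triSet T := by
  have h := Convex.closure_interior_eq_closure_of_nonempty_interior (𝕜 := ℝ)
    (convex_triSet T) (interior_triSet_nonempty T)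
  rw [h, (isCompact_triSet T).isClosed.closure_eq]

theorem mem_triVertices_of_bary {T : Tri} {x : Plane} {i : Fin 3} (hx : x ∈ triSet T)
    (h : bary T i x = 1) : x = T.points i := by
  have h0 := mem_triSet.1 hx
  have hs := bary_sum T x
  refine bary_ext (T := T) fun j => ?_
  have h0' := h0 0
  have h1' := h0 1
  have h2' := h0 2
  rw [bary_points]
  fin_cases i <;> fin_cases j <;> simp at h ⊢ <;> linarith

theorem affine_nonneg_on_tri (g : Plane →ᵃ[ℝ] ℝ) (T : Tri) (h : ∀ i, 0 ≤ g (T.points i)) :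
    ∀ x ∈ triSet T, 0 ≤ g x := by
  intro x hx
  rw [affineMap_eq_sum_bary g T x]
  exact Finset.sum_nonneg fun i _ => mul_nonneg (mem_triSet.1 hx i) (h i)

/-! ### Measures of triangles -/

theorem measurableSet_triSet (T : Tri) : MeasurableSet (triSet T) :=
  (isCompact_triSet T).isClosed.measurableSet

theorem volume_triSet_ne_top (T : Tri) : volume (triSet T) ≠ ∞ :=
  (isCompact_triSet T).measure_lt_top.ne

theorem volume_triSet_pos (T : Tri) : 0 < volume (triSet T) :=
  lt_of_lt_of_le (isOpen_interior.measure_pos _ (interior_triSet_nonempty T))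
    (measure_mono interior_subset)

/-- The boundary of a convex set is a null set, and any overlap is confined to the two boundaries.
-/
theorem aedisjoint_triSet {T S : Tri}
    (h : Disjoint (interior (triSet T)) (interior (triSet S))) :
    AEDisjoint volume (triSet T) (triSet S) := by
  have h1 : volume (frontier (triSet T)) = 0 := (convex_triSet T).addHaar_frontier _
  have h2 : volume (frontier (triSet S)) = 0 := (convex_triSet S).addHaar_frontier _
  refine measure_mono_null (t := frontier (triSet T) ∪ frontier (triSet S)) ?_
    (measure_union_null h1 h2)
  rintro x ⟨hx, hy⟩
  by_cases hxi : x ∈ interior (triSet T)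
  · right
    exact ⟨subset_closure hy, fun hyi => Set.disjoint_left.1 h hxi hyi⟩
  · left
    exact ⟨subset_closure hx, hxi⟩

theorem sum_lintegral_triSet {ι : Type*} (s : Finset ι) (T : ι → Tri)
    (hd : ∀ i ∈ s, ∀ j ∈ s, i ≠ j → Disjoint (interior (triSet (T i))) (interior (triSet (T j))))
    {A : Set Plane} (hA : ∀ i ∈ s, triSet (T i) ⊆ A) (F : Plane → ℝ≥0∞) :
    ∑ i ∈ s, ∫⁻ x in triSet (T i), F x ≤ ∫⁻ x in A, F x := by
  rw [← lintegral_biUnion_finset₀ (t := fun i => triSet (T i))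
    (fun i hi j hj hij => aedisjoint_triSet (hd i hi j hj hij))
    (fun i _ => (measurableSet_triSet _).nullMeasurableSet)]
  exact lintegral_mono_set (Set.iUnion₂_subset hA)

theorem sum_volume_triSet_le {ι : Type*} (s : Finset ι) (T : ι → Tri)
    (hd : ∀ i ∈ s, ∀ j ∈ s, i ≠ j → Disjoint (interior (triSet (T i))) (interior (triSet (T j))))
    {A : Set Plane} (hA : ∀ i ∈ s, triSet (T i) ⊆ A) :
    ∑ i ∈ s, volume (triSet (T i)) ≤ volume A := by
  simpa using sum_lintegral_triSet s T hd hA (fun _ => 1)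

/-- The area of a triangle as a real number. -/
noncomputable def triArea (T : Tri) : ℝ := (volume (triSet T)).toReal

theorem triArea_pos (T : Tri) : 0 < triArea T :=
  ENNReal.toReal_pos (volume_triSet_pos T).ne' (volume_triSet_ne_top T)

theorem ofReal_triArea (T : Tri) : ENNReal.ofReal (triArea T) = volume (triSet T) :=
  ENNReal.ofReal_toReal (volume_triSet_ne_top T)

theorem sum_triArea_le {ι : Type*} (s : Finset ι) (T : ι → Tri)
    (hd : ∀ i ∈ s, ∀ j ∈ s, i ≠ j → Disjoint (interior (triSet (T i))) (interior (triSet (T j))))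
    {A : Set Plane} (hA : ∀ i ∈ s, triSet (T i) ⊆ A) (hfin : volume A ≠ ∞) :
    ∑ i ∈ s, triArea (T i) ≤ (volume A).toReal := by
  have h := sum_volume_triSet_le s T hd hA
  have h2 := ENNReal.toReal_mono hfin h
  rwa [ENNReal.toReal_sum (fun i _ => volume_triSet_ne_top _)] at h2

/-! ### Replacing a vertex -/

/-- The coordinates of `T` turn an affine dependence into a triangular system: coordinate `k` kills
the weight of `v`, and then the other coordinates kill the remaining weights. -/
theorem replace_indep (T : Tri) (k : Fin 3) (v : Plane) (h : bary T k v ≠ 0) :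
    AffineIndependent ℝ (Function.update T.points k v) := by
  rw [affineIndependent_iff_of_fintype]
  classical
  intro w hw hsum
  rw [Finset.weightedVSub_eq_linear_combination _ hw] at hsum
  have key : ∀ j, ∑ i, w i * bary T j (Function.update T.points k v i) = 0 := by
    intro j
    have h1 : ∀ x, bary T j x = (bary T j).linear x + bary T j 0 := fun x => by
      have := congrFun (AffineMap.decomp (bary T j)) x
      simpa using this
    have h2 := congrArg (bary T j).linear hsum
    rw [map_sum, map_zero] at h2
    simp_rw [map_smul, smul_eq_mul] at h2
    calc ∑ i, w i * bary T j (Function.update T.points k v i)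
        = ∑ i, (w i * (bary T j).linear (Function.update T.points k v i) + w i * bary T j 0) :=
          Finset.sum_congr rfl fun i _ => by rw [h1, mul_add]
      _ = 0 := by rw [Finset.sum_add_distrib, h2, ← Finset.sum_mul, hw, zero_mul, zero_add]
  have key' : ∀ j, w k * bary T j v + (if j = k then 0 else w j) = 0 := by
    intro j
    have := key j
    rw [← Finset.add_sum_erase _ _ (Finset.mem_univ k)] at this
    rw [Function.update_self] at this
    refine Eq.trans ?_ this
    congr 1
    have : ∀ i ∈ Finset.univ.erase k, w i * bary T j (Function.update T.points k v i) =
        if j = i then w i else 0 := by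
      intro i hi
      rw [Function.update_of_ne (Finset.ne_of_mem_erase hi), bary_points]
      simp
    rw [Finset.sum_congr rfl this, Finset.sum_ite_eq]
    by_cases hjk : j = k
    · simp [hjk]
    · simp [hjk]
  have hk : w k = 0 := by
    have := key' k
    simpa [h] using this
  intro j
  by_cases hj : j = k
  · rw [hj, hk]
  · have := key' j
    simpa [hj, hk] using this

/-- Replace the vertex `k` of `T` by a point off the line through the other two vertices. -/
def Tri.replace (T : Tri) (k : Fin 3) (v : Plane) (h : bary T k v ≠ 0) : Tri :=
  ⟨Function.update T.points k v, replace_indep T k v h⟩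

theorem replace_points (T : Tri) (k : Fin 3) (v : Plane) (h : bary T k v ≠ 0) (i : Fin 3) :
    (T.replace k v h).points i = if i = k then v else T.points i := by
  simp [Tri.replace, Function.update_apply]

/-- This change of coordinates yields explicit inequalities for the two halves of a bisected
triangle. -/
theorem bary_replace (T : Tri) (k : Fin 3) (v : Plane) (h : bary T k v ≠ 0) (j : Fin 3)
    (y : Plane) : bary T j y = bary (T.replace k v h) k y * bary T j v +
      if j = k then 0 else bary (T.replace k v h) j y := by
  rw [affineMap_eq_sum_bary (bary T j) (T.replace k v h) y,
    ← Finset.add_sum_erase _ _ (Finset.mem_univ k)]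
  simp only [smul_eq_mul]
  rw [replace_points, if_pos rfl]
  congr 1
  have : ∀ i ∈ Finset.univ.erase k, bary (T.replace k v h) i y *
      bary T j ((T.replace k v h).points i) = if j = i then bary (T.replace k v h) i y else 0 := by
    intro i hi
    rw [replace_points, if_neg (Finset.ne_of_mem_erase hi), bary_points]
    simp
  rw [Finset.sum_congr rfl this, Finset.sum_ite_eq]
  by_cases hjk : j = k
  · simp [hjk]
  · simp [hjk]

/-! ### Bisecting a triangle -/

theorem fin3_cases {a b l : Fin 3} (hab : a ≠ b) (hal : a ≠ l) (hbl : b ≠ l) (i : Fin 3) :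
    i = a ∨ i = b ∨ i = l := by
  revert a b l i; decide

theorem bary_sum' (T : Tri) {a b l : Fin 3} (hab : a ≠ b) (hal : a ≠ l) (hbl : b ≠ l)
    (x : Plane) : bary T a x + bary T b x + bary T l x = 1 := by
  have := bary_sum T x
  fin_cases a <;> fin_cases b <;> fin_cases l <;> simp at hab hal hbl ⊢ <;> linarith

/-- The two halves `T₁ = [a, v, l]` and `T₂ = [v, b, l]` of a triangle with vertices `a, b, l` cut
from the vertex `l` to a point `v` of the open edge between the vertices `a` and `b`. -/
structure IsBisection (T : Tri) (a b l : Fin 3) (v : Plane) (T₁ T₂ : Tri) : Prop where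
  cover : triSet T₁ ∪ triSet T₂ = triSet T
  disj : Disjoint (interior (triSet T₁)) (interior (triSet T₂))
  vert₁ : triVertices T₁ = {T.points a, v, T.points l}
  vert₂ : triVertices T₂ = {v, T.points b, T.points l}
  notMem₁ : T.points b ∉ triSet T₁
  notMem₂ : T.points a ∉ triSet T₂
  inter : ∀ x ∈ triSet T₁, x ∈ triSet T₂ → x ∉ interior (triSet T) → x = v ∨ x = T.points l

theorem exists_bisection (T : Tri) {a b l : Fin 3} (hab : a ≠ b) (hal : a ≠ l) (hbl : b ≠ l)
    {v : Plane} (hl : bary T l v = 0) (ha : 0 < bary T a v) (hb : 0 < bary T b v) :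
    ∃ T₁ T₂ : Tri, IsBisection T a b l v T₁ T₂ := by
  set s := bary T a v with hs
  set t := bary T b v with ht
  have hst : s + t = 1 := by have := bary_sum' T hab hal hbl v; linarith
  set T₁ := T.replace b v hb.ne' with hT₁
  set T₂ := T.replace a v ha.ne' with hT₂
  have A1 : ∀ y, bary T b y = bary T₁ b y * t := fun y => by
    have := bary_replace T b v hb.ne' b y; simpa using this
  have A2 : ∀ y, bary T a y = bary T₁ b y * s + bary T₁ a y := fun y => by
    have := bary_replace T b v hb.ne' a y; simpa [hab] using this
  have A3 : ∀ y, bary T l y = bary T₁ l y := fun y => by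
    have := bary_replace T b v hb.ne' l y; simpa [hbl.symm, hl] using this
  have B1 : ∀ y, bary T a y = bary T₂ a y * s := fun y => by
    have := bary_replace T a v ha.ne' a y; simpa using this
  have B2 : ∀ y, bary T b y = bary T₂ a y * t + bary T₂ b y := fun y => by
    have := bary_replace T a v ha.ne' b y; simpa [hab.symm] using this
  have B3 : ∀ y, bary T l y = bary T₂ l y := fun y => by
    have := bary_replace T a v ha.ne' l y; simpa [hal.symm, hl] using this
  -- The cut from vertex `l` to `v` lies on the line where `s * bary T b = t * bary T a`; each half
  -- is the part of `T` on one side of it.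
  have M1 : ∀ y, y ∈ triSet T₁ ↔
      0 ≤ bary T b y ∧ 0 ≤ bary T l y ∧ s * bary T b y ≤ t * bary T a y := by
    intro y
    rw [mem_triSet]
    constructor
    · intro h
      refine ⟨A1 y ▸ mul_nonneg (h b) hb.le, A3 y ▸ h l, ?_⟩
      rw [A1, A2]
      nlinarith [mul_nonneg hb.le (h a)]
    · rintro ⟨h1, h2, h3⟩ i
      rw [A1] at h1
      rw [A3] at h2
      rw [A1, A2] at h3
      rcases fin3_cases hab hal hbl i with rfl | rfl | rfl
      · exact nonneg_of_mul_nonneg_right (a := t) (by nlinarith) hb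
      · exact nonneg_of_mul_nonneg_left h1 hb
      · exact h2
  have M2 : ∀ y, y ∈ triSet T₂ ↔
      0 ≤ bary T a y ∧ 0 ≤ bary T l y ∧ t * bary T a y ≤ s * bary T b y := by
    intro y
    rw [mem_triSet]
    constructor
    · intro h
      refine ⟨B1 y ▸ mul_nonneg (h a) ha.le, B3 y ▸ h l, ?_⟩
      rw [B1, B2]
      nlinarith [mul_nonneg ha.le (h b)]
    · rintro ⟨h1, h2, h3⟩ i
      rw [B1] at h1
      rw [B3] at h2
      rw [B1, B2] at h3
      rcases fin3_cases hab hal hbl i with rfl | rfl | rfl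
      · exact nonneg_of_mul_nonneg_left h1 ha
      · exact nonneg_of_mul_nonneg_right (a := s) (by nlinarith) ha
      · exact h2
  refine ⟨T₁, T₂, ?_, ?_, ?_, ?_, ?_, ?_, ?_⟩
  · ext y
    rw [Set.mem_union, M1, M2, mem_triSet]
    constructor
    · rintro (⟨h1, h2, h3⟩ | ⟨h1, h2, h3⟩) i
      · rcases fin3_cases hab hal hbl i with rfl | rfl | rfl
        · exact nonneg_of_mul_nonneg_right (a := t) (by nlinarith) hb
        · exact h1
        · exact h2
      · rcases fin3_cases hab hal hbl i with rfl | rfl | rfl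
        · exact h1
        · exact nonneg_of_mul_nonneg_right (a := s) (by nlinarith) ha
        · exact h2
    · intro h
      rcases le_total (s * bary T b y) (t * bary T a y) with h3 | h3
      · exact Or.inl ⟨h b, h l, h3⟩
      · exact Or.inr ⟨h a, h l, h3⟩
  · rw [Set.disjoint_left]
    intro y h1 h2
    rw [mem_interior_triSet] at h1 h2
    have e1 := A1 y
    have e2 := A2 y
    have e3 := B1 y
    have e4 := B2 y
    have p1 := mul_pos hb (h1 a)
    have p2 := mul_pos ha (h2 b)
    rw [e3] at e2
    rw [e1] at e4
    nlinarith
  · ext y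
    simp only [triVertices, Set.mem_range, Set.mem_insert_iff, Set.mem_singleton_iff]
    constructor
    · rintro ⟨i, rfl⟩
      rw [hT₁, replace_points]
      rcases fin3_cases hab hal hbl i with rfl | rfl | rfl
      · simp [hab]
      · simp
      · simp [hbl.symm]
    · rintro (rfl | rfl | rfl)
      · exact ⟨a, by simp [hT₁, replace_points, hab]⟩
      · exact ⟨b, by simp [hT₁, replace_points]⟩
      · exact ⟨l, by simp [hT₁, replace_points, hbl.symm]⟩
  · ext y
    simp only [triVertices, Set.mem_range, Set.mem_insert_iff, Set.mem_singleton_iff]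
    constructor
    · rintro ⟨i, rfl⟩
      rw [hT₂, replace_points]
      rcases fin3_cases hab hal hbl i with rfl | rfl | rfl
      · simp
      · simp [hab.symm]
      · simp [hal.symm]
    · rintro (rfl | rfl | rfl)
      · exact ⟨a, by simp [hT₂, replace_points]⟩
      · exact ⟨b, by simp [hT₂, replace_points, hab.symm]⟩
      · exact ⟨l, by simp [hT₂, replace_points, hal.symm]⟩
  · rw [M1, bary_self, bary_ne T hbl.symm, bary_ne T hab]
    rintro ⟨_, _, h⟩
    linarith
  · rw [M2, bary_self, bary_ne T hal.symm, bary_ne T hab.symm]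
    rintro ⟨_, _, h⟩
    linarith
  · intro x h1 h2 hx
    rw [M1] at h1
    rw [M2] at h2
    have heq : s * bary T b x = t * bary T a x := le_antisymm h1.2.2 h2.2.2
    have hsum := bary_sum' T hab hal hbl x
    rw [mem_interior_triSet] at hx
    push Not at hx
    obtain ⟨i, hi⟩ := hx
    have habl : bary T l x = 0 ∨ (bary T a x = 0 ∧ bary T b x = 0) := by
      rcases fin3_cases hab hal hbl i with rfl | rfl | rfl
      · right
        have h0 : bary T i x = 0 := le_antisymm hi h2.1
        rw [h0, mul_zero] at heq
        exact ⟨h0, (mul_eq_zero.1 heq).resolve_left ha.ne'⟩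
      · right
        have h0 : bary T i x = 0 := le_antisymm hi h1.1
        rw [h0, mul_zero] at heq
        exact ⟨(mul_eq_zero.1 heq.symm).resolve_left hb.ne', h0⟩
      · left
        exact le_antisymm hi h1.2.1
    rcases habl with h0 | ⟨h0, h0'⟩
    · left
      have e1 : bary T a x = s := by
        have : bary T b x = 1 - bary T a x := by linarith
        rw [this] at heq
        have : t = 1 - s := by linarith
        rw [this] at heq
        linarith
      have e2 : bary T b x = t := by linarith
      refine bary_ext (T := T) fun i => ?_
      rcases fin3_cases hab hal hbl i with rfl | rfl | rfl
      · exact e1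
      · exact e2
      · rw [h0, hl]
    · right
      have e : bary T l x = 1 := by linarith
      refine bary_ext (T := T) fun i => ?_
      rcases fin3_cases hab hal hbl i with rfl | rfl | rfl
      · rw [h0, bary_ne T hal]
      · rw [h0', bary_ne T hbl]
      · rw [e, bary_self]

theorem interior_subset_iff_disjoint {T S : Tri} (h : triSet T ⊆ triSet S) :
    ¬ Disjoint (interior (triSet T)) (interior (triSet S)) := by
  obtain ⟨x, hx⟩ := interior_triSet_nonempty T
  exact fun hd => Set.disjoint_left.1 hd hx (interior_mono h hx)

/-! ### Gluing triangulations -/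

theorem isTriangulation_singleton (T : Tri) : IsTriangulation (triSet T) {T} where
  covers := by simp
  nonoverlapping := by
    intro S hS S' hS' h
    rw [Finset.mem_singleton] at hS hS'
    exact absurd (hS.trans hS'.symm) h

theorem IsTriangulation.subset {Ω : Set Plane} {𝒯 : Finset Tri} (h : IsTriangulation Ω 𝒯)
    {T : Tri} (hT : T ∈ 𝒯) : triSet T ⊆ Ω := by
  rw [← h.covers]
  exact Set.subset_biUnion_of_mem (u := fun T => triSet T) hT

theorem IsTriangulation.exists_mem {Ω : Set Plane} {𝒯 : Finset Tri} (h : IsTriangulation Ω 𝒯)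
    {x : Plane} (hx : x ∈ Ω) : ∃ T ∈ 𝒯, x ∈ triSet T := by
  rw [← h.covers] at hx
  simpa using hx

open Classical in
theorem IsTriangulation.biUnion {Ω : Set Plane} {𝒯 : Finset Tri} (h : IsTriangulation Ω 𝒯)
    {𝒮 : Tri → Finset Tri} (h𝒮 : ∀ T ∈ 𝒯, IsTriangulation (triSet T) (𝒮 T)) :
    IsTriangulation Ω (𝒯.biUnion 𝒮) where
  covers := by
    rw [Finset.set_biUnion_biUnion, ← h.covers]
    exact Set.iUnion₂_congr fun T hT => (h𝒮 T hT).covers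
  nonoverlapping := by
    intro S hS S' hS' hne
    rw [Finset.mem_biUnion] at hS hS'
    obtain ⟨T, hT, hS⟩ := hS
    obtain ⟨T', hT', hS'⟩ := hS'
    by_cases hTT : T = T'
    · subst hTT
      exact (h𝒮 T hT).nonoverlapping S hS S' hS' hne
    · exact (h.nonoverlapping T hT T' hT' hTT).mono
        (interior_mono ((h𝒮 T hT).subset hS)) (interior_mono ((h𝒮 T' hT').subset hS'))

open Classical in
theorem IsTriangulation.pairwiseDisjoint {Ω : Set Plane} {𝒯 : Finset Tri}
    (h : IsTriangulation Ω 𝒯)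
    {𝒮 : Tri → Finset Tri} (h𝒮 : ∀ T ∈ 𝒯, IsTriangulation (triSet T) (𝒮 T)) :
    (𝒯 : Set Tri).PairwiseDisjoint 𝒮 := by
  intro T hT T' hT' hne
  rw [Function.onFun, Finset.disjoint_left]
  intro S hS hS'
  refine interior_subset_iff_disjoint (subset_refl (triSet S)) ?_
  exact (h.nonoverlapping T hT T' hT' hne).mono
        (interior_mono ((h𝒮 T hT).subset hS)) (interior_mono ((h𝒮 T' hT').subset hS'))

open Classical in
theorem IsBisection.isTriangulation {T : Tri} {a b l : Fin 3} {v : Plane} {T₁ T₂ : Tri}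
    (h : IsBisection T a b l v T₁ T₂) : IsTriangulation (triSet T) {T₁, T₂} where
  covers := by simp [h.cover]
  nonoverlapping := by
    intro S hS S' hS' hne
    simp only [Finset.mem_insert, Finset.mem_singleton] at hS hS'
    rcases hS with rfl | rfl <;> rcases hS' with rfl | rfl
    · exact absurd rfl hne
    · exact h.disj
    · exact h.disj.symm
    · exact absurd rfl hne

theorem IsBisection.ne {T : Tri} {a b l : Fin 3} {v : Plane} {T₁ T₂ : Tri}
    (h : IsBisection T a b l v T₁ T₂) : T₁ ≠ T₂ := by
  rintro rfl
  exact interior_subset_iff_disjoint (subset_refl _) h.disj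

theorem IsBisection.subset₁ {T : Tri} {a b l : Fin 3} {v : Plane} {T₁ T₂ : Tri}
    (h : IsBisection T a b l v T₁ T₂) : triSet T₁ ⊆ triSet T := by
  rw [← h.cover]; exact Set.subset_union_left

theorem IsBisection.subset₂ {T : Tri} {a b l : Fin 3} {v : Plane} {T₁ T₂ : Tri}
    (h : IsBisection T a b l v T₁ T₂) : triSet T₂ ⊆ triSet T := by
  rw [← h.cover]; exact Set.subset_union_right

/-! ### Hanging vertices and conformity -/

theorem exists_edge {T : Tri} {v : Plane} (hv : v ∈ triSet T) (hi : v ∉ interior (triSet T))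
    (hn : v ∉ triVertices T) : ∃ a b l : Fin 3, a ≠ b ∧ a ≠ l ∧ b ≠ l ∧ bary T l v = 0 ∧
      0 < bary T a v ∧ 0 < bary T b v := by
  rw [mem_interior_triSet] at hi
  push Not at hi
  obtain ⟨l, hl⟩ := hi
  have h0 := mem_triSet.1 hv
  have hl0 : bary T l v = 0 := le_antisymm hl (h0 l)
  obtain ⟨a, b, hab, hal, hbl⟩ : ∃ a b : Fin 3, a ≠ b ∧ a ≠ l ∧ b ≠ l := by
    clear hl hl0; revert l; decide
  have hs := bary_sum' T hab hal hbl v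
  refine ⟨a, b, l, hab, hal, hbl, hl0, lt_of_le_of_ne (h0 a) ?_, lt_of_le_of_ne (h0 b) ?_⟩
  · intro ha
    exact hn ⟨b, (mem_triVertices_of_bary (i := b) hv (by linarith)).symm⟩
  · intro hb
    exact hn ⟨a, (mem_triVertices_of_bary (i := a) hv (by linarith)).symm⟩

open Classical in
/-- The points of `V` which lie on `T` without being vertices of `T`. -/
noncomputable def hanging (V : Finset Plane) (T : Tri) : Finset Plane :=
  V.filter fun v => v ∈ triSet T ∧ v ∉ triVertices T

theorem mem_hanging {V : Finset Plane} {T : Tri} {v : Plane} :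
    v ∈ hanging V T ↔ v ∈ V ∧ v ∈ triSet T ∧ v ∉ triVertices T := by
  simp [hanging]

open Classical in
-- Away from the interior of `T` the halves meet only at `v` and at the vertex `l`, which are
-- vertices of both. So every other hanging point hangs on exactly one half, and `v` no longer
-- hangs.
theorem IsBisection.hanging_card {T : Tri} {a b l : Fin 3} {v : Plane} {T₁ T₂ : Tri}
    (h : IsBisection T a b l v T₁ T₂) (hab : a ≠ b) (hal : a ≠ l) (hbl : b ≠ l)
    {V : Finset Plane} (hV : ∀ w ∈ V, w ∉ interior (triSet T)) (hv : v ∈ hanging V T) :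
    (hanging V T₁).card + (hanging V T₂).card + 1 = (hanging V T).card := by
  have hdisj : Disjoint (hanging V T₁) (hanging V T₂) := by
    rw [Finset.disjoint_left]
    intro w h1 h2
    rw [mem_hanging] at h1 h2
    have := h1.2.2
    rw [h.vert₁] at this
    rcases h.inter w h1.2.1 h2.2.1 (hV w h1.1) with rfl | rfl <;> simp at this
  have hunion : hanging V T₁ ∪ hanging V T₂ = (hanging V T).erase v := by
    ext w
    rw [Finset.mem_union, Finset.mem_erase, mem_hanging, mem_hanging, mem_hanging, h.vert₁, h.vert₂]
    constructor
    · rintro (⟨h1, h2, h3⟩ | ⟨h1, h2, h3⟩)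
      · simp only [Set.mem_insert_iff, Set.mem_singleton_iff, not_or] at h3
        refine ⟨h3.2.1, h1, h.subset₁ h2, ?_⟩
        rintro ⟨i, rfl⟩
        rcases fin3_cases hab hal hbl i with rfl | rfl | rfl
        · exact h3.1 rfl
        · exact h.notMem₁ h2
        · exact h3.2.2 rfl
      · simp only [Set.mem_insert_iff, Set.mem_singleton_iff, not_or] at h3
        refine ⟨h3.1, h1, h.subset₂ h2, ?_⟩
        rintro ⟨i, rfl⟩
        rcases fin3_cases hab hal hbl i with rfl | rfl | rfl
        · exact h.notMem₂ h2
        · exact h3.2.1 rfl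
        · exact h3.2.2 rfl
    · rintro ⟨h1, h2, h3, h4⟩
      have hp : ∀ i, w ≠ T.points i := fun i hi => h4 ⟨i, hi.symm⟩
      rw [← h.cover] at h3
      rcases h3 with h3 | h3
      · left
        simp [h2, h3, h1, hp]
      · right
        simp [h2, h3, h1, hp]
  rw [← Finset.card_union_of_disjoint hdisj, hunion, Finset.card_erase_add_one hv]

open Classical in
-- Bisecting at one hanging point after another adds exactly one triangle per point. The exact count
-- is what later allows the number of triangles to be prescribed, and the last clause keeps
-- triangles without hanging points intact.
theorem exists_split (V : Finset Plane) (T : Tri) (hV : ∀ w ∈ V, w ∉ interior (triSet T)) :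
    ∃ 𝒮 : Finset Tri, IsTriangulation (triSet T) 𝒮 ∧ 𝒮.card = (hanging V T).card + 1 ∧
      (∀ S ∈ 𝒮, triVertices S ⊆ triVertices T ∪ V) ∧ (∀ S ∈ 𝒮, hanging V S = ∅) ∧
      (hanging V T = ∅ → 𝒮 = {T}) := by
  induction hn : (hanging V T).card using Nat.strong_induction_on generalizing T with
  | _ n ih =>
    rcases (hanging V T).eq_empty_or_nonempty with h0 | ⟨v, hv⟩
    · refine ⟨{T}, isTriangulation_singleton T, ?_, ?_, ?_, fun _ => rfl⟩
      · rw [← hn, h0]; rfl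
      · intro S hS
        rw [Finset.mem_singleton.1 hS]
        exact Set.subset_union_left
      · intro S hS
        rw [Finset.mem_singleton.1 hS, h0]
    · have hv' := mem_hanging.1 hv
      obtain ⟨a, b, l, hab, hal, hbl, hl, ha, hb⟩ := exists_edge hv'.2.1 (hV v hv'.1) hv'.2.2
      obtain ⟨T₁, T₂, h⟩ := exists_bisection T hab hal hbl hl ha hb
      have hcard := h.hanging_card hab hal hbl hV hv
      have key : ∀ S ∈ ({T₁, T₂} : Finset Tri), ∃ 𝒮 : Finset Tri, IsTriangulation (triSet S) 𝒮 ∧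
          𝒮.card = (hanging V S).card + 1 ∧
          (∀ S' ∈ 𝒮, triVertices S' ⊆ triVertices S ∪ V) ∧ (∀ S' ∈ 𝒮, hanging V S' = ∅) := by
        intro S hS
        simp only [Finset.mem_insert, Finset.mem_singleton] at hS
        have hsub : triSet S ⊆ triSet T := by
          rcases hS with rfl | rfl
          · exact h.subset₁
          · exact h.subset₂
        have hlt : (hanging V S).card < n := by
          rcases hS with rfl | rfl <;> omega
        obtain ⟨𝒮, h1, h2, h3, h4, -⟩ := ih _ hlt S
          (fun w hw hi => hV w hw (interior_mono hsub hi)) rfl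
        exact ⟨𝒮, h1, h2, h3, h4⟩
      choose! 𝒮 k1 k2 k3 k4 using key
      refine ⟨({T₁, T₂} : Finset Tri).biUnion 𝒮, h.isTriangulation.biUnion k1, ?_, ?_, ?_, ?_⟩
      · rw [Finset.card_biUnion (h.isTriangulation.pairwiseDisjoint k1), Finset.sum_pair h.ne,
          k2 _ (by simp), k2 _ (by simp)]
        omega
      · intro S hS
        obtain ⟨S', hS', hS⟩ := Finset.mem_biUnion.1 hS
        refine (k3 S' hS' S hS).trans (Set.union_subset ?_ Set.subset_union_right)
        have hp : ∀ i, T.points i ∈ triVertices T ∪ V := fun i => Or.inl ⟨i, rfl⟩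
        have hvV : v ∈ triVertices T ∪ V := Or.inr hv'.1
        simp only [Finset.mem_insert, Finset.mem_singleton] at hS'
        rcases hS' with rfl | rfl
        · rw [h.vert₁]
          rintro x (rfl | rfl | rfl)
          exacts [hp _, hvV, hp _]
        · rw [h.vert₂]
          rintro x (rfl | rfl | rfl)
          exacts [hvV, hp _, hp _]
      · intro S hS
        obtain ⟨S', hS', hS⟩ := Finset.mem_biUnion.1 hS
        exact k4 S' hS' S hS
      · intro h0
        rw [h0] at hv
        simp at hv

theorem disjoint_interior_left {T T' : Tri}
    (hd : Disjoint (interior (triSet T)) (interior (triSet T'))) :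
    Disjoint (interior (triSet T)) (triSet T') := by
  rw [← closure_interior_triSet T']
  exact hd.closure_right isOpen_interior

theorem bary_lineMap (T : Tri) (i : Fin 3) (x y : Plane) (s : ℝ) :
    bary T i (AffineMap.lineMap x y s) = (1 - s) * bary T i x + s * bary T i y := by
  rw [AffineMap.apply_lineMap, AffineMap.lineMap_apply_ring']
  ring

theorem lineMap_edge (T : Tri) {a b l : Fin 3} (hab : a ≠ b) (hal : a ≠ l) (hbl : b ≠ l)
    {y : Plane} (hy : bary T l y = 0) :
    y = AffineMap.lineMap (T.points a) (T.points b) (bary T b y) := by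
  have hs := bary_sum' T hab hal hbl y
  refine bary_ext (T := T) fun i => ?_
  rw [bary_lineMap]
  rcases fin3_cases hab hal hbl i with rfl | rfl | rfl
  · rw [bary_self, bary_ne T hab]; linarith
  · rw [bary_self, bary_ne T hab.symm]; linarith
  · rw [bary_ne T hal.symm, bary_ne T hbl.symm, hy]; ring

/-- If the two edges through `x` crossed transversally, moving slightly along the edge of `T'` in
the right direction would lead into the interior of `T`. -/
theorem bary_edge_zero {T T' : Tri} (hd : Disjoint (interior (triSet T)) (interior (triSet T')))
    {a b l a' b' l' : Fin 3} (hab : a ≠ b) (hal : a ≠ l) (hbl : b ≠ l)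
    (hab' : a' ≠ b') (hal' : a' ≠ l') (hbl' : b' ≠ l') {x : Plane}
    (hl : bary T l x = 0) (ha : 0 < bary T a x) (hb : 0 < bary T b x)
    (hl' : bary T' l' x = 0) (ha' : 0 < bary T' a' x) (hb' : 0 < bary T' b' x) :
    bary T l (T'.points a') = bary T l (T'.points b') := by
  set γ : ℝ → Plane := fun s => AffineMap.lineMap (T'.points a') (T'.points b') s with hγ
  have hγc : Continuous γ := AffineMap.lineMap_continuous
  set s₀ := bary T' b' x
  have hx : γ s₀ = x := (lineMap_edge T' hab' hal' hbl' hl').symm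
  have hs₀ : s₀ < 1 := by
    have := bary_sum' T' hab' hal' hbl' x
    linarith
  by_contra hne
  have hev : ∀ i : Fin 3, 0 < bary T i x → ∀ᶠ s in nhds s₀, 0 < bary T i (γ s) := fun i hi =>
    (((continuous_affineMap (bary T i)).comp hγc).tendsto s₀).eventually_const_lt
      (by simpa [hx] using hi)
  have hev2 : ∀ᶠ s in nhds s₀, 0 < s ∧ s < 1 :=
    (eventually_gt_nhds hb').and (eventually_lt_nhds hs₀)
  have hev3 := ((hev a ha).and (hev b hb)).and hev2
  obtain ⟨ε, hε, hball⟩ := Metric.eventually_nhds_iff.1 hev3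
  have hlin : ∀ s, bary T l (γ s) =
      (s - s₀) * (bary T l (T'.points b') - bary T l (T'.points a')) := by
    intro s
    have h1 := bary_lineMap T l (T'.points a') (T'.points b') s
    have h2 := bary_lineMap T l (T'.points a') (T'.points b') s₀
    change bary T l (γ s₀) = _ at h2
    rw [hx, hl] at h2
    change bary T l (γ s) = _ at h1
    rw [h1]
    linarith
  obtain ⟨s, hs, hpos⟩ : ∃ s, dist s s₀ < ε ∧ 0 < bary T l (γ s) := by
    rcases lt_or_gt_of_ne hne with h | h
    · refine ⟨s₀ + ε / 2, ?_, ?_⟩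
      · rw [Real.dist_eq, add_sub_cancel_left, abs_of_pos (half_pos hε)]; linarith
      · rw [hlin]; exact mul_pos (by linarith) (by linarith)
    · refine ⟨s₀ - ε / 2, ?_, ?_⟩
      · rw [Real.dist_eq, sub_sub_cancel_left, abs_neg, abs_of_pos (half_pos hε)]; linarith
      · rw [hlin]; exact mul_pos_of_neg_of_neg (by linarith) (by linarith)
  obtain ⟨⟨h1, h2⟩, h3, h4⟩ := hball hs
  refine Set.disjoint_left.1 (disjoint_interior_left hd) (?_ : γ s ∈ _) ?_
  · rw [mem_interior_triSet]
    intro i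
    rcases fin3_cases hab hal hbl i with rfl | rfl | rfl <;> assumption
  · exact (convex_triSet T').lineMap_mem (points_mem T' a') (points_mem T' b') ⟨h3.le, h4.le⟩

/-- Conformity reduces to the absence of hanging vertices: a common point that is no vertex lies
inside an edge of each triangle, these edges are collinear, and without hanging vertices they
coincide. -/
theorem inter_eq_convexHull {T T' : Tri}
    (hd : Disjoint (interior (triSet T)) (interior (triSet T')))
    (h1 : ∀ v ∈ triVertices T, v ∈ triSet T' → v ∈ triVertices T')
    (h2 : ∀ v ∈ triVertices T', v ∈ triSet T → v ∈ triVertices T) :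
    triSet T ∩ triSet T' = convexHull ℝ (triVertices T ∩ triVertices T') := by
  apply Set.Subset.antisymm
  swap
  · exact Set.subset_inter (convexHull_mono Set.inter_subset_left)
      (convexHull_mono Set.inter_subset_right)
  rintro x ⟨hx, hx'⟩
  by_cases hv : x ∈ triVertices T
  · exact subset_convexHull ℝ _ ⟨hv, h1 x hv hx'⟩
  by_cases hv' : x ∈ triVertices T'
  · exact subset_convexHull ℝ _ ⟨h2 x hv' hx, hv'⟩
  obtain ⟨a, b, l, hab, hal, hbl, hl, ha, hb⟩ := exists_edge hx
    (fun hi => Set.disjoint_left.1 (disjoint_interior_left hd) hi hx') hv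
  obtain ⟨a', b', l', hab', hal', hbl', hl', ha', hb'⟩ := exists_edge hx'
    (fun hi => Set.disjoint_left.1 (disjoint_interior_left hd.symm) hi hx) hv'
  wlog hle : bary T b (T'.points a') ≤ bary T b (T'.points b') generalizing a' b'
  · exact this b' a' hab'.symm hbl' hal' hb' ha' (le_of_not_ge hle)
  have hxl' := lineMap_edge T' hab' hal' hbl' hl'
  have hsum' := bary_sum' T' hab' hal' hbl' x
  have hsum := bary_sum' T hab hal hbl x
  set s := bary T' b' x with hs
  have hz := bary_edge_zero hd hab hal hbl hab' hal' hbl' hl ha hb hl' ha' hb'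
  have hza : bary T l (T'.points a') = 0 := by
    have := bary_lineMap T l (T'.points a') (T'.points b') s
    rw [← hxl', hl, ← hz] at this
    linarith
  have hzb : bary T l (T'.points b') = 0 := by rw [← hz, hza]
  -- On the common line, `bary T b` is a parameter in which the edge of `T` is `[0, 1]` and the edge
  -- of `T'` is `[α, β]`. The goal is `α = 0` and `β = 1`.
  set α := bary T b (T'.points a') with hα
  set β := bary T b (T'.points b') with hβ
  have hξ : bary T b x = (1 - s) * α + s * β := by
    have := bary_lineMap T b (T'.points a') (T'.points b') s
    rwa [← hxl'] at this
  have hs1 : s < 1 := by linarith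
  have haξ : α ≤ bary T b x := by rw [hξ]; nlinarith
  have hbξ : bary T b x ≤ β := by rw [hξ]; nlinarith
  have hxlt : bary T b x < 1 := by linarith
  have suma := bary_sum' T hab hal hbl (T'.points a')
  have sumb := bary_sum' T hab hal hbl (T'.points b')
  -- a vertex of `T` strictly inside the edge of `T'` is impossible
  have noV : ∀ y ∈ triVertices T, bary T l y = 0 → α < bary T b y → bary T b y < β → False := by
    intro y hy hyl h3 h4
    set r := (bary T b y - α) / (β - α) with hr
    have hr0 : 0 < r := div_pos (by linarith) (by linarith)
    have hr1 : r < 1 := by rw [hr, div_lt_one (by linarith)]; linarith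
    have hyr : y = AffineMap.lineMap (T'.points a') (T'.points b') r := by
      have e : bary T b y = (1 - r) * α + r * β := by
        have : r * (β - α) = bary T b y - α := div_mul_cancel₀ _ (by linarith)
        linarith
      have sumy := bary_sum' T hab hal hbl y
      refine bary_ext (T := T) fun i => ?_
      rw [bary_lineMap]
      rcases fin3_cases hab hal hbl i with rfl | rfl | rfl
      · have e1 : bary T i y = 1 - bary T b y := by linarith
        have e2 : bary T i (T'.points a') = 1 - α := by linarith
        have e3 : bary T i (T'.points b') = 1 - β := by linarith
        rw [e1, e2, e3, e]; ring
      · exact e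
      · rw [hyl, hza, hzb]; ring
    have hyT' : y ∈ triSet T' := by
      rw [hyr]
      exact (convex_triSet T').lineMap_mem (points_mem T' a') (points_mem T' b') ⟨hr0.le, hr1.le⟩
    obtain ⟨i, hi⟩ := h1 y hy hyT'
    have c1 : bary T' a' y = 1 - r := by
      rw [hyr, bary_lineMap, bary_self, bary_ne T' hab']; ring
    have c2 : bary T' b' y = r := by
      rw [hyr, bary_lineMap, bary_self, bary_ne T' hab'.symm]; ring
    rw [← hi, bary_points] at c1 c2
    split_ifs at c1 c2 <;> linarith
  have Tmem : ∀ y, bary T l y = 0 → 0 ≤ bary T b y → bary T b y ≤ 1 → y ∈ triSet T := by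
    intro y h3 h4 h5
    rw [mem_triSet]
    have sumy := bary_sum' T hab hal hbl y
    intro i
    rcases fin3_cases hab hal hbl i with rfl | rfl | rfl <;> linarith
  have hvert01 : ∀ y ∈ triVertices T, bary T b y = 0 ∨ bary T b y = 1 := by
    rintro y ⟨i, rfl⟩
    rw [bary_points]
    split_ifs <;> simp
  have hα0 : α = 0 := by
    rcases lt_or_ge α 0 with hneg | hpos
    · refine (noV (T.points a) ⟨a, rfl⟩ (bary_ne T hal.symm) ?_ ?_).elim
      · rwa [bary_ne T hab.symm]
      · rw [bary_ne T hab.symm]; linarith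
    · rcases hvert01 _ (h2 _ (points_mem_triVertices T' a') (Tmem _ hza hpos (by linarith)))
        with h | h
      · exact h
      · linarith
  have hβ1 : β = 1 := by
    rcases lt_or_ge 1 β with hneg | hpos
    · refine (noV (T.points b) ⟨b, rfl⟩ (bary_ne T hbl.symm) ?_ ?_).elim
      · rw [bary_self]; linarith
      · rwa [bary_self]
    · rcases hvert01 _ (h2 _ (points_mem_triVertices T' b') (Tmem _ hzb (by linarith) hpos))
        with h | h
      · linarith
      · exact h
  have ea : T'.points a' = T.points a := by
    rw [lineMap_edge T hab hal hbl hza, ← hα, hα0, AffineMap.lineMap_apply_zero]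
  have eb : T'.points b' = T.points b := by
    rw [lineMap_edge T hab hal hbl hzb, ← hβ, hβ1, AffineMap.lineMap_apply_one]
  rw [hxl', ea, eb]
  have ma : T.points a ∈ triVertices T ∩ triVertices T' := ⟨⟨a, rfl⟩, ⟨a', ea⟩⟩
  have mb : T.points b ∈ triVertices T ∩ triVertices T' := ⟨⟨b, rfl⟩, ⟨b', eb⟩⟩
  exact (convex_convexHull ℝ _).lineMap_mem (subset_convexHull ℝ _ ma)
    (subset_convexHull ℝ _ mb) ⟨hb'.le, hs1.le⟩

/-! ### Points of the boundary of a triangulated set -/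

theorem IsTriangulation.isCompact {Ω : Set Plane} {𝒯 : Finset Tri} (h : IsTriangulation Ω 𝒯) :
    IsCompact Ω := by
  rw [← h.covers]
  exact 𝒯.finite_toSet.isCompact_biUnion fun T _ => isCompact_triSet T

/-- Points outside `Ω` close to `x` lie beyond the edge through `x` of each of the two triangles, so
their reflections in `x` lie in both interiors. -/
theorem IsTriangulation.eq_of_mem_frontier {Ω : Set Plane} {𝒯 : Finset Tri}
    (h : IsTriangulation Ω 𝒯) {x : Plane} (hx : x ∈ frontier Ω) {T T' : Tri} (hT : T ∈ 𝒯)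
    (hT' : T' ∈ 𝒯) (hxT : x ∈ triSet T) (hxT' : x ∈ triSet T') (hv : x ∉ triVertices T)
    (hv' : x ∉ triVertices T') : T = T' := by
  by_contra hne
  have hd := h.nonoverlapping T hT T' hT' hne
  obtain ⟨a, b, l, hab, hal, hbl, hl, ha, hb⟩ := exists_edge hxT
    (fun hi => hx.2 (interior_mono (h.subset hT) hi)) hv
  obtain ⟨a', b', l', hab', hal', hbl', hl', ha', hb'⟩ := exists_edge hxT'
    (fun hi => hx.2 (interior_mono (h.subset hT') hi)) hv'
  have hfreq : ∃ᶠ y in nhds x, y ∉ Ω := by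
    intro hev
    apply hx.2
    rw [mem_interior_iff_mem_nhds]
    filter_upwards [hev] with y hy
    exact not_not.1 hy
  have hev : ∀ (T : Tri) (i : Fin 3), 0 < bary T i x → ∀ᶠ y in nhds x, 0 < bary T i y :=
    fun T i hi => ((continuous_affineMap (bary T i)).tendsto x).eventually_const_lt hi
  have href : Tendsto (fun y : Plane => x + (x - y)) (nhds x) (nhds x) := by
    have : Continuous (fun y : Plane => x + (x - y)) := by fun_prop
    simpa using this.tendsto x
  have hrefl : ∀ (T : Tri) (i : Fin 3), bary T i x = 0 → ∀ y,
      bary T i (x + (x - y)) = - bary T i y := by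
    intro T i hi y
    have : x + (x - y) = AffineMap.lineMap y x (2 : ℝ) := by
      rw [AffineMap.lineMap_apply_module]
      module
    rw [this, bary_lineMap, hi]
    ring
  obtain ⟨y, hy, ⟨h1, h2, h3, h4⟩, h1', h2', h3', h4'⟩ := (hfreq.and_eventually
    (((hev T a ha).and ((hev T b hb).and ((hev T' a' ha').and (hev T' b' hb')))).and
    (href.eventually
      ((hev T a ha).and ((hev T b hb).and ((hev T' a' ha').and (hev T' b' hb'))))))).exists
  have k1 : bary T l y < 0 := by
    by_contra hc
    refine hy (h.subset hT (mem_triSet.2 fun i => ?_))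
    rcases fin3_cases hab hal hbl i with rfl | rfl | rfl <;> linarith
  have k2 : bary T' l' y < 0 := by
    by_contra hc
    refine hy (h.subset hT' (mem_triSet.2 fun i => ?_))
    rcases fin3_cases hab' hal' hbl' i with rfl | rfl | rfl <;> linarith
  refine Set.disjoint_left.1 hd (?_ : x + (x - y) ∈ _) ?_
  · rw [mem_interior_triSet]
    intro i
    rcases fin3_cases hab hal hbl i with rfl | rfl | rfl
    · exact h1'
    · exact h2'
    · rw [hrefl T _ hl]; linarith
  · rw [mem_interior_triSet]
    intro i
    rcases fin3_cases hab' hal' hbl' i with rfl | rfl | rfl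
    · exact h3'
    · exact h4'
    · rw [hrefl T' _ hl']; linarith

theorem one_lt_rank_plane : 1 < Module.rank ℝ Plane := by
  rw [← Module.finrank_eq_rank]
  simp

theorem infinite_of_isOpen_nonempty {s : Set Plane} (hs : IsOpen s) (hne : s.Nonempty) :
    s.Infinite := by
  obtain ⟨x, hx⟩ := hne
  exact infinite_of_mem_nhds x (hs.mem_nhds hx)

/-- The plane minus a finite set is connected, so a finite boundary could not separate the interior
of `Ω` from its complement. -/
theorem infinite_frontier_diff {Ω : Set Plane} (hc : IsCompact Ω) (hi : (interior Ω).Nonempty)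
    {V : Set Plane} (hV : V.Finite) : (frontier Ω \ V).Infinite := by
  intro hfin
  have hfin2 := hV.union hfin
  have hpre := (hfin2.countable.isConnected_compl_of_one_lt_rank one_lt_rank_plane).isPreconnected
  have h1 : ((V ∪ frontier Ω \ V)ᶜ ∩ interior Ω).Nonempty := by
    obtain ⟨y, hy, hyn⟩ := (infinite_of_isOpen_nonempty isOpen_interior hi).exists_notMem_finite hfin2
    exact ⟨y, hyn, hy⟩
  have h2 : ((V ∪ frontier Ω \ V)ᶜ ∩ Ωᶜ).Nonempty := by
    have hne : Ωᶜ.Nonempty := by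
      rw [Set.nonempty_compl]
      rintro rfl
      exact noncompact_univ Plane hc
    obtain ⟨y, hy, hyn⟩ :=
      (infinite_of_isOpen_nonempty hc.isClosed.isOpen_compl hne).exists_notMem_finite hfin2
    exact ⟨y, hyn, hy⟩
  have hcov : (V ∪ frontier Ω \ V)ᶜ ⊆ interior Ω ∪ Ωᶜ := by
    intro x hx
    by_contra hcon
    simp only [Set.mem_union, Set.mem_compl_iff, not_or, not_not] at hcon
    refine hx ?_
    by_cases hxV : x ∈ V
    · exact Or.inl hxV
    · exact Or.inr ⟨⟨subset_closure hcon.2, hcon.1⟩, hxV⟩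
  obtain ⟨x, -, hx1, hx2⟩ := hpre _ _ isOpen_interior hc.isClosed.isOpen_compl hcov h1 h2
  exact hx2 (interior_subset hx1)

/-- An unlimited supply of points at which a single triangle can be bisected without creating a
hanging vertex on any other triangle. They serve to adjust the number of triangles. -/
theorem IsTriangulation.exists_infinite_boundary {Ω : Set Plane} {𝒯 : Finset Tri}
    (h : IsTriangulation Ω 𝒯) (hne : 𝒯.Nonempty) :
    ∃ T ∈ 𝒯, {x | x ∈ triSet T ∧ x ∉ interior (triSet T) ∧ (∀ T' ∈ 𝒯, x ∉ triVertices T') ∧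
      ∀ T' ∈ 𝒯, T' ≠ T → x ∉ triSet T'}.Infinite := by
  obtain ⟨T₀, hT₀⟩ := hne
  set V : Set Plane := ⋃ T ∈ 𝒯, triVertices T
  have hV : V.Finite := 𝒯.finite_toSet.biUnion fun T _ => finite_triVertices T
  have hinf := infinite_frontier_diff h.isCompact
    ((interior_triSet_nonempty T₀).mono (interior_mono (h.subset hT₀))) hV
  by_contra! hcon
  refine hinf (Set.Finite.subset (𝒯.finite_toSet.biUnion hcon) ?_)
  rintro x ⟨hx, hxV⟩
  have hxV' : ∀ T' ∈ 𝒯, x ∉ triVertices T' := fun T' hT' hxT' =>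
    hxV (Set.mem_biUnion hT' hxT')
  obtain ⟨T, hT, hxT⟩ := h.exists_mem (h.isCompact.isClosed.frontier_subset hx)
  refine Set.mem_biUnion hT ⟨hxT, fun hi => hx.2 (interior_mono (h.subset hT) hi), hxV', ?_⟩
  intro T' hT' hne hxT'
  exact hne (h.eq_of_mem_frontier hx hT' hT hxT' hxT (hxV' _ hT') (hxV' _ hT))

/-! ### Conforming refinements -/

theorem vertex_notMem_interior (T : Tri) (i : Fin 3) : T.points i ∉ interior (triSet T) := by
  intro h
  rw [mem_interior_triSet] at h
  have h1 := h (i + 1)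
  rw [bary_ne T (by clear h h1; revert i; decide)] at h1
  exact lt_irrefl _ h1

open Classical in
/-- The set of all vertices of the triangles of a finite family. -/
noncomputable def vertexFinset (𝒯 : Finset Tri) : Finset Plane :=
  𝒯.biUnion fun T => Finset.univ.image T.points

theorem mem_vertexFinset {𝒯 : Finset Tri} {v : Plane} :
    v ∈ vertexFinset 𝒯 ↔ ∃ T ∈ 𝒯, v ∈ triVertices T := by
  simp [vertexFinset, triVertices]

theorem IsTriangulation.vertexFinset_notMem_interior {Ω : Set Plane} {𝒯 : Finset Tri}
    (h : IsTriangulation Ω 𝒯) {v : Plane} (hv : v ∈ vertexFinset 𝒯) {T : Tri} (hT : T ∈ 𝒯) :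
    v ∉ interior (triSet T) := by
  obtain ⟨T', hT', hv⟩ := mem_vertexFinset.1 hv
  intro hi
  by_cases hne : T = T'
  · subst hne
    obtain ⟨i, rfl⟩ := hv
    exact vertex_notMem_interior T i hi
  · exact Set.disjoint_left.1 (disjoint_interior_left (h.nonoverlapping T hT T' hT' hne)) hi
      (triVertices_subset T' hv)

open Classical in
-- Splitting creates no vertex outside `V`, and afterwards no point of `V` hangs on any piece. Hence
-- a single pass suffices.
theorem IsTriangulation.exists_conforming {Ω : Set Plane} {𝒯 : Finset Tri}
    (h : IsTriangulation Ω 𝒯) (V : Finset Plane) (hV : vertexFinset 𝒯 ⊆ V)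
    (hint : ∀ v ∈ V, ∀ T ∈ 𝒯, v ∉ interior (triSet T)) :
    ∃ 𝒮 : Tri → Finset Tri, (∀ T ∈ 𝒯, IsTriangulation (triSet T) (𝒮 T)) ∧
      (∀ T ∈ 𝒯, hanging V T = ∅ → 𝒮 T = {T}) ∧ IsConforming (𝒯.biUnion 𝒮) ∧
      (𝒯.biUnion 𝒮).card = ∑ T ∈ 𝒯, ((hanging V T).card + 1) := by
  choose! 𝒮 k1 k2 k3 k4 k5 using fun T (hT : T ∈ 𝒯) =>
    exists_split V T (fun v hv => hint v hv T hT)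
  refine ⟨𝒮, k1, k5, ?_, ?_⟩
  · have hvert : ∀ S ∈ 𝒯.biUnion 𝒮, ∀ v ∈ triVertices S, v ∈ V := by
      intro S hS v hv
      obtain ⟨T, hT, hS⟩ := Finset.mem_biUnion.1 hS
      rcases k3 T hT S hS hv with hv | hv
      · exact hV (mem_vertexFinset.2 ⟨T, hT, hv⟩)
      · exact hv
    have hhang : ∀ S ∈ 𝒯.biUnion 𝒮, ∀ v ∈ V, v ∈ triSet S → v ∈ triVertices S := by
      intro S hS v hv hvS
      obtain ⟨T, hT, hS⟩ := Finset.mem_biUnion.1 hS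
      by_contra hn
      have : v ∈ hanging V S := mem_hanging.2 ⟨hv, hvS, hn⟩
      rw [k4 T hT S hS] at this
      simp at this
    intro S hS S' hS' hne
    exact inter_eq_convexHull ((h.biUnion k1).nonoverlapping S hS S' hS' hne)
      (fun v hv hv' => hhang S' hS' v (hvert S hS v hv) hv')
      (fun v hv hv' => hhang S hS v (hvert S' hS' v hv) hv')
  · rw [Finset.card_biUnion (h.pairwiseDisjoint k1)]
    exact Finset.sum_congr rfl fun T hT => k2 T hT

/-! ### Cutting triangles by lines -/

/-- An affine function does not change its sign on a set. -/
def OneSided (g : Plane →ᵃ[ℝ] ℝ) (s : Set Plane) : Prop :=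
  (∀ x ∈ s, 0 ≤ g x) ∨ ∀ x ∈ s, g x ≤ 0

theorem OneSided.mono {g : Plane →ᵃ[ℝ] ℝ} {s t : Set Plane} (h : OneSided g t) (hst : s ⊆ t) :
    OneSided g s :=
  h.imp (fun h x hx => h x (hst hx)) (fun h x hx => h x (hst hx))

theorem oneSided_of_nonneg {g : Plane →ᵃ[ℝ] ℝ} {T : Tri} (h : ∀ v ∈ triVertices T, 0 ≤ g v) :
    OneSided g (triSet T) :=
  Or.inl (affine_nonneg_on_tri g T fun i => h _ ⟨i, rfl⟩)

theorem oneSided_of_nonpos {g : Plane →ᵃ[ℝ] ℝ} {T : Tri} (h : ∀ v ∈ triVertices T, g v ≤ 0) :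
    OneSided g (triSet T) := by
  refine Or.inr fun x hx => ?_
  have := affine_nonneg_on_tri (-g) T (fun i => by simpa using h _ ⟨i, rfl⟩) x hx
  simpa using this

theorem exists_bisection_zero (T : Tri) (g : Plane →ᵃ[ℝ] ℝ) {a b l : Fin 3} (hab : a ≠ b)
    (hal : a ≠ l) (hbl : b ≠ l) (ha : 0 < g (T.points a)) (hb : g (T.points b) < 0) :
    ∃ v T₁ T₂, g v = 0 ∧ IsBisection T a b l v T₁ T₂ := by
  set s := g (T.points a) / (g (T.points a) - g (T.points b)) with hs
  have hpos : 0 < g (T.points a) - g (T.points b) := by linarith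
  have hs0 : 0 < s := div_pos ha hpos
  have hs1 : s < 1 := by rw [hs, div_lt_one hpos]; linarith
  set v : Plane := AffineMap.lineMap (T.points a) (T.points b) s with hv
  have h1 : bary T l v = 0 := by
    rw [hv, bary_lineMap, bary_ne T hal.symm, bary_ne T hbl.symm]; ring
  have h2 : bary T a v = 1 - s := by
    rw [hv, bary_lineMap, bary_self, bary_ne T hab]; ring
  have h3 : bary T b v = s := by
    rw [hv, bary_lineMap, bary_self, bary_ne T hab.symm]; ring
  obtain ⟨T₁, T₂, h⟩ := exists_bisection T hab hal hbl h1 (by rw [h2]; linarith) (by rwa [h3])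
  refine ⟨v, T₁, T₂, ?_, h⟩
  rw [hv, AffineMap.apply_lineMap, AffineMap.lineMap_apply_ring', hs]
  field_simp
  ring

open Classical in
theorem exists_cut_of_zero (T : Tri) (g : Plane →ᵃ[ℝ] ℝ) (l : Fin 3) (hl : g (T.points l) = 0) :
    ∃ 𝒮 : Finset Tri, IsTriangulation (triSet T) 𝒮 ∧ 𝒮.card ≤ 2 ∧
      ∀ S ∈ 𝒮, OneSided g (triSet S) := by
  have single : OneSided g (triSet T) → ∃ 𝒮 : Finset Tri, IsTriangulation (triSet T) 𝒮 ∧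
      𝒮.card ≤ 2 ∧ ∀ S ∈ 𝒮, OneSided g (triSet S) := fun h =>
    ⟨{T}, isTriangulation_singleton T, by simp, by simpa using h⟩
  have double : ∀ a b : Fin 3, a ≠ b → a ≠ l → b ≠ l → 0 < g (T.points a) →
      g (T.points b) < 0 → ∃ 𝒮 : Finset Tri, IsTriangulation (triSet T) 𝒮 ∧
      𝒮.card ≤ 2 ∧ ∀ S ∈ 𝒮, OneSided g (triSet S) := by
    intro a b hab hal hbl ha hb
    obtain ⟨v, T₁, T₂, hv, h⟩ := exists_bisection_zero T g hab hal hbl ha hb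
    refine ⟨{T₁, T₂}, h.isTriangulation, Finset.card_le_two, ?_⟩
    intro S hS
    simp only [Finset.mem_insert, Finset.mem_singleton] at hS
    rcases hS with rfl | rfl
    · refine oneSided_of_nonneg ?_
      rw [h.vert₁]
      rintro x (rfl | rfl | rfl)
      exacts [ha.le, hv.ge, hl.ge]
    · refine oneSided_of_nonpos ?_
      rw [h.vert₂]
      rintro x (rfl | rfl | rfl)
      exacts [hv.le, hb.le, hl.le]
  obtain ⟨a, b, hab, hal, hbl⟩ : ∃ a b : Fin 3, a ≠ b ∧ a ≠ l ∧ b ≠ l := by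
    clear hl single double; revert l; decide
  rcases lt_or_ge 0 (g (T.points a)) with h1 | h1
  · rcases lt_or_ge (g (T.points b)) 0 with h2 | h2
    · exact double a b hab hal hbl h1 h2
    · refine single (oneSided_of_nonneg ?_)
      rintro _ ⟨i, rfl⟩
      rcases fin3_cases hab hal hbl i with rfl | rfl | rfl
      exacts [h1.le, h2, hl.ge]
  · rcases lt_or_ge 0 (g (T.points b)) with h2 | h2
    · rcases h1.lt_or_eq with h1 | h1
      · exact double b a hab.symm hbl hal h2 h1
      · refine single (oneSided_of_nonneg ?_)
        rintro _ ⟨i, rfl⟩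
        rcases fin3_cases hab hal hbl i with rfl | rfl | rfl
        exacts [h1.ge, h2.le, hl.ge]
    · refine single (oneSided_of_nonpos ?_)
      rintro _ ⟨i, rfl⟩
      rcases fin3_cases hab hal hbl i with rfl | rfl | rfl
      exacts [h1, h2, hl.le]

open Classical in
-- A first cut at a zero of `g` on an edge makes this zero a vertex of both halves; each half then
-- needs at most one more cut, whence `4 = 2 * 2`.
theorem exists_cut (T : Tri) (g : Plane →ᵃ[ℝ] ℝ) :
    ∃ 𝒮 : Finset Tri, IsTriangulation (triSet T) 𝒮 ∧ 𝒮.card ≤ 4 ∧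
      ∀ S ∈ 𝒮, OneSided g (triSet S) := by
  by_cases hone : OneSided g (triSet T)
  · exact ⟨{T}, isTriangulation_singleton T, by simp, by simpa using hone⟩
  obtain ⟨b, hb⟩ : ∃ b, g (T.points b) < 0 := by
    by_contra! hcon
    exact hone (oneSided_of_nonneg (by rintro _ ⟨i, rfl⟩; exact hcon i))
  obtain ⟨a, ha⟩ : ∃ a, 0 < g (T.points a) := by
    by_contra! hcon
    exact hone (oneSided_of_nonpos (by rintro _ ⟨i, rfl⟩; exact hcon i))
  have hab : a ≠ b := by rintro rfl; linarith
  obtain ⟨l, hal, hbl⟩ : ∃ l : Fin 3, a ≠ l ∧ b ≠ l := by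
    clear ha hb; revert a b; decide
  obtain ⟨v, T₁, T₂, hv, h⟩ := exists_bisection_zero T g hab hal hbl ha hb
  have key : ∀ S ∈ ({T₁, T₂} : Finset Tri), ∃ 𝒮 : Finset Tri, IsTriangulation (triSet S) 𝒮 ∧
      𝒮.card ≤ 2 ∧ ∀ S' ∈ 𝒮, OneSided g (triSet S') := by
    intro S hS
    have hvS : v ∈ triVertices S := by
      simp only [Finset.mem_insert, Finset.mem_singleton] at hS
      rcases hS with rfl | rfl
      · rw [h.vert₁]; simp
      · rw [h.vert₂]; simp
    obtain ⟨l, hl⟩ := hvS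
    exact exists_cut_of_zero S g l (by rw [hl, hv])
  choose! 𝒮 k1 k2 k3 using key
  refine ⟨_, h.isTriangulation.biUnion k1, ?_, ?_⟩
  · refine (Finset.card_biUnion_le_card_mul _ _ 2 k2).trans ?_
    have := Finset.card_le_two (a := T₁) (b := T₂)
    omega
  · intro S hS
    obtain ⟨S', hS', hS⟩ := Finset.mem_biUnion.1 hS
    exact k3 S' hS' S hS

open Classical in
theorem exists_cut_finset {ι : Type*} (g : ι → Plane →ᵃ[ℝ] ℝ) (s : Finset ι) (T : Tri) :
    ∃ 𝒮 : Finset Tri, IsTriangulation (triSet T) 𝒮 ∧ 𝒮.card ≤ 4 ^ s.card ∧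
      ∀ S ∈ 𝒮, ∀ i ∈ s, OneSided (g i) (triSet S) := by
  induction s using Finset.induction_on with
  | empty => exact ⟨{T}, isTriangulation_singleton T, by simp, by simp⟩
  | insert i s his ih =>
    obtain ⟨𝒮, h1, h2, h3⟩ := ih
    choose 𝒬 k1 k2 k3 using fun S : Tri => exists_cut S (g i)
    have hb := h1.biUnion (𝒮 := 𝒬) (fun S _ => k1 S)
    refine ⟨_, hb, ?_, ?_⟩
    · refine (Finset.card_biUnion_le_card_mul _ _ 4 fun S _ => k2 S).trans ?_
      rw [Finset.card_insert_of_notMem his, pow_succ]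
      exact Nat.mul_le_mul_right 4 h2
    · intro S hS j hj
      obtain ⟨S', hS', hS⟩ := Finset.mem_biUnion.1 hS
      rcases Finset.mem_insert.1 hj with rfl | hj
      · exact k3 S' S hS
      · exact (h3 S' hS' j hj).mono ((k1 S').subset hS)

theorem exists_cut_family {ι : Type*} [Fintype ι] (g : ι → Plane →ᵃ[ℝ] ℝ) (T : Tri) :
    ∃ 𝒮 : Finset Tri, IsTriangulation (triSet T) 𝒮 ∧ 𝒮.card ≤ 4 ^ Fintype.card ι ∧
      ∀ S ∈ 𝒮, ∀ i, OneSided (g i) (triSet S) := by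
  obtain ⟨𝒮, h1, h2, h3⟩ := exists_cut_finset g Finset.univ T
  exact ⟨𝒮, h1, h2, fun S hS i => h3 S hS i (Finset.mem_univ i)⟩

open Classical in
-- A piece that crosses none of the three edge lines of `R` and meets the interior of `R` lies in
-- `R`. The pieces kept therefore cover the interior of each `R`, and by closedness all of `R`.
theorem IsTriangulation.filter_subset {A : Set Plane} {𝒬 : Finset Tri} (h : IsTriangulation A 𝒬)
    (𝓡 : Finset Tri) (hA : ∀ R ∈ 𝓡, triSet R ⊆ A)
    (hone : ∀ S ∈ 𝒬, ∀ R ∈ 𝓡, ∀ i, OneSided (bary R i) (triSet S)) :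
    IsTriangulation (⋃ R ∈ 𝓡, triSet R) (𝒬.filter fun S => ∃ R ∈ 𝓡, triSet S ⊆ triSet R) where
  covers := by
    apply Set.Subset.antisymm
    · refine Set.iUnion₂_subset fun S hS => ?_
      obtain ⟨-, R, hR, hSR⟩ := Finset.mem_filter.1 hS
      exact hSR.trans (Set.subset_biUnion_of_mem (u := fun R => triSet R) hR)
    · refine Set.iUnion₂_subset fun R hR => ?_
      rw [← closure_interior_triSet R]
      refine closure_minimal ?_ (Set.Finite.isClosed_biUnion (Finset.finite_toSet _)
        fun S _ => (isCompact_triSet S).isClosed)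
      intro x hx
      obtain ⟨S, hS, hxS⟩ := h.exists_mem (hA R hR (interior_subset hx))
      refine Set.mem_biUnion (x := S) (Finset.mem_filter.2 ⟨hS, R, hR, fun y hy => ?_⟩) hxS
      rw [mem_triSet]
      intro i
      rcases hone S hS R hR i with h1 | h1
      · exact h1 y hy
      · exact absurd (h1 x hxS) (not_le.2 (mem_interior_triSet.1 hx i))
  nonoverlapping := by
    intro S hS S' hS'
    exact h.nonoverlapping S (Finset.mem_filter.1 hS).1 S' (Finset.mem_filter.1 hS').1

/-! ### Diameters and fine subdivisions -/

/-- The diameter of a triangle. -/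
noncomputable def triDiam (T : Tri) : ℝ := Metric.diam (triSet T)

theorem dist_le_triDiam {T : Tri} {x y : Plane} (hx : x ∈ triSet T) (hy : y ∈ triSet T) :
    dist x y ≤ triDiam T :=
  Metric.dist_le_diam_of_mem (isCompact_triSet T).isBounded hx hy

theorem triDiam_nonneg (T : Tri) : 0 ≤ triDiam T := Metric.diam_nonneg

theorem triDiam_le {T : Tri} {D : ℝ} (hD : 0 ≤ D)
    (h : ∀ x ∈ triSet T, ∀ y ∈ triSet T, dist x y ≤ D) : triDiam T ≤ D :=
  Metric.diam_le_of_forall_dist_le hD h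

theorem triDiam_mono {S T : Tri} (h : triSet S ⊆ triSet T) : triDiam S ≤ triDiam T :=
  Metric.diam_mono h (isCompact_triSet T).isBounded

/-- The lines `bary T i = k / n`. -/
noncomputable def gridLine (T : Tri) (n : ℕ) (j : Fin 3 × Fin (n + 1)) : Plane →ᵃ[ℝ] ℝ :=
  bary T j.1 - AffineMap.const ℝ Plane ((j.2 : ℝ) / n)

theorem bary_sub_le_of_oneSided {T S : Tri} {n : ℕ} (hn : 0 < n) (hST : triSet S ⊆ triSet T)
    (h : ∀ j, OneSided (gridLine T n j) (triSet S)) (i : Fin 3) {x y : Plane}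
    (hx : x ∈ triSet S) (hy : y ∈ triSet S) : bary T i y - bary T i x ≤ 1 / n := by
  by_contra! hcon
  have hn' : (0 : ℝ) < n := by exact_mod_cast hn
  have hx0 := mem_triSet.1 (hST hx) i
  have hy0 := mem_triSet.1 (hST hy)
  have hy1 : bary T i y ≤ 1 := by
    have := bary_sum T y
    have h0 := hy0 0
    have h1 := hy0 1
    have h2 := hy0 2
    fin_cases i <;> simp <;> linarith
  -- The first grid level strictly above `x`. A gap larger than `1 / n` places it strictly below
  -- `y`, so its line separates two points of `S`.
  set k := ⌊n * bary T i x⌋₊ + 1 with hk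
  have hk1 : n * bary T i x < k := by
    rw [hk]; push_cast; exact Nat.lt_floor_add_one _
  have hk2 : (k : ℝ) ≤ n * bary T i x + 1 := by
    rw [hk]; push_cast
    have := Nat.floor_le (mul_nonneg hn'.le hx0)
    linarith
  have hk3 : (k : ℝ) < n * bary T i y := by
    have : n * (1 / n : ℝ) < n * (bary T i y - bary T i x) := mul_lt_mul_of_pos_left hcon hn'
    rw [mul_one_div_cancel hn'.ne'] at this
    linarith
  have hkn : k < n + 1 := by
    have : (k : ℝ) < n := hk3.trans_le (by nlinarith)
    have : k < n := by exact_mod_cast this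
    omega
  have hval : ∀ z, gridLine T n (i, ⟨k, hkn⟩) z = bary T i z - k / n := by
    intro z; simp [gridLine]
  rcases h (i, ⟨k, hkn⟩) with h1 | h1
  · have := h1 x hx
    rw [hval, sub_nonneg, div_le_iff₀ hn'] at this
    linarith
  · have := h1 y hy
    rw [hval, sub_nonpos, le_div_iff₀ hn'] at this
    linarith

theorem triDiam_le_of_oneSided {T S : Tri} {n : ℕ} (hn : 0 < n) (hST : triSet S ⊆ triSet T)
    (h : ∀ j, OneSided (gridLine T n j) (triSet S)) : triDiam S ≤ 3 / n * triDiam T := by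
  have hn' : (0 : ℝ) < n := by exact_mod_cast hn
  refine triDiam_le (mul_nonneg (by positivity) (triDiam_nonneg T)) fun x hx y hy => ?_
  have e : x - y = ∑ i, (bary T i x - bary T i y) • (T.points i - T.points 0) := by
    simp_rw [smul_sub, Finset.sum_sub_distrib, ← Finset.sum_smul, sub_smul,
      Finset.sum_sub_distrib, sum_bary_smul, Fin.sum_univ_three]
    have h1 := bary_sum T x
    have h2 := bary_sum T y
    rw [h1, h2, sub_self, zero_smul, sub_zero]
  rw [dist_eq_norm, e]
  calc ‖∑ i, (bary T i x - bary T i y) • (T.points i - T.points 0)‖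
      ≤ ∑ i, ‖(bary T i x - bary T i y) • (T.points i - T.points 0)‖ := norm_sum_le _ _
    _ ≤ ∑ _i : Fin 3, 1 / n * triDiam T := by
        refine Finset.sum_le_sum fun i _ => ?_
        rw [norm_smul, Real.norm_eq_abs, ← dist_eq_norm]
        refine mul_le_mul ?_ (dist_le_triDiam (points_mem T i) (points_mem T 0)) dist_nonneg
          (by positivity)
        rw [abs_sub_le_iff]
        exact ⟨bary_sub_le_of_oneSided hn hST h i hy hx, bary_sub_le_of_oneSided hn hST h i hx hy⟩
    _ = 3 / n * triDiam T := by simp; ring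

/-! ### Homothetic images of triangles -/

theorem homothet_indep (T : Tri) (s : ℝ) (hs : s ≠ 0) (c : Plane) :
    AffineIndependent ℝ (fun i => s • T.points i + c) := by
  set f : Plane →ᵃ[ℝ] Plane := s • AffineMap.id ℝ Plane + AffineMap.const ℝ Plane c with hf
  have hfx : ∀ x, f x = s • x + c := fun x => by simp [hf]
  have hinj : Function.Injective f := by
    intro x y hxy
    rw [hfx, hfx, add_left_inj] at hxy
    exact smul_right_injective _ hs hxy
  have e : (fun i => s • T.points i + c) = f ∘ T.points := by
    funext i
    rw [Function.comp_apply, hfx]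
  rw [e]
  exact T.independent.map' f hinj

/-- The image of `T` under the homothety `x ↦ s • x + c`. -/
def Tri.homothet (T : Tri) (s : ℝ) (hs : s ≠ 0) (c : Plane) : Tri :=
  ⟨fun i => s • T.points i + c, homothet_indep T s hs c⟩

theorem homothet_points (T : Tri) (s : ℝ) (hs : s ≠ 0) (c : Plane) (i : Fin 3) :
    (T.homothet s hs c).points i = s • T.points i + c := rfl

theorem bary_homothet (T : Tri) (s : ℝ) (hs : s ≠ 0) (c : Plane) (i : Fin 3) (x : Plane) :
    bary (T.homothet s hs c) i (s • x + c) = bary T i x := by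
  have hsum : ∑ i, bary T i x = 1 := (triBasis T).sum_coord_apply_eq_one x
  have : s • x + c = ∑ i, bary T i x • (T.homothet s hs c).points i := by
    simp_rw [homothet_points, smul_add, Finset.sum_add_distrib, ← Finset.sum_smul, hsum, one_smul,
      smul_comm _ s, ← Finset.smul_sum, sum_bary_smul]
  rw [this]
  exact bary_sum_smul (T.homothet s hs c) (fun i => bary T i x) hsum i

theorem mem_homothet (T : Tri) (s : ℝ) (hs : s ≠ 0) (c : Plane) (x : Plane) :
    s • x + c ∈ triSet (T.homothet s hs c) ↔ x ∈ triSet T := by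
  simp_rw [mem_triSet, bary_homothet]

theorem triSet_homothet (T : Tri) (s : ℝ) (hs : s ≠ 0) (c : Plane) :
    triSet (T.homothet s hs c) = (fun x => s • x + c) '' triSet T := by
  ext y
  constructor
  · intro hy
    have e : s • (s⁻¹ • (y - c)) + c = y := by rw [smul_inv_smul₀ hs, sub_add_cancel]
    rw [← e, mem_homothet] at hy
    exact ⟨_, hy, e⟩
  · rintro ⟨x, hx, rfl⟩
    exact (mem_homothet T s hs c x).2 hx

open scoped Pointwise in
theorem triDiam_homothet (T : Tri) (s : ℝ) (hs : s ≠ 0) (c : Plane) :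
    triDiam (T.homothet s hs c) = |s| * triDiam T := by
  have e : triSet (T.homothet s hs c) = (fun x => x + c) '' (s • triSet T) := by
    rw [triSet_homothet, ← Set.image_smul, Set.image_image]
  rw [triDiam, e, (isometry_add_right c).diam_image, diam_smul₀, Real.norm_eq_abs]
  rfl

open scoped Pointwise in
theorem volume_homothet (T : Tri) (s : ℝ) (hs : s ≠ 0) (c : Plane) :
    volume (triSet (T.homothet s hs c)) = ENNReal.ofReal (s ^ 2) * volume (triSet T) := by
  have e : triSet (T.homothet s hs c) = (fun x => x + c) '' (s • triSet T) := by
    rw [triSet_homothet, ← Set.image_smul, Set.image_image]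
  rw [e, Set.image_add_right, measure_preimage_add_right, Measure.addHaar_smul]
  simp

theorem triArea_homothet (T : Tri) (s : ℝ) (hs : s ≠ 0) (c : Plane) :
    triArea (T.homothet s hs c) = s ^ 2 * triArea T := by
  rw [triArea, volume_homothet, ENNReal.toReal_mul, ENNReal.toReal_ofReal (sq_nonneg s)]
  rfl

theorem exists_tri_superset (T : Tri) {A : Set Plane} (hA : Bornology.IsBounded A) :
    ∃ B : Tri, A ⊆ triSet B := by
  obtain ⟨x, hx⟩ := interior_triSet_nonempty T
  obtain ⟨ε, hε, hball⟩ := Metric.isOpen_iff.1 isOpen_interior x hx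
  obtain ⟨r, hr, hAr⟩ := hA.subset_ball_lt 0 0
  have hs : r / ε ≠ 0 := (div_pos hr hε).ne'
  refine ⟨T.homothet (r / ε) hs (-((r / ε) • x)), fun y hy => ?_⟩
  have e : (r / ε) • ((r / ε)⁻¹ • y + x) + -((r / ε) • x) = y := by
    rw [smul_add, smul_inv_smul₀ hs]; abel
  rw [← e, mem_homothet]
  refine interior_subset (hball ?_)
  have hy' := hAr hy
  rw [mem_ball_zero_iff] at hy'
  rw [Metric.mem_ball, dist_eq_norm, add_sub_cancel_right, norm_smul, norm_inv, Real.norm_eq_abs,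
    abs_of_pos (div_pos hr hε), inv_div]
  calc ε / r * ‖y‖ < ε / r * r := mul_lt_mul_of_pos_left hy' (by positivity)
    _ = ε := div_mul_cancel₀ _ hr.ne'

open Classical in
-- A large triangle `B` containing `Ω` is cut along all edge lines of the given triangles and along
-- a fine grid of `B`; the pieces lying in one of the given triangles form the triangulation. The
-- given triangles may overlap.
theorem IsPolygonal.exists_fine_triangulation {Ω : Set Plane} (hΩ : IsPolygonal Ω) {ρ : ℝ}
    (hρ : 0 < ρ) : ∃ 𝓡 : Finset Tri, IsTriangulation Ω 𝓡 ∧ 𝓡.Nonempty ∧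
      ∀ R ∈ 𝓡, triDiam R ≤ ρ := by
  obtain ⟨S, ⟨T₀, hT₀⟩, rfl⟩ := hΩ
  have hbd : Bornology.IsBounded (⋃ T ∈ S, triSet T) :=
    (S.finite_toSet.isCompact_biUnion fun T _ => isCompact_triSet T).isBounded
  obtain ⟨B, hB⟩ := exists_tri_superset T₀ hbd
  obtain ⟨n, hn⟩ := exists_nat_gt (3 * triDiam B / ρ)
  have hn0 : 0 < n := by
    have : (0 : ℝ) < n := lt_of_le_of_lt (by have := triDiam_nonneg B; positivity) hn
    exact_mod_cast this
  have hn' : (0 : ℝ) < n := by exact_mod_cast hn0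
  obtain ⟨𝒬, h1, -, h3⟩ := exists_cut_family
    (Sum.elim (fun j : {x // x ∈ S} × Fin 3 => bary j.1.1 j.2) (gridLine B n)) B
  have htri := h1.filter_subset S
    (fun R hR => (Set.subset_biUnion_of_mem (u := fun R => triSet R) hR).trans hB)
    (fun P hP R hR i => h3 P hP (Sum.inl (⟨R, hR⟩, i)))
  refine ⟨_, htri, ?_, ?_⟩
  · by_contra hempty
    rw [Finset.not_nonempty_iff_eq_empty] at hempty
    have hcov := htri.covers
    rw [hempty] at hcov
    have : T₀.points 0 ∈ ⋃ T ∈ S, triSet T := Set.mem_biUnion hT₀ (points_mem T₀ 0)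
    rw [← hcov] at this
    simp at this
  · intro P hP
    have hP' := (Finset.mem_filter.1 hP).1
    refine (triDiam_le_of_oneSided hn0 (h1.subset hP') fun j => h3 P hP' (Sum.inr j)).trans ?_
    rw [div_lt_iff₀ hρ] at hn
    rw [div_mul_eq_mul_div, div_le_iff₀ hn']
    linarith

/-! ### Tilings of the plane by the translates of `h • τ` and `-h • τ` -/

/-- The vector `i (p₁ - p₀) + j (p₂ - p₀)` of the lattice spanned by the edges of `τ`. -/
noncomputable def latticeVec (τ : Tri) (i j : ℤ) : Plane :=
  (i : ℝ) • (τ.points 1 - τ.points 0) + (j : ℝ) • (τ.points 2 - τ.points 0)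

/-- The tiles: the translates of `h • τ` by the lattice `h • latticeVec τ`, and the triangles which
complete them to parallelograms. -/
noncomputable def tile (τ : Tri) (h : ℝ) (hh : 0 < h) : ℤ × ℤ × Bool → Tri
  | (i, j, false) => τ.homothet h hh.ne' (h • latticeVec τ i j)
  | (i, j, true) => τ.homothet (-h) (neg_ne_zero.2 hh.ne')
      (h • (τ.points 1 + τ.points 2 + latticeVec τ i j))

theorem bary_coeffs (τ : Tri) {x : Plane} {c₀ c₁ c₂ : ℝ} (hsum : c₀ + c₁ + c₂ = 1)
    (hx : x = c₀ • τ.points 0 + c₁ • τ.points 1 + c₂ • τ.points 2) :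
    bary τ 0 x = c₀ ∧ bary τ 1 x = c₁ ∧ bary τ 2 x = c₂ := by
  have h : ∀ k, bary τ k x = ![c₀, c₁, c₂] k := by
    intro k
    rw [← bary_sum_smul τ ![c₀, c₁, c₂] (by simpa [Fin.sum_univ_three] using hsum) k, hx]
    simp [Fin.sum_univ_three]
  exact ⟨h 0, h 1, h 2⟩

theorem eq_bary_three (τ : Tri) (z : Plane) :
    z = bary τ 0 z • τ.points 0 + bary τ 1 z • τ.points 1 + bary τ 2 z • τ.points 2 := by
  have := sum_bary_smul τ z
  rw [Fin.sum_univ_three] at this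
  exact this.symm

/-- In the coordinates `(bary τ 1 z, bary τ 2 z)` the tiles become the unit squares with integer
corner `(i, j)`, each cut in two by a diagonal. Covering and disjointness then reduce to integer and
fractional parts. -/
theorem bary_tile_false (τ : Tri) (h : ℝ) (hh : 0 < h) (i j : ℤ) (z : Plane) :
    bary (tile τ h hh (i, j, false)) 0 (h • z) = 1 - (bary τ 1 z - i) - (bary τ 2 z - j) ∧
    bary (tile τ h hh (i, j, false)) 1 (h • z) = bary τ 1 z - i ∧
    bary (tile τ h hh (i, j, false)) 2 (h • z) = bary τ 2 z - j := by
  have e : h • z = h • (z - latticeVec τ i j) + h • latticeVec τ i j := by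
    rw [← smul_add, sub_add_cancel]
  have hs := bary_sum τ z
  simp only [tile]
  rw [e, bary_homothet, bary_homothet, bary_homothet]
  refine bary_coeffs τ (by ring) ?_
  have h0 : bary τ 0 z = 1 - bary τ 1 z - bary τ 2 z := by linarith
  conv_lhs => rw [eq_bary_three τ z, h0]
  rw [latticeVec]
  module

theorem bary_tile_true (τ : Tri) (h : ℝ) (hh : 0 < h) (i j : ℤ) (z : Plane) :
    bary (tile τ h hh (i, j, true)) 0 (h • z) = (bary τ 1 z - i) + (bary τ 2 z - j) - 1 ∧
    bary (tile τ h hh (i, j, true)) 1 (h • z) = 1 - (bary τ 1 z - i) ∧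
    bary (tile τ h hh (i, j, true)) 2 (h • z) = 1 - (bary τ 2 z - j) := by
  have e : h • z = (-h) • (τ.points 1 + τ.points 2 + latticeVec τ i j - z) +
      h • (τ.points 1 + τ.points 2 + latticeVec τ i j) := by
    module
  have hs := bary_sum τ z
  simp only [tile]
  rw [e, bary_homothet, bary_homothet, bary_homothet]
  refine bary_coeffs τ (by ring) ?_
  have h0 : bary τ 0 z = 1 - bary τ 1 z - bary τ 2 z := by linarith
  conv_lhs => rw [eq_bary_three τ z, h0]
  rw [latticeVec]
  module

theorem tile_eq_homothet (τ : Tri) (h : ℝ) (hh : 0 < h) (t : ℤ × ℤ × Bool) :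
    ∃ (s : ℝ) (hs : s ≠ 0) (c : Plane), |s| = h ∧ tile τ h hh t = τ.homothet s hs c := by
  obtain ⟨i, j, b⟩ := t
  cases b
  · exact ⟨h, hh.ne', _, abs_of_pos hh, rfl⟩
  · exact ⟨-h, neg_ne_zero.2 hh.ne', _, by rw [abs_neg, abs_of_pos hh], rfl⟩

theorem triDiam_tile (τ : Tri) (h : ℝ) (hh : 0 < h) (t : ℤ × ℤ × Bool) :
    triDiam (tile τ h hh t) = h * triDiam τ := by
  obtain ⟨s, hs, c, hsh, e⟩ := tile_eq_homothet τ h hh t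
  rw [e, triDiam_homothet, hsh]

theorem triArea_tile (τ : Tri) (h : ℝ) (hh : 0 < h) (t : ℤ × ℤ × Bool) :
    triArea (tile τ h hh t) = h ^ 2 * triArea τ := by
  obtain ⟨s, hs, c, hsh, e⟩ := tile_eq_homothet τ h hh t
  rw [e, triArea_homothet, ← hsh, sq_abs]

theorem exists_mem_tile (τ : Tri) (h : ℝ) (hh : 0 < h) (y : Plane) :
    ∃ t, y ∈ triSet (tile τ h hh t) := by
  obtain ⟨z, rfl⟩ : ∃ z : Plane, y = h • z := ⟨h⁻¹ • y, (smul_inv_smul₀ hh.ne' y).symm⟩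
  set i := ⌊bary τ 1 z⌋
  set j := ⌊bary τ 2 z⌋
  have h1 := Int.floor_le (bary τ 1 z)
  have h2 := Int.floor_le (bary τ 2 z)
  have h3 := Int.lt_floor_add_one (bary τ 1 z)
  have h4 := Int.lt_floor_add_one (bary τ 2 z)
  rcases le_total ((bary τ 1 z - i) + (bary τ 2 z - j)) 1 with hle | hle
  · refine ⟨(i, j, false), mem_triSet.2 fun k => ?_⟩
    obtain ⟨e0, e1, e2⟩ := bary_tile_false τ h hh i j z
    fin_cases k
    · exact e0.symm ▸ by linarith
    · exact e1.symm ▸ by linarith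
    · exact e2.symm ▸ by linarith
  · refine ⟨(i, j, true), mem_triSet.2 fun k => ?_⟩
    obtain ⟨e0, e1, e2⟩ := bary_tile_true τ h hh i j z
    fin_cases k
    · exact e0.symm ▸ by linarith
    · exact e1.symm ▸ by linarith
    · exact e2.symm ▸ by linarith

theorem mem_interior_tile {τ : Tri} {h : ℝ} {hh : 0 < h} {i j : ℤ} {b : Bool} {z : Plane}
    (hz : h • z ∈ interior (triSet (tile τ h hh (i, j, b)))) :
    i = ⌊bary τ 1 z⌋ ∧ j = ⌊bary τ 2 z⌋ ∧
      (b = true ↔ 1 < (bary τ 1 z - ⌊bary τ 1 z⌋) + (bary τ 2 z - ⌊bary τ 2 z⌋)) := by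
  rw [mem_interior_triSet] at hz
  cases b
  · obtain ⟨e0, e1, e2⟩ := bary_tile_false τ h hh i j z
    have h0 := hz 0
    have h1 := hz 1
    have h2 := hz 2
    rw [e0] at h0
    rw [e1] at h1
    rw [e2] at h2
    have hi : ⌊bary τ 1 z⌋ = i := Int.floor_eq_iff.2 ⟨by linarith, by linarith⟩
    have hj : ⌊bary τ 2 z⌋ = j := Int.floor_eq_iff.2 ⟨by linarith, by linarith⟩
    refine ⟨hi.symm, hj.symm, ?_⟩
    rw [hi, hj]
    constructor
    · intro h; simp at h
    · intro h; linarith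
  · obtain ⟨e0, e1, e2⟩ := bary_tile_true τ h hh i j z
    have h0 := hz 0
    have h1 := hz 1
    have h2 := hz 2
    rw [e0] at h0
    rw [e1] at h1
    rw [e2] at h2
    have hi : ⌊bary τ 1 z⌋ = i := Int.floor_eq_iff.2 ⟨by linarith, by linarith⟩
    have hj : ⌊bary τ 2 z⌋ = j := Int.floor_eq_iff.2 ⟨by linarith, by linarith⟩
    refine ⟨hi.symm, hj.symm, ?_⟩
    rw [hi, hj]
    simp only [true_iff]
    linarith

theorem disjoint_interior_tile (τ : Tri) (h : ℝ) (hh : 0 < h) {t t' : ℤ × ℤ × Bool}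
    (hne : t ≠ t') :
    Disjoint (interior (triSet (tile τ h hh t))) (interior (triSet (tile τ h hh t'))) := by
  rw [Set.disjoint_left]
  intro y hy hy'
  obtain ⟨z, rfl⟩ : ∃ z : Plane, y = h • z := ⟨h⁻¹ • y, (smul_inv_smul₀ hh.ne' y).symm⟩
  obtain ⟨i, j, b⟩ := t
  obtain ⟨i', j', b'⟩ := t'
  obtain ⟨h1, h2, h3⟩ := mem_interior_tile hy
  obtain ⟨h1', h2', h3'⟩ := mem_interior_tile hy'
  apply hne
  rw [h1, h2, h1', h2', Bool.eq_iff_iff.2 (h3.trans h3'.symm)]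

theorem mem_triVertices_of_int {S : Tri} {v : Plane} (hv : v ∈ triSet S)
    (hint : ∀ k, ∃ a : ℤ, bary S k v = a) : v ∈ triVertices S := by
  have h0 := mem_triSet.1 hv
  have hs := bary_sum S v
  by_contra hn
  have hz : ∀ k, bary S k v = 0 := by
    intro k
    have hk0 := h0 k
    have hk1 : bary S k v < 1 := by
      by_contra! hge
      refine hn ⟨k, (mem_triVertices_of_bary (i := k) hv (le_antisymm ?_ hge)).symm⟩
      have a0 := h0 0
      have a1 := h0 1
      have a2 := h0 2
      fin_cases k <;> simp <;> linarith
    obtain ⟨a, ha⟩ := hint k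
    rw [ha] at hk0 hk1 ⊢
    have b0 : 0 ≤ a := by exact_mod_cast hk0
    have b1 : a < 1 := by exact_mod_cast hk1
    have : a = 0 := by omega
    simp [this]
  rw [hz, hz, hz] at hs
  norm_num at hs

theorem int_of_mem_triVertices {S : Tri} {v : Plane} (hv : v ∈ triVertices S) (k : Fin 3) :
    ∃ a : ℤ, bary S k v = a := by
  obtain ⟨i, rfl⟩ := hv
  rw [bary_points]
  split_ifs
  · exact ⟨1, by simp⟩
  · exact ⟨0, by simp⟩

/-- Vertices of tiles have integer coordinates relative to every tile, and nonnegative integers with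
sum 1 are the coordinates of a vertex. So the tiling itself has no hanging vertices. -/
theorem mem_triVertices_tile {τ : Tri} {h : ℝ} {hh : 0 < h} {t t' : ℤ × ℤ × Bool} {v : Plane}
    (hv : v ∈ triVertices (tile τ h hh t')) (hvt : v ∈ triSet (tile τ h hh t)) :
    v ∈ triVertices (tile τ h hh t) := by
  refine mem_triVertices_of_int hvt ?_
  obtain ⟨z, rfl⟩ : ∃ z : Plane, v = h • z := ⟨h⁻¹ • v, (smul_inv_smul₀ hh.ne' v).symm⟩
  have hint := int_of_mem_triVertices hv
  obtain ⟨i', j', b'⟩ := t'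
  obtain ⟨a, b, ha, hb⟩ : ∃ a b : ℤ, bary τ 1 z = a ∧ bary τ 2 z = b := by
    obtain ⟨a, ha⟩ := hint 1
    obtain ⟨b, hb⟩ := hint 2
    cases b'
    · obtain ⟨e0, e1, e2⟩ := bary_tile_false τ h hh i' j' z
      rw [e1] at ha
      rw [e2] at hb
      exact ⟨a + i', b + j', by push_cast; linarith, by push_cast; linarith⟩
    · obtain ⟨e0, e1, e2⟩ := bary_tile_true τ h hh i' j' z
      rw [e1] at ha
      rw [e2] at hb
      exact ⟨1 - a + i', 1 - b + j', by push_cast; linarith, by push_cast; linarith⟩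
  obtain ⟨i, j, b'⟩ := t
  intro k
  cases b'
  · obtain ⟨e0, e1, e2⟩ := bary_tile_false τ h hh i j z
    rw [ha, hb] at e0
    rw [ha] at e1
    rw [hb] at e2
    fin_cases k
    · exact ⟨1 - (a - i) - (b - j), e0.trans (by push_cast; ring)⟩
    · exact ⟨a - i, e1.trans (by push_cast; ring)⟩
    · exact ⟨b - j, e2.trans (by push_cast; ring)⟩
  · obtain ⟨e0, e1, e2⟩ := bary_tile_true τ h hh i j z
    rw [ha, hb] at e0
    rw [ha] at e1
    rw [hb] at e2
    fin_cases k
    · exact ⟨(a - i) + (b - j) - 1, e0.trans (by push_cast; ring)⟩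
    · exact ⟨1 - (a - i), e1.trans (by push_cast; ring)⟩
    · exact ⟨1 - (b - j), e2.trans (by push_cast; ring)⟩

/-! ### Counting tiles -/

/-- The number of tiles of size `h` which meet a disc of radius `a h` is bounded. -/
theorem exists_card_tile_le (τ : Tri) {a : ℝ} (ha : 0 ≤ a) : ∃ K : ℕ, ∀ (h : ℝ) (hh : 0 < h)
    (z : Plane) (J : Finset (ℤ × ℤ × Bool)),
    (∀ t ∈ J, (triSet (tile τ h hh t) ∩ Metric.closedBall z (a * h)).Nonempty) → J.card ≤ K := by
  set r := a + triDiam τ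
  have hr : 0 ≤ r := add_nonneg ha (triDiam_nonneg τ)
  set A := (volume (Metric.closedBall (0 : Plane) r)).toReal
  obtain ⟨K, hK⟩ := exists_nat_ge (A / triArea τ)
  refine ⟨K, fun h hh z J hJ => ?_⟩
  have hsub : ∀ t ∈ J, triSet (tile τ h hh t) ⊆ Metric.closedBall z (h * r) := by
    intro t ht y hy
    obtain ⟨x, hx, hxz⟩ := hJ t ht
    have h1 := dist_le_triDiam hy hx
    rw [triDiam_tile] at h1
    rw [Metric.mem_closedBall] at hxz ⊢
    calc dist y z ≤ dist y x + dist x z := dist_triangle _ _ _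
      _ ≤ h * triDiam τ + a * h := add_le_add h1 hxz
      _ = h * r := by ring
  have hvol : volume (Metric.closedBall z (h * r)) =
      ENNReal.ofReal (h ^ 2) * volume (Metric.closedBall (0 : Plane) r) := by
    rw [Measure.addHaar_closedBall_mul _ _ hh.le hr]
    simp
  have hfin : volume (Metric.closedBall z (h * r)) ≠ ∞ := measure_closedBall_lt_top.ne
  -- Tiles with disjoint interiors and area `h ^ 2 * triArea τ` fit in a disc of radius `h * r`; in
  -- the comparison of areas `h` cancels.
  have key := sum_triArea_le J (tile τ h hh)
    (fun t _ t' _ hne => disjoint_interior_tile τ h hh hne) hsub hfin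
  rw [hvol, ENNReal.toReal_mul, ENNReal.toReal_ofReal (sq_nonneg h)] at key
  simp_rw [triArea_tile] at key
  rw [Finset.sum_const, nsmul_eq_mul] at key
  have h2 : (J.card : ℝ) ≤ A / triArea τ := by
    rw [le_div_iff₀ (triArea_pos τ)]
    have h3 : h ^ 2 * (J.card * triArea τ) ≤ h ^ 2 * A := by
      calc _ = (J.card : ℝ) * (h ^ 2 * triArea τ) := by ring
        _ ≤ _ := key
    exact le_of_mul_le_mul_left h3 (by positivity)
  exact_mod_cast h2.trans hK

theorem finite_tiles_meeting (τ : Tri) (h : ℝ) (hh : 0 < h) {A : Set Plane}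
    (hA : Bornology.IsBounded A) : {t | (triSet (tile τ h hh t) ∩ A).Nonempty}.Finite := by
  obtain ⟨r, hr, hAr⟩ := hA.subset_ball_lt 0 0
  obtain ⟨K, hK⟩ := exists_card_tile_le τ (a := r / h) (by positivity)
  by_contra hinf
  obtain ⟨J, hJ, hcard⟩ := Set.Infinite.exists_subset_card_eq hinf (K + 1)
  have := hK h hh 0 J (fun t ht => ?_)
  · omega
  · refine (hJ ht).mono (Set.inter_subset_inter_right _ (hAr.trans ?_))
    rw [div_mul_cancel₀ _ hh.ne']
    exact Metric.ball_subset_closedBall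

/-- The boundary of a triangle is covered by `O(1 / h)` discs of radius `h`. -/
theorem exists_frontier_net (R : Tri) : ∃ C : ℝ, 0 ≤ C ∧ ∀ h : ℝ, 0 < h → h ≤ 1 →
    ∃ Z : Finset Plane, (Z.card : ℝ) ≤ C / h ∧
      ∀ x ∈ frontier (triSet R), ∃ z ∈ Z, dist x z ≤ h := by
  classical
  -- Nine ordered pairs of vertices, each with `n + 1 ≤ triDiam R / h + 3` division points; `h ≤ 1`
  -- gives the form `C / h`.
  refine ⟨9 * (triDiam R + 3), by have := triDiam_nonneg R; positivity, fun h hh h1 => ?_⟩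
  set n := ⌈triDiam R / h⌉₊ + 1 with hn
  have hn0 : (0 : ℝ) < n := by rw [hn]; positivity
  have hn1 : triDiam R ≤ n * h := by
    rw [← div_le_iff₀ hh, hn]
    push_cast
    linarith [Nat.le_ceil (triDiam R / h)]
  have hn2 : (n : ℝ) ≤ triDiam R / h + 2 := by
    rw [hn]; push_cast
    linarith [Nat.ceil_lt_add_one (div_nonneg (triDiam_nonneg R) hh.le)]
  refine ⟨Finset.univ.image fun k : Fin 3 × Fin 3 × Fin (n + 1) =>
    AffineMap.lineMap (R.points k.1) (R.points k.2.1) ((k.2.2 : ℝ) / n), ?_, ?_⟩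
  · calc ((Finset.univ.image fun k : Fin 3 × Fin 3 × Fin (n + 1) =>
        (AffineMap.lineMap (R.points k.1) (R.points k.2.1) ((k.2.2 : ℝ) / n) : Plane)).card : ℝ)
        ≤ ((Finset.univ : Finset (Fin 3 × Fin 3 × Fin (n + 1))).card : ℝ) := by
          exact_mod_cast Finset.card_image_le
      _ = 9 * (n + 1) := by
          rw [Finset.card_univ]; simp; ring
      _ ≤ 9 * (triDiam R / h + 3) := by linarith
      _ ≤ 9 * (triDiam R + 3) / h := by
          rw [le_div_iff₀ hh]
          have : triDiam R / h * h = triDiam R := div_mul_cancel₀ _ hh.ne'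
          nlinarith
  · intro x hx
    have hxR := (isCompact_triSet R).isClosed.frontier_subset hx
    have h0 := mem_triSet.1 hxR
    have hxi : ¬ ∀ i, 0 < bary R i x := fun hi => hx.2 (mem_interior_triSet.2 hi)
    push Not at hxi
    obtain ⟨l, hl⟩ := hxi
    have hl0 : bary R l x = 0 := le_antisymm hl (h0 l)
    obtain ⟨a, b, hab, hal, hbl⟩ : ∃ a b : Fin 3, a ≠ b ∧ a ≠ l ∧ b ≠ l := by
      clear hl hl0; revert l; decide
    have hxe := lineMap_edge R hab hal hbl hl0
    set s := bary R b x with hs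
    have hs0 : 0 ≤ s := h0 b
    have hs1 : s ≤ 1 := by have := bary_sum' R hab hal hbl x; linarith [h0 a]
    have hfl := Nat.floor_le (mul_nonneg hn0.le hs0)
    have hfl2 := Nat.lt_floor_add_one (n * s)
    have hk : ⌊n * s⌋₊ < n + 1 := by
      have : (⌊n * s⌋₊ : ℝ) ≤ n := hfl.trans (by nlinarith)
      have : ⌊n * s⌋₊ ≤ n := by exact_mod_cast this
      omega
    refine ⟨_, Finset.mem_image_of_mem _ (Finset.mem_univ (a, b, ⟨⌊n * s⌋₊, hk⟩)), ?_⟩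
    conv_lhs => rw [hxe]
    rw [dist_lineMap_lineMap, Real.dist_eq]
    have hdist : |s - (⌊n * s⌋₊ : ℝ) / n| ≤ 1 / n := by
      rw [abs_le]
      constructor
      · rw [neg_le_sub_iff_le_add, div_le_iff₀ hn0]
        have : (s + 1 / n) * n = n * s + 1 := by field_simp
        linarith
      · rw [sub_le_iff_le_add, ← add_div, le_div_iff₀ hn0]
        linarith
    calc |s - (⌊n * s⌋₊ : ℝ) / n| * dist (R.points a) (R.points b)
        ≤ 1 / n * triDiam R :=
          mul_le_mul hdist (dist_le_triDiam (points_mem R a) (points_mem R b)) dist_nonneg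
            (by positivity)
      _ ≤ h := by rw [one_div_mul_eq_div, div_le_iff₀ hn0]; linarith

/-! ### Tiling a triangle, and the global mesh -/

theorem exists_mem_frontier {R S : Set Plane} (hR : IsClosed R) (hS : IsPreconnected S)
    {v y : Plane} (hv : v ∈ S) (hvR : v ∈ R) (hy : y ∈ S) (hyR : y ∉ interior R) :
    ∃ w ∈ S, w ∈ frontier R := by
  by_contra! hcon
  have hcov : S ⊆ interior R ∪ Rᶜ := by
    intro x hx
    by_cases hxR : x ∈ R
    · by_contra hc
      exact hcon x hx ⟨subset_closure hxR, fun hi => hc (Or.inl hi)⟩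
    · exact Or.inr hxR
  have h1 : v ∈ interior R := (hcov hv).resolve_right (fun h => h hvR)
  have h2 : y ∈ Rᶜ := (hcov hy).resolve_left hyR
  obtain ⟨x, -, hx1, hx2⟩ := hS _ _ isOpen_interior hR.isOpen_compl hcov ⟨v, hv, h1⟩ ⟨y, hy, h2⟩
  exact hx2 (interior_subset hx1)

open Classical in
/-- The triangles of a family which meet a given disc. -/
noncomputable def near (𝒯 : Finset Tri) (z : Plane) (r : ℝ) : Finset Tri :=
  𝒯.filter fun T => (triSet T ∩ Metric.closedBall z r).Nonempty

theorem mem_near {𝒯 : Finset Tri} {z : Plane} {r : ℝ} {T : Tri} :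
    T ∈ near 𝒯 z r ↔ T ∈ 𝒯 ∧ (triSet T ∩ Metric.closedBall z r).Nonempty := by
  simp [near]

open Classical in
/-- A triangle `R` is subdivided into tiles `± h • τ + c` and `O(1 / h)` small triangles along its
boundary. -/
theorem exists_tiling (R τ : Tri) {n : ℕ} (hn : 0 < n) {a : ℝ} (ha : 0 ≤ a) :
    ∃ C : ℝ, 0 ≤ C ∧ ∃ K : ℕ, ∀ h : ℝ, 0 < h → h ≤ 1 → ∃ 𝒩 𝒢 : Finset Tri,
      IsTriangulation (triSet R) 𝒩 ∧ 𝒢 ⊆ 𝒩 ∧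
      (∀ T ∈ 𝒢, ∃ (s : ℝ) (hs : s ≠ 0) (c : Plane), |s| = h ∧ T = τ.homothet s hs c) ∧
      (∀ T ∈ 𝒩, T ∉ 𝒢 → triDiam T ≤ 3 / n * (h * triDiam τ)) ∧
      ((𝒩 \ 𝒢).card : ℝ) ≤ C / h ∧ (𝒩 \ 𝒢).Nonempty ∧
      (∀ z, (near 𝒩 z (a * h)).card ≤ K) ∧
      (∀ T ∈ 𝒩, ∀ T' ∈ 𝒩, ∀ v ∈ triVertices T', v ∈ triSet T → v ∉ triVertices T →
        ∃ y ∈ frontier (triSet R), dist v y ≤ h * triDiam τ) := by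
  obtain ⟨C, hC, hnet⟩ := exists_frontier_net R
  obtain ⟨K₁, hK₁⟩ := exists_card_tile_le τ zero_le_one
  obtain ⟨K, hK⟩ := exists_card_tile_le τ ha
  -- Bounds the number of pieces of one boundary tile, which is cut by the three edge lines of `R`
  -- and by the `3 * (n + 1)` grid lines of the tile.
  set c : ℕ := 4 ^ Fintype.card (Fin 3 ⊕ Fin 3 × Fin (n + 1)) with hc
  have hc1 : 1 ≤ c := Nat.one_le_pow _ _ (by norm_num)
  refine ⟨C * (c * K₁), by positivity, K * c, fun h hh h1 => ?_⟩
  have hfin := finite_tiles_meeting τ h hh (isCompact_triSet R).isBounded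
  set J := hfin.toFinset with hJ
  set 𝒜 : Finset Tri := J.image (tile τ h hh) with h𝒜
  have hmem : ∀ S ∈ 𝒜, (triSet S ∩ triSet R).Nonempty ∧ ∃ t, S = tile τ h hh t := by
    intro S hS
    obtain ⟨t, ht, rfl⟩ := Finset.mem_image.1 hS
    exact ⟨hfin.mem_toFinset.1 ht, t, rfl⟩
  have htri𝒜 : IsTriangulation (⋃ S ∈ 𝒜, triSet S) 𝒜 := by
    refine ⟨rfl, fun S hS S' hS' hne => ?_⟩
    obtain ⟨-, t, rfl⟩ := hmem S hS
    obtain ⟨-, t', rfl⟩ := hmem S' hS'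
    exact disjoint_interior_tile τ h hh fun e => hne (by rw [e])
  have hR𝒜 : triSet R ⊆ ⋃ S ∈ 𝒜, triSet S := by
    intro x hx
    obtain ⟨t, ht⟩ := exists_mem_tile τ h hh x
    exact Set.mem_biUnion (x := tile τ h hh t) (Finset.mem_image_of_mem _
      (hfin.mem_toFinset.2 ⟨x, ht, hx⟩)) ht
  have hnear𝒜 : ∀ (z : Plane) (b : ℝ) (M : ℕ), (∀ J : Finset (ℤ × ℤ × Bool),
      (∀ t ∈ J, (triSet (tile τ h hh t) ∩ Metric.closedBall z (b * h)).Nonempty) → J.card ≤ M) →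
      (near 𝒜 z (b * h)).card ≤ M := by
    intro z b M hM
    have hsub : near 𝒜 z (b * h) ⊆ (J.filter fun t =>
        (triSet (tile τ h hh t) ∩ Metric.closedBall z (b * h)).Nonempty).image (tile τ h hh) := by
      intro S hS
      obtain ⟨hS, hS'⟩ := mem_near.1 hS
      obtain ⟨t, ht, rfl⟩ := Finset.mem_image.1 hS
      exact Finset.mem_image_of_mem _ (Finset.mem_filter.2 ⟨ht, hS'⟩)
    refine (Finset.card_le_card hsub).trans (Finset.card_image_le.trans (hM _ ?_))
    intro t ht
    exact (Finset.mem_filter.1 ht).2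
  -- subdivide the tiles which are not in the interior of `R`
  have hcut : ∀ S : Tri, ∃ 𝒮 : Finset Tri, IsTriangulation (triSet S) 𝒮 ∧ 𝒮.card ≤ c ∧
      (∀ P ∈ 𝒮, ∀ i, OneSided (bary R i) (triSet P)) ∧
      (triSet S ⊆ interior (triSet R) → 𝒮 = {S}) ∧
      (¬ triSet S ⊆ interior (triSet R) → ∀ P ∈ 𝒮, triDiam P ≤ 3 / n * triDiam S) := by
    intro S
    by_cases hS : triSet S ⊆ interior (triSet R)
    · refine ⟨{S}, isTriangulation_singleton S, by simpa using hc1, ?_, fun _ => rfl,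
        fun h => absurd hS h⟩
      intro P hP i
      rw [Finset.mem_singleton.1 hP]
      exact Or.inl fun x hx => (mem_interior_triSet.1 (hS hx) i).le
    · obtain ⟨𝒮, k1, k2, k3⟩ := exists_cut_family (Sum.elim (bary R) (gridLine S n)) S
      exact ⟨𝒮, k1, k2, fun P hP i => k3 P hP (Sum.inl i), fun h => absurd h hS,
        fun _ P hP => triDiam_le_of_oneSided hn (k1.subset hP) fun j => k3 P hP (Sum.inr j)⟩
  choose 𝒮 k1 k2 k3 k4 k5 using hcut
  have htri1 := htri𝒜.biUnion (𝒮 := 𝒮) (fun S _ => k1 S)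
  have htri2 := htri1.filter_subset {R} (by simpa using hR𝒜) (by
    intro P hP R' hR' i
    rw [Finset.mem_singleton.1 hR']
    obtain ⟨S, hS, hP⟩ := Finset.mem_biUnion.1 hP
    exact k3 S P hP i)
  simp only [Finset.mem_singleton, Set.iUnion_iUnion_eq_left, exists_eq_left] at htri2
  set 𝒩 := (𝒜.biUnion 𝒮).filter fun P => triSet P ⊆ triSet R with h𝒩
  set 𝒢 := 𝒜.filter fun S => triSet S ⊆ interior (triSet R) with h𝒢
  have h𝒩mem : ∀ P ∈ 𝒩, ∃ S ∈ 𝒜, P ∈ 𝒮 S := fun P hP =>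
    Finset.mem_biUnion.1 (Finset.mem_filter.1 hP).1
  have hborder : ∀ S ∈ 𝒜, ∀ P ∈ 𝒮 S, P ∉ 𝒢 → ¬ triSet S ⊆ interior (triSet R) := by
    intro S hS P hP hPG hSi
    rw [k4 S hSi, Finset.mem_singleton] at hP
    rw [hP] at hPG
    exact hPG (Finset.mem_filter.2 ⟨hS, hSi⟩)
  have hfrontier : ∀ S ∈ 𝒜, ¬ triSet S ⊆ interior (triSet R) → ∀ v ∈ triSet S, v ∈ triSet R →
      ∃ w ∈ triSet S, w ∈ frontier (triSet R) := by
    intro S hS hSi v hv hvR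
    obtain ⟨y, hy, hyi⟩ := Set.not_subset.1 hSi
    exact exists_mem_frontier (isCompact_triSet R).isClosed (convex_triSet S).isPreconnected
      hv hvR hy hyi
  refine ⟨𝒩, 𝒢, htri2, ?_, ?_, ?_, ?_, ?_, ?_, ?_⟩
  · intro S hS
    obtain ⟨hS, hSi⟩ := Finset.mem_filter.1 hS
    refine Finset.mem_filter.2 ⟨Finset.mem_biUnion.2 ⟨S, hS, ?_⟩, hSi.trans interior_subset⟩
    rw [k4 S hSi]
    exact Finset.mem_singleton_self S
  · intro S hS
    obtain ⟨-, t, rfl⟩ := hmem S (Finset.mem_filter.1 hS).1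
    exact tile_eq_homothet τ h hh t
  · intro P hP hPG
    obtain ⟨S, hS, hPS⟩ := h𝒩mem P hP
    have := k5 S (hborder S hS P hPS hPG) P hPS
    obtain ⟨-, t, rfl⟩ := hmem S hS
    rwa [triDiam_tile] at this
  · obtain ⟨Z, hZ, hZ'⟩ := hnet h hh h1
    -- A piece outside `𝒢` comes from a tile reaching the boundary of `R`, hence from one of
    -- boundedly many tiles near one of the `O(1 / h)` net points.
    have hsub : 𝒩 \ 𝒢 ⊆ Z.biUnion fun z => (near 𝒜 z (1 * h)).biUnion 𝒮 := by
      intro P hP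
      obtain ⟨hP, hPG⟩ := Finset.mem_sdiff.1 hP
      obtain ⟨S, hS, hPS⟩ := h𝒩mem P hP
      have hPR := (Finset.mem_filter.1 hP).2 (points_mem P 0)
      obtain ⟨w, hw, hwR⟩ := hfrontier S hS (hborder S hS P hPS hPG) _
        ((k1 S).subset hPS (points_mem P 0)) hPR
      obtain ⟨z, hz, hwz⟩ := hZ' w hwR
      exact Finset.mem_biUnion.2 ⟨z, hz, Finset.mem_biUnion.2
        ⟨S, mem_near.2 ⟨hS, w, hw, by rw [one_mul]; exact hwz⟩, hPS⟩⟩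
    have hcard : (𝒩 \ 𝒢).card ≤ Z.card * (K₁ * c) := by
      refine (Finset.card_le_card hsub).trans (Finset.card_biUnion_le_card_mul _ _ _ ?_)
      intro z _
      refine (Finset.card_biUnion_le_card_mul _ _ c fun S _ => k2 S).trans ?_
      exact Nat.mul_le_mul_right c (hnear𝒜 z 1 K₁ (fun J hJ => hK₁ h hh z J hJ))
    calc ((𝒩 \ 𝒢).card : ℝ) ≤ (Z.card : ℝ) * (K₁ * c) := by exact_mod_cast hcard
      _ ≤ C / h * (K₁ * c) := by gcongr
      _ = C * (c * K₁) / h := by ring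
  · obtain ⟨x, hx⟩ : (frontier (triSet R)).Nonempty :=
      ((infinite_frontier_diff (isCompact_triSet R) (interior_triSet_nonempty R)
        Set.finite_empty).mono Set.sdiff_subset).nonempty
    obtain ⟨P, hP, hxP⟩ := htri2.exists_mem ((isCompact_triSet R).isClosed.frontier_subset hx)
    refine ⟨P, Finset.mem_sdiff.2 ⟨hP, fun hPG => ?_⟩⟩
    exact hx.2 ((Finset.mem_filter.1 hPG).2 hxP)
  · intro z
    have hsub : near 𝒩 z (a * h) ⊆ (near 𝒜 z (a * h)).biUnion 𝒮 := by
      intro P hP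
      obtain ⟨hP, x, hx, hxz⟩ := mem_near.1 hP
      obtain ⟨S, hS, hPS⟩ := h𝒩mem P hP
      exact Finset.mem_biUnion.2 ⟨S, mem_near.2 ⟨hS, x, (k1 S).subset hPS hx, hxz⟩, hPS⟩
    refine (Finset.card_le_card hsub).trans ?_
    refine (Finset.card_biUnion_le_card_mul _ _ c fun S _ => k2 S).trans ?_
    exact Nat.mul_le_mul_right c (hnear𝒜 z a K (fun J hJ => hK h hh z J hJ))
  · intro T hT T' hT' v hv hvT hvn
    obtain ⟨S, hS, hTS⟩ := h𝒩mem T hT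
    obtain ⟨S', hS', hTS'⟩ := h𝒩mem T' hT'
    have hvR : v ∈ triSet R := (Finset.mem_filter.1 hT).2 hvT
    have close : ∀ S ∈ 𝒜, v ∈ triSet S → ¬ triSet S ⊆ interior (triSet R) →
        ∃ y ∈ frontier (triSet R), dist v y ≤ h * triDiam τ := by
      intro S hS hvS hSi
      obtain ⟨w, hw, hwR⟩ := hfrontier S hS hSi v hvS hvR
      refine ⟨w, hwR, ?_⟩
      have := dist_le_triDiam hvS hw
      obtain ⟨-, t, rfl⟩ := hmem S hS
      rwa [triDiam_tile] at this
    have hvS : v ∈ triSet S := (k1 S).subset hTS hvT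
    have hvS' : v ∈ triSet S' := (k1 S').subset hTS' (triVertices_subset T' hv)
    -- Two uncut tiles fit together conformingly, so a hanging vertex lies on some cut tile, and
    -- that tile reaches the boundary of `R`.
    by_cases hSi : triSet S ⊆ interior (triSet R)
    · by_cases hSi' : triSet S' ⊆ interior (triSet R)
      · exfalso
        rw [k4 S hSi, Finset.mem_singleton] at hTS
        rw [k4 S' hSi', Finset.mem_singleton] at hTS'
        subst hTS hTS'
        obtain ⟨-, t, rfl⟩ := hmem _ hS
        obtain ⟨-, t', rfl⟩ := hmem _ hS'
        exact hvn (mem_triVertices_tile hv hvT)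
      · exact close S' hS' hvS' hSi'
    · exact close S hS hvS hSi

open Classical in
-- The tilings of the members of `𝓡` are put together. Comparing areas bounds the number of tiles.
-- Hanging vertices occur only within `h * D` of the boundaries of the members of `𝓡`, hence `O(1 /
-- h)` times. The parameter `n` is the factor by which boundary pieces are refined.
theorem exists_mesh {Ω : Set Plane} {𝓡 : Finset Tri} (h𝓡 : IsTriangulation Ω 𝓡)
    (hne : 𝓡.Nonempty) (τ : Tri → Tri) {n : ℕ} (hn : 0 < n) :
    ∃ C : ℝ, 0 ≤ C ∧ ∀ h : ℝ, 0 < h → h ≤ 1 → ∃ 𝒯 𝒢 : Finset Tri,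
      IsTriangulation Ω 𝒯 ∧ 𝒢 ⊆ 𝒯 ∧
      (∀ T ∈ 𝒢, ∃ R ∈ 𝓡, triSet T ⊆ triSet R ∧
        ∃ (s : ℝ) (hs : s ≠ 0) (c : Plane), |s| = h ∧ T = (τ R).homothet s hs c) ∧
      (𝒢.card : ℝ) ≤ (∑ R ∈ 𝓡, triArea R / triArea (τ R)) / h ^ 2 ∧
      (∀ T ∈ 𝒯, T ∉ 𝒢 → triDiam T ≤ 3 / n * (h * ∑ R ∈ 𝓡, triDiam (τ R))) ∧
      ((𝒯 \ 𝒢).card : ℝ) ≤ C / h ∧ (𝒯 \ 𝒢).Nonempty ∧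
      ((∑ T ∈ 𝒯, (hanging (vertexFinset 𝒯) T).card : ℕ) : ℝ) ≤ C / h := by
  set D := ∑ R ∈ 𝓡, triDiam (τ R) with hD
  have hD0 : 0 ≤ D := Finset.sum_nonneg fun R _ => triDiam_nonneg _
  have hDle : ∀ R ∈ 𝓡, triDiam (τ R) ≤ D := fun R hR =>
    Finset.single_le_sum (f := fun R => triDiam (τ R)) (fun R _ => triDiam_nonneg _) hR
  choose C₁ hC₁ K hK using fun R => exists_tiling R (τ R) hn (a := D + 1) (by linarith)
  choose C₂ hC₂ hnet using exists_frontier_net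
  set M : ℕ := ∑ R ∈ 𝓡, K R with hM
  have hCa : 0 ≤ ∑ R ∈ 𝓡, C₁ R := Finset.sum_nonneg fun R _ => hC₁ R
  have hCb : 0 ≤ ∑ R ∈ 𝓡, C₂ R := Finset.sum_nonneg fun R _ => hC₂ R
  refine ⟨∑ R ∈ 𝓡, C₁ R + (∑ R ∈ 𝓡, C₂ R) * (M * (M * 3)), by positivity, fun h hh h1 => ?_⟩
  choose 𝒩 𝒢 k1 k2 k3 k4 k5 k6 k7 k8 using fun R => hK R h hh h1
  choose Z hZ hZ' using fun R => hnet R h hh h1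
  have htri := h𝓡.biUnion (fun R _ => k1 R)
  have hsd : 𝓡.biUnion 𝒩 \ 𝓡.biUnion 𝒢 ⊆ 𝓡.biUnion fun R => 𝒩 R \ 𝒢 R := by
    intro T hT
    obtain ⟨hT, hTG⟩ := Finset.mem_sdiff.1 hT
    obtain ⟨R, hR, hT⟩ := Finset.mem_biUnion.1 hT
    exact Finset.mem_biUnion.2 ⟨R, hR, Finset.mem_sdiff.2 ⟨hT, fun hc =>
      hTG (Finset.mem_biUnion.2 ⟨R, hR, hc⟩)⟩⟩
  have hDh : ∀ R ∈ 𝓡, h * triDiam (τ R) ≤ h * D := fun R hR =>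
    mul_le_mul_of_nonneg_left (hDle R hR) hh.le
  refine ⟨𝓡.biUnion 𝒩, 𝓡.biUnion 𝒢, htri, ?_, ?_, ?_, ?_, ?_, ?_, ?_⟩
  · exact Finset.biUnion_mono fun R _ => k2 R
  · intro T hT
    obtain ⟨R, hR, hT⟩ := Finset.mem_biUnion.1 hT
    exact ⟨R, hR, (k1 R).subset (k2 R hT), k3 R T hT⟩
  · calc ((𝓡.biUnion 𝒢).card : ℝ) ≤ ∑ R ∈ 𝓡, ((𝒢 R).card : ℝ) := by
          exact_mod_cast Finset.card_biUnion_le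
      _ ≤ ∑ R ∈ 𝓡, triArea R / triArea (τ R) / h ^ 2 := by
          refine Finset.sum_le_sum fun R _ => ?_
          have key := sum_triArea_le (𝒢 R) id
            (fun T hT T' hT' => (k1 R).nonoverlapping T (k2 R hT) T' (k2 R hT'))
            (fun T hT => (k1 R).subset (k2 R hT)) (volume_triSet_ne_top R)
          have hconst : ∀ T ∈ 𝒢 R, triArea (id T) = h ^ 2 * triArea (τ R) := by
            intro T hT
            obtain ⟨s, hs, c, hsh, rfl⟩ := k3 R T hT
            rw [id, triArea_homothet, ← hsh, sq_abs]
          rw [Finset.sum_congr rfl hconst, Finset.sum_const, nsmul_eq_mul] at key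
          rw [div_div, le_div_iff₀ (mul_pos (triArea_pos _) (by positivity)),
            mul_comm (triArea (τ R))]
          exact key
      _ = _ := by rw [Finset.sum_div]
  · intro T hT hTG
    obtain ⟨R, hR, hT⟩ := Finset.mem_biUnion.1 hT
    refine (k4 R T hT fun hc => hTG (Finset.mem_biUnion.2 ⟨R, hR, hc⟩)).trans ?_
    exact mul_le_mul_of_nonneg_left (hDh R hR) (by positivity)
  · calc ((𝓡.biUnion 𝒩 \ 𝓡.biUnion 𝒢).card : ℝ) ≤ ((𝓡.biUnion fun R => 𝒩 R \ 𝒢 R).card : ℝ) := by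
          exact_mod_cast Finset.card_le_card hsd
      _ ≤ ∑ R ∈ 𝓡, ((𝒩 R \ 𝒢 R).card : ℝ) := by exact_mod_cast Finset.card_biUnion_le
      _ ≤ ∑ R ∈ 𝓡, C₁ R / h := Finset.sum_le_sum fun R _ => k5 R
      _ = (∑ R ∈ 𝓡, C₁ R) / h := by rw [Finset.sum_div]
      _ ≤ _ := by
          gcongr
          have : 0 ≤ (∑ R ∈ 𝓡, C₂ R) * (M * (M * 3)) := by positivity
          linarith
  · obtain ⟨R, hR⟩ := hne
    obtain ⟨T, hT⟩ := k6 R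
    obtain ⟨hT, hTG⟩ := Finset.mem_sdiff.1 hT
    refine ⟨T, Finset.mem_sdiff.2 ⟨Finset.mem_biUnion.2 ⟨R, hR, hT⟩, fun hc => ?_⟩⟩
    obtain ⟨R', hR', hTR'⟩ := Finset.mem_biUnion.1 hc
    by_cases hRR : R = R'
    · subst hRR
      exact hTG hTR'
    · exact Finset.disjoint_left.1 (h𝓡.pairwiseDisjoint (fun R _ => k1 R) hR hR' hRR) hT
        (k2 R' hTR')
  · set 𝒯 := 𝓡.biUnion 𝒩 with h𝒯
    set r := (D + 1) * h with hr
    have hnear : ∀ z, (near 𝒯 z r).card ≤ M := by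
      intro z
      have hsub : near 𝒯 z r ⊆ 𝓡.biUnion fun R => near (𝒩 R) z r := by
        intro T hT
        obtain ⟨hT, hTz⟩ := mem_near.1 hT
        obtain ⟨R, hR, hT⟩ := Finset.mem_biUnion.1 hT
        exact Finset.mem_biUnion.2 ⟨R, hR, mem_near.2 ⟨hT, hTz⟩⟩
      exact (Finset.card_le_card hsub).trans (Finset.card_biUnion_le.trans
        (Finset.sum_le_sum fun R _ => k7 R z))
    have hclose : ∀ T ∈ 𝒯, ∀ v ∈ hanging (vertexFinset 𝒯) T,
        ∃ R ∈ 𝓡, ∃ y ∈ frontier (triSet R), dist v y ≤ h * D := by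
      intro T hT v hv
      obtain ⟨hvV, hvT, hvn⟩ := mem_hanging.1 hv
      obtain ⟨T', hT', hvT'⟩ := mem_vertexFinset.1 hvV
      obtain ⟨R, hR, hT⟩ := Finset.mem_biUnion.1 hT
      obtain ⟨R', hR', hT'⟩ := Finset.mem_biUnion.1 hT'
      refine ⟨R, hR, ?_⟩
      by_cases hRR : R = R'
      · subst hRR
        obtain ⟨y, hy, hvy⟩ := k8 R T hT T' hT' v hvT' hvT hvn
        exact ⟨y, hy, hvy.trans (hDh R hR)⟩
      · refine ⟨v, ⟨subset_closure ((k1 R).subset hT hvT), fun hi => ?_⟩, ?_⟩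
        · exact Set.disjoint_left.1 (disjoint_interior_left
            (h𝓡.nonoverlapping R hR R' hR' hRR)) hi
            ((k1 R').subset hT' (triVertices_subset T' hvT'))
        · rw [dist_self]; positivity
    -- For a hanging vertex `v` of `T`, both `T` and a triangle having `v` as a vertex meet the disc
    -- of radius `r` around some net point. At most `M` triangles do so, and they have at most `3 *
    -- M` vertices.
    have hsub : (𝒯.sigma fun T => hanging (vertexFinset 𝒯) T) ⊆
        ((𝓡.biUnion Z).biUnion fun z => (near 𝒯 z r).sigma
          fun _ => vertexFinset (near 𝒯 z r)) := by
      rintro ⟨T, v⟩ hTv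
      obtain ⟨hT, hv⟩ := Finset.mem_sigma.1 hTv
      simp only at hT hv
      obtain ⟨R, hR, y, hy, hvy⟩ := hclose T hT v hv
      obtain ⟨z, hz, hyz⟩ := hZ' R y hy
      have hvz : v ∈ Metric.closedBall z r := by
        rw [Metric.mem_closedBall]
        calc dist v z ≤ dist v y + dist y z := dist_triangle _ _ _
          _ ≤ h * D + h := add_le_add hvy hyz
          _ = r := by rw [hr]; ring
      obtain ⟨hvV, hvT, hvn⟩ := mem_hanging.1 hv
      obtain ⟨T', hT', hvT'⟩ := mem_vertexFinset.1 hvV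
      refine Finset.mem_biUnion.2 ⟨z, Finset.mem_biUnion.2 ⟨R, hR, hz⟩, Finset.mem_sigma.2 ⟨?_, ?_⟩⟩
      · exact mem_near.2 ⟨hT, v, hvT, hvz⟩
      · exact mem_vertexFinset.2 ⟨T', mem_near.2 ⟨hT', v, triVertices_subset T' hvT', hvz⟩, hvT'⟩
    have hcard : ∑ T ∈ 𝒯, (hanging (vertexFinset 𝒯) T).card ≤ (∑ R ∈ 𝓡, (Z R).card) * (M * (M * 3)) := by
      rw [← Finset.card_sigma]
      refine (Finset.card_le_card hsub).trans ((Finset.card_biUnion_le_card_mul _ _ (M * (M * 3))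
        ?_).trans (Nat.mul_le_mul_right _ Finset.card_biUnion_le))
      intro z _
      rw [Finset.card_sigma, Finset.sum_const, smul_eq_mul]
      refine Nat.mul_le_mul (hnear z) ?_
      refine (Finset.card_biUnion_le_card_mul _ _ 3 fun T _ => ?_).trans
        (Nat.mul_le_mul_right 3 (hnear z))
      exact Finset.card_image_le.trans (by simp)
    calc ((∑ T ∈ 𝒯, (hanging (vertexFinset 𝒯) T).card : ℕ) : ℝ)
        ≤ (∑ R ∈ 𝓡, ((Z R).card : ℝ)) * (M * (M * 3)) := by exact_mod_cast hcard
      _ ≤ (∑ R ∈ 𝓡, C₂ R / h) * (M * (M * 3)) := by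
          gcongr with R _
          exact hZ R
      _ = (∑ R ∈ 𝓡, C₂ R) * (M * (M * 3)) / h := by rw [← Finset.sum_div]; ring
      _ ≤ _ := by
          gcongr
          linarith

/-! ### Meshes with a prescribed number of triangles -/

theorem triArea_le_triDiam (T : Tri) :
    triArea T ≤ triDiam T ^ 2 * (volume (Metric.closedBall (0 : Plane) 1)).toReal := by
  have hsub : triSet T ⊆ Metric.closedBall (T.points 0) (triDiam T * 1) := by
    intro x hx
    rw [mul_one]
    exact dist_le_triDiam hx (points_mem T 0)
  have h := ENNReal.toReal_mono measure_closedBall_lt_top.ne (measure_mono (μ := volume) hsub)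
  rw [Measure.addHaar_closedBall_mul _ _ (triDiam_nonneg T) zero_le_one, ENNReal.toReal_mul,
    ENNReal.toReal_ofReal (pow_nonneg (triDiam_nonneg T) _)] at h
  simpa [triArea] using h

open Classical in
-- The count is raised to `N` by splitting one triangle outside `𝒢`. Its pieces inherit the diameter
-- bound, and all tiles with the sharp error bound survive. This version serves `p = ∞`.
theorem exists_mesh_card {Ω : Set Plane} {𝓡 : Finset Tri} (h𝓡 : IsTriangulation Ω 𝓡)
    (hne : 𝓡.Nonempty) (τ : Tri → Tri) {n : ℕ} (hn : 0 < n) :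
    ∃ C : ℝ, 0 ≤ C ∧ ∀ h : ℝ, 0 < h → h ≤ 1 → ∀ N : ℕ,
      (∑ R ∈ 𝓡, triArea R / triArea (τ R)) / h ^ 2 + C / h ≤ N → ∃ 𝒯 𝒢 : Finset Tri,
      IsTriangulation Ω 𝒯 ∧ 𝒯.card = N ∧
      (∀ T ∈ 𝒢, ∃ R ∈ 𝓡, triSet T ⊆ triSet R ∧
        ∃ (s : ℝ) (hs : s ≠ 0) (c : Plane), |s| = h ∧ T = (τ R).homothet s hs c) ∧
      (∀ T ∈ 𝒯, T ∉ 𝒢 → triDiam T ≤ 3 / n * (h * ∑ R ∈ 𝓡, triDiam (τ R))) := by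
  obtain ⟨C, hC, hmesh⟩ := exists_mesh h𝓡 hne τ hn
  refine ⟨C, hC, fun h hh h1 N hN => ?_⟩
  obtain ⟨𝒯, 𝒢, k1, k2, k3, k4, k5, k6, ⟨T₀, hT₀⟩, -⟩ := hmesh h hh h1
  obtain ⟨hT₀, hT₀G⟩ := Finset.mem_sdiff.1 hT₀
  have hcard : 𝒯.card ≤ N := by
    have : (𝒯.card : ℝ) ≤ N := by
      refine le_trans ?_ hN
      rw [← Finset.card_sdiff_add_card_eq_card k2]
      push_cast
      linarith
    exact_mod_cast this
  obtain ⟨T₁, hT₁, hinf⟩ := (isTriangulation_singleton T₀).exists_infinite_boundary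
    (Finset.singleton_nonempty T₀)
  rw [Finset.mem_singleton] at hT₁
  subst hT₁
  obtain ⟨X, hX, hXcard⟩ := hinf.exists_subset_card_eq (N - 𝒯.card)
  obtain ⟨𝒮₁, s1, s2, -⟩ := exists_split X T₁ (fun x hx => (hX hx).2.1)
  have hhang : hanging X T₁ = X := by
    ext x
    rw [mem_hanging]
    refine ⟨fun hx => hx.1, fun hx => ⟨hx, (hX hx).1, (hX hx).2.2.1 _ (by simp)⟩⟩
  rw [hhang, hXcard] at s2
  set 𝒮 : Tri → Finset Tri := fun T => if T = T₁ then 𝒮₁ else {T} with h𝒮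
  have h𝒮tri : ∀ T ∈ 𝒯, IsTriangulation (triSet T) (𝒮 T) := by
    intro T _
    by_cases hT : T = T₁
    · subst hT
      simpa [h𝒮] using s1
    · simpa [h𝒮, hT] using isTriangulation_singleton T
  refine ⟨𝒯.biUnion 𝒮, 𝒢, k1.biUnion h𝒮tri, ?_, k3, ?_⟩
  · rw [Finset.card_biUnion (k1.pairwiseDisjoint h𝒮tri), ← Finset.add_sum_erase _ _ hT₀]
    have : ∀ T ∈ 𝒯.erase T₁, (𝒮 T).card = 1 := by
      intro T hT
      simp [h𝒮, Finset.ne_of_mem_erase hT]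
    rw [Finset.sum_congr rfl this, Finset.sum_const, Finset.card_erase_of_mem hT₀]
    have hpos : 0 < 𝒯.card := Finset.card_pos.2 ⟨_, hT₀⟩
    simp only [h𝒮, if_true, smul_eq_mul, mul_one, s2]
    omega
  · intro S hS hSG
    obtain ⟨T, hT, hST⟩ := Finset.mem_biUnion.1 hS
    by_cases hTT : T = T₁
    · subst hTT
      exact (triDiam_mono ((h𝒮tri T hT).subset hST)).trans (k5 T hT hT₀G)
    · simp only [h𝒮, hTT, if_false, Finset.mem_singleton] at hST
      subst hST
      exact k5 _ hT hSG

open Classical in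
-- This version serves `p < ∞`. Tiles carrying a hanging vertex or an extra point are split and
-- leave `𝒢`; there are `O(1 / h)` of them, each of area `O(h ^ 2)`, so the part of `Ω` without the
-- sharp error bound still has area `O(h)`.
theorem exists_conforming_mesh_card {Ω : Set Plane} {𝓡 : Finset Tri} (h𝓡 : IsTriangulation Ω 𝓡)
    (hne : 𝓡.Nonempty) (τ : Tri → Tri) :
    ∃ C : ℝ, 0 ≤ C ∧ ∀ h : ℝ, 0 < h → h ≤ 1 → ∀ N : ℕ,
      (∑ R ∈ 𝓡, triArea R / triArea (τ R)) / h ^ 2 + C / h ≤ N → ∃ 𝒯 𝒢 : Finset Tri,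
      IsTriangulation Ω 𝒯 ∧ IsConforming 𝒯 ∧ 𝒯.card = N ∧
      (∀ T ∈ 𝒢, ∃ R ∈ 𝓡, triSet T ⊆ triSet R ∧
        ∃ (s : ℝ) (hs : s ≠ 0) (c : Plane), |s| = h ∧ T = (τ R).homothet s hs c) ∧
      (𝒢.card : ℝ) ≤ (∑ R ∈ 𝓡, triArea R / triArea (τ R)) / h ^ 2 ∧
      (∀ T ∈ 𝒯, triDiam T ≤ C * h) ∧ ∑ T ∈ 𝒯 \ 𝒢, triArea T ≤ C * h := by
  obtain ⟨C, hC, hmesh⟩ := exists_mesh h𝓡 hne τ one_pos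
  set D := ∑ R ∈ 𝓡, triDiam (τ R) with hD
  have hD0 : 0 ≤ D := Finset.sum_nonneg fun R _ => triDiam_nonneg _
  have hDle : ∀ R ∈ 𝓡, triDiam (τ R) ≤ D := fun R hR =>
    Finset.single_le_sum (f := fun R => triDiam (τ R)) (fun R _ => triDiam_nonneg _) hR
  set ω := (volume (Metric.closedBall (0 : Plane) 1)).toReal with hω
  have hω0 : 0 ≤ ω := ENNReal.toReal_nonneg
  -- One constant for three purposes: `2 * C` counts boundary pieces and hanging vertices, `3 * D`
  -- bounds diameters, and the last term bounds the area of at most `(2 * C + 1) / h` triangles of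
  -- diameter at most `3 * D * h`.
  refine ⟨2 * C + 3 * D + (2 * C + 1) * ((3 * D) ^ 2 * ω), by positivity, fun h hh h1 N hN => ?_⟩
  have hX0 : 0 ≤ (2 * C + 1) * ((3 * D) ^ 2 * ω) := by positivity
  obtain ⟨𝒯, 𝒢, k1, k2, k3, k4, k5, k6, hsd, k7⟩ := hmesh h hh h1
  have h𝒯ne : 𝒯.Nonempty := hsd.mono Finset.sdiff_subset
  have hdiam : ∀ T ∈ 𝒯, triDiam T ≤ 3 * D * h := by
    intro T hT
    by_cases hTG : T ∈ 𝒢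
    · obtain ⟨R, hR, -, s, hs, c, hsh, rfl⟩ := k3 T hTG
      rw [triDiam_homothet, hsh]
      have := mul_le_mul_of_nonneg_left (hDle R hR) hh.le
      nlinarith
    · have := k5 T hT hTG
      simp only [Nat.cast_one, div_one] at this
      linarith
  set V₀ := vertexFinset 𝒯 with hV₀
  have htotal : 𝒯.card + ∑ T ∈ 𝒯, (hanging V₀ T).card ≤ N := by
    have : ((𝒯.card + ∑ T ∈ 𝒯, (hanging V₀ T).card : ℕ) : ℝ) ≤ N := by
      refine le_trans ?_ hN
      rw [← Finset.card_sdiff_add_card_eq_card k2]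
      have e : C / h + C / h ≤
          (2 * C + 3 * D + (2 * C + 1) * ((3 * D) ^ 2 * ω)) / h := by
        rw [← add_div]
        exact div_le_div_of_nonneg_right (by linarith) hh.le
      push_cast at k7 ⊢
      linarith
    exact_mod_cast this
  obtain ⟨T₁, hT₁, hinf⟩ := k1.exists_infinite_boundary h𝒯ne
  -- As many extra points as triangles are missing: each of them hangs on `T₁` only and adds one
  -- triangle.
  obtain ⟨X, hX, hXcard⟩ := hinf.exists_subset_card_eq
    (N - (𝒯.card + ∑ T ∈ 𝒯, (hanging V₀ T).card))
  have hother : ∀ T ∈ 𝒯, T ≠ T₁ → hanging (V₀ ∪ X) T = hanging V₀ T := by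
    intro T hT hTT
    ext x
    rw [mem_hanging, mem_hanging, Finset.mem_union]
    constructor
    · rintro ⟨hx | hx, h2⟩
      · exact ⟨hx, h2⟩
      · exact absurd h2.1 ((hX hx).2.2.2 T hT hTT)
    · rintro ⟨hx, h2⟩
      exact ⟨Or.inl hx, h2⟩
  have hthis : (hanging (V₀ ∪ X) T₁).card = (hanging V₀ T₁).card + X.card := by
    rw [← Finset.card_union_of_disjoint]
    · congr 1
      ext x
      rw [Finset.mem_union, mem_hanging, mem_hanging, Finset.mem_union]
      constructor
      · rintro ⟨hx | hx, h2⟩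
        · exact Or.inl ⟨hx, h2⟩
        · exact Or.inr hx
      · rintro (⟨hx, h2⟩ | hx)
        · exact ⟨Or.inl hx, h2⟩
        · exact ⟨Or.inr hx, (hX hx).1, (hX hx).2.2.1 T₁ hT₁⟩
    · rw [Finset.disjoint_left]
      intro x hx hxX
      obtain ⟨T', hT', hxT'⟩ := mem_vertexFinset.1 (mem_hanging.1 hx).1
      exact (hX hxX).2.2.1 T' hT' hxT'
  obtain ⟨𝒮, s1, s2, s3, s4⟩ := k1.exists_conforming (V₀ ∪ X) Finset.subset_union_left (by
    intro v hv T hT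
    rcases Finset.mem_union.1 hv with hv | hv
    · exact k1.vertexFinset_notMem_interior hv hT
    · by_cases hTT : T = T₁
      · subst hTT
        exact (hX hv).2.1
      · exact fun hi => (hX hv).2.2.2 T hT hTT (interior_subset hi))
  have hsum : ∑ T ∈ 𝒯, (hanging (V₀ ∪ X) T).card = ∑ T ∈ 𝒯, (hanging V₀ T).card + X.card := by
    rw [← Finset.add_sum_erase _ _ hT₁, ← Finset.add_sum_erase _ _ hT₁, hthis,
      Finset.sum_congr rfl fun T hT => by
        rw [hother T (Finset.mem_of_mem_erase hT) (Finset.ne_of_mem_erase hT)]]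
    ring
  have htri := k1.biUnion s1
  set 𝒢' := 𝒢.filter fun T => hanging (V₀ ∪ X) T = ∅ with h𝒢'
  set B := 𝒯.filter fun T => T ∉ 𝒢 ∨ hanging (V₀ ∪ X) T ≠ ∅ with hB
  refine ⟨𝒯.biUnion 𝒮, 𝒢', htri, s3, ?_, ?_, ?_, ?_, ?_⟩
  · rw [s4, Finset.sum_add_distrib, hsum, hXcard, Finset.sum_const, smul_eq_mul, mul_one]
    omega
  · intro T hT
    exact k3 T (Finset.mem_filter.1 hT).1
  · refine le_trans ?_ k4
    exact_mod_cast Finset.card_filter_le _ _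
  · intro S hS
    obtain ⟨T, hT, hST⟩ := Finset.mem_biUnion.1 hS
    refine (triDiam_mono ((s1 T hT).subset hST)).trans ((hdiam T hT).trans ?_)
    gcongr
    linarith
  · have hsub : 𝒯.biUnion 𝒮 \ 𝒢' ⊆ B.biUnion 𝒮 := by
      intro S hS
      obtain ⟨hS, hSG⟩ := Finset.mem_sdiff.1 hS
      obtain ⟨T, hT, hST⟩ := Finset.mem_biUnion.1 hS
      refine Finset.mem_biUnion.2 ⟨T, Finset.mem_filter.2 ⟨hT, ?_⟩, hST⟩
      by_contra! hcon
      rw [s2 T hT hcon.2, Finset.mem_singleton] at hST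
      subst hST
      exact hSG (Finset.mem_filter.2 ⟨hcon.1, hcon.2⟩)
    have hBcard : (B.card : ℝ) ≤ (2 * C + 1) / h := by
      have hBsub : B ⊆ (𝒯 \ 𝒢) ∪ insert T₁ (𝒯.filter fun T => hanging V₀ T ≠ ∅) := by
        intro T hT
        obtain ⟨hT, hT'⟩ := Finset.mem_filter.1 hT
        rw [Finset.mem_union, Finset.mem_insert, Finset.mem_filter, Finset.mem_sdiff]
        rcases hT' with hT' | hT'
        · exact Or.inl ⟨hT, hT'⟩
        · by_cases hTT : T = T₁
          · exact Or.inr (Or.inl hTT)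
          · rw [hother T hT hTT] at hT'
            exact Or.inr (Or.inr ⟨hT, hT'⟩)
      have hfil : (𝒯.filter fun T => hanging V₀ T ≠ ∅).card ≤
          ∑ T ∈ 𝒯, (hanging V₀ T).card := by
        rw [Finset.card_filter]
        refine Finset.sum_le_sum fun T _ => ?_
        split_ifs with hcase
        · exact Finset.card_pos.2 (Finset.nonempty_iff_ne_empty.2 hcase)
        · exact Nat.zero_le _
      have hc : B.card ≤ (𝒯 \ 𝒢).card + (∑ T ∈ 𝒯, (hanging V₀ T).card + 1) :=
        (Finset.card_le_card hBsub).trans ((Finset.card_union_le _ _).trans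
          (Nat.add_le_add_left ((Finset.card_insert_le _ _).trans
            (Nat.add_le_add_right hfil 1)) _))
      have hone : 1 ≤ 1 / h := by rw [le_div_iff₀ hh]; linarith
      calc (B.card : ℝ) ≤ (𝒯 \ 𝒢).card + ((∑ T ∈ 𝒯, (hanging V₀ T).card : ℕ) + 1) := by
            exact_mod_cast hc
        _ ≤ C / h + (C / h + 1 / h) := by gcongr
        _ = (2 * C + 1) / h := by ring
    have hpieces : ∀ T ∈ B, ∑ S ∈ 𝒮 T, triArea S ≤ (3 * D) ^ 2 * ω * h ^ 2 := by
      intro T hT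
      have hT := (Finset.mem_filter.1 hT).1
      calc ∑ S ∈ 𝒮 T, triArea S ≤ triArea T :=
            sum_triArea_le (𝒮 T) id (s1 T hT).nonoverlapping (fun S hS => (s1 T hT).subset hS)
              (volume_triSet_ne_top T)
        _ ≤ triDiam T ^ 2 * ω := triArea_le_triDiam T
        _ ≤ (3 * D * h) ^ 2 * ω := by
            gcongr
            · exact triDiam_nonneg T
            · exact hdiam T hT
        _ = _ := by ring
    calc ∑ S ∈ 𝒯.biUnion 𝒮 \ 𝒢', triArea S ≤ ∑ S ∈ B.biUnion 𝒮, triArea S :=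
          Finset.sum_le_sum_of_subset_of_nonneg hsub fun S _ _ => (triArea_pos S).le
      _ = ∑ T ∈ B, ∑ S ∈ 𝒮 T, triArea S := by
          refine Finset.sum_biUnion ?_
          exact (k1.pairwiseDisjoint s1).subset (by
            intro T hT
            exact (Finset.mem_filter.1 hT).1)
      _ ≤ ∑ _T ∈ B, (3 * D) ^ 2 * ω * h ^ 2 := Finset.sum_le_sum hpieces
      _ = B.card * ((3 * D) ^ 2 * ω * h ^ 2) := by rw [Finset.sum_const, nsmul_eq_mul]
      _ ≤ (2 * C + 1) / h * ((3 * D) ^ 2 * ω * h ^ 2) := by gcongr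
      _ = (2 * C + 1) * ((3 * D) ^ 2 * ω) * h := by field_simp
      _ ≤ _ := by
          gcongr
          linarith

/-! ### Polynomial functions on the plane -/

/-- `g` is a polynomial function of total degree at most `d`. -/
def IsPolyFun (d : ℕ) (g : Plane → ℝ) : Prop :=
  ∃ P : MvPolynomial (Fin 2) ℝ, P.totalDegree ≤ d ∧ ∀ u, polyVal P u = g u

theorem isPolyFun_const (c : ℝ) : IsPolyFun 0 fun _ => c :=
  ⟨MvPolynomial.C c, by simp, fun u => by simp [polyVal]⟩

theorem isPolyFun_coord (i : Fin 2) : IsPolyFun 1 fun u => u i :=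
  ⟨MvPolynomial.X i, by simp, fun u => by simp [polyVal]⟩

theorem IsPolyFun.mono {d e : ℕ} {g : Plane → ℝ} (h : IsPolyFun d g) (hde : d ≤ e) : IsPolyFun e g := by
  obtain ⟨P, h1, h2⟩ := h
  exact ⟨P, h1.trans hde, h2⟩

theorem IsPolyFun.add {d : ℕ} {f g : Plane → ℝ} (hf : IsPolyFun d f) (hg : IsPolyFun d g) :
    IsPolyFun d fun u => f u + g u := by
  obtain ⟨P, h1, h2⟩ := hf
  obtain ⟨Q, k1, k2⟩ := hg
  refine ⟨P + Q, (MvPolynomial.totalDegree_add _ _).trans (max_le h1 k1), fun u => ?_⟩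
  simp only [← h2, ← k2]
  simp [polyVal]

theorem IsPolyFun.mul {d e : ℕ} {f g : Plane → ℝ} (hf : IsPolyFun d f) (hg : IsPolyFun e g) :
    IsPolyFun (d + e) fun u => f u * g u := by
  obtain ⟨P, h1, h2⟩ := hf
  obtain ⟨Q, k1, k2⟩ := hg
  refine ⟨P * Q, (MvPolynomial.totalDegree_mul _ _).trans (add_le_add h1 k1), fun u => ?_⟩
  simp only [← h2, ← k2]
  simp [polyVal]

theorem IsPolyFun.const_mul {d : ℕ} {f : Plane → ℝ} (c : ℝ) (hf : IsPolyFun d f) :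
    IsPolyFun d fun u => c * f u := by
  simpa using (isPolyFun_const c).mul hf

theorem IsPolyFun.neg {d : ℕ} {f : Plane → ℝ} (hf : IsPolyFun d f) : IsPolyFun d fun u => - f u := by
  simpa using hf.const_mul (-1)

theorem IsPolyFun.sum {d : ℕ} {ι : Type*} (s : Finset ι) {f : ι → Plane → ℝ}
    (hf : ∀ i ∈ s, IsPolyFun d (f i)) : IsPolyFun d fun u => ∑ i ∈ s, f i u := by
  classical
  induction s using Finset.induction_on with
  | empty => simpa using (isPolyFun_const 0).mono (Nat.zero_le d)
  | insert i s his ih =>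
    simp_rw [Finset.sum_insert his]
    exact (hf i (Finset.mem_insert_self i s)).add
      (ih fun j hj => hf j (Finset.mem_insert_of_mem hj))

theorem IsPolyFun.prod {ι : Type*} (s : Finset ι) {d : ι → ℕ} {f : ι → Plane → ℝ}
    (hf : ∀ i ∈ s, IsPolyFun (d i) (f i)) : IsPolyFun (∑ i ∈ s, d i) fun u => ∏ i ∈ s, f i u := by
  classical
  induction s using Finset.induction_on with
  | empty => simpa using isPolyFun_const 1
  | insert i s his ih =>
    simp_rw [Finset.prod_insert his, Finset.sum_insert his]
    exact (hf i (Finset.mem_insert_self i s)).mul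
      (ih fun j hj => hf j (Finset.mem_insert_of_mem hj))

theorem plane_eq_sum (u : Plane) : u = ∑ j, u j • EuclideanSpace.single j (1 : ℝ) := by
  ext k
  fin_cases k <;> simp

theorem isPolyFun_affineMap (g : Plane →ᵃ[ℝ] ℝ) : IsPolyFun 1 g := by
  have e : (g : Plane → ℝ) =
      fun u => (∑ j, g.linear (EuclideanSpace.single j 1) * u j) + g 0 := by
    funext u
    have h := congrFun (AffineMap.decomp g) u
    simp only [Pi.add_apply] at h
    rw [h]
    congr 1
    conv_lhs => rw [plane_eq_sum u]
    rw [map_sum]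
    exact Finset.sum_congr rfl fun j _ => by rw [map_smul, smul_eq_mul, mul_comm]
  rw [e]
  exact (IsPolyFun.sum _ fun j _ => (isPolyFun_coord j).const_mul _).add
    ((isPolyFun_const _).mono zero_le_one)

theorem continuous_polyVal (P : MvPolynomial (Fin 2) ℝ) : Continuous (polyVal P) := by
  unfold polyVal
  have : Continuous fun z : Plane => (fun i => z i) := by fun_prop
  exact (MvPolynomial.continuous_eval P).comp this

/-! ### Lagrange interpolation -/

/-- The multi-indices of the Lagrange nodes of degree `n`. -/
def nodeIndex (n : ℕ) : Finset (Fin 3 → ℕ) := Finset.piAntidiag Finset.univ n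

theorem mem_nodeIndex {n : ℕ} {a : Fin 3 → ℕ} : a ∈ nodeIndex n ↔ ∑ i, a i = n := by
  simp [nodeIndex, Finset.mem_piAntidiag]

/-- The Lagrange basis function of the multi-index `a` in terms of barycentric coordinates. -/
noncomputable def lagWeight (m : ℕ) (a : Fin 3 → ℕ) (μ : Fin 3 → ℝ) : ℝ :=
  ∏ i, ∏ k ∈ Finset.range (a i), ((((m : ℝ) - 1) * μ i - k) / ((a i : ℝ) - k))

theorem bary_lagrangeNode {m : ℕ} (hm : 2 ≤ m) (T : Tri) {a : Fin 3 → ℕ}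
    (ha : ∑ i, a i = m - 1) (k : Fin 3) :
    bary T k (lagrangeNode m T a) = (a k : ℝ) / ((m : ℝ) - 1) := by
  have hm' : ((m : ℝ) - 1) ≠ 0 := by
    have : (2 : ℝ) ≤ m := by exact_mod_cast hm
    linarith
  refine bary_sum_smul T (fun i => (a i : ℝ) / ((m : ℝ) - 1)) ?_ k
  rw [← Finset.sum_div, div_eq_one_iff_eq hm', ← Nat.cast_sum, ha]
  push_cast [show 1 ≤ m by omega]
  ring

theorem lagrangeNode_mem {m : ℕ} (hm : 2 ≤ m) (T : Tri) {a : Fin 3 → ℕ}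
    (ha : ∑ i, a i = m - 1) : lagrangeNode m T a ∈ triSet T := by
  have : (2 : ℝ) ≤ m := by exact_mod_cast hm
  rw [mem_triSet]
  intro k
  rw [bary_lagrangeNode hm T ha]
  exact div_nonneg (Nat.cast_nonneg _) (by linarith)

/-- Distinct multi-indices with the same sum satisfy `b i < a i` for some `i`, and then the factor
with `k = b i` vanishes. -/
theorem lagWeight_node {m : ℕ} (hm : 2 ≤ m) (T : Tri) {a b : Fin 3 → ℕ}
    (ha : ∑ i, a i = m - 1) (hb : ∑ i, b i = m - 1) :
    lagWeight m a (fun i => bary T i (lagrangeNode m T b)) = if a = b then 1 else 0 := by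
  have hm' : ((m : ℝ) - 1) ≠ 0 := by
    have : (2 : ℝ) ≤ m := by exact_mod_cast hm
    linarith
  unfold lagWeight
  simp_rw [bary_lagrangeNode hm T hb, mul_div_cancel₀ _ hm']
  split_ifs with hab
  · subst hab
    refine Finset.prod_eq_one fun i _ => Finset.prod_eq_one fun k hk => div_self ?_
    have : (k : ℝ) < a i := by exact_mod_cast Finset.mem_range.1 hk
    linarith
  · obtain ⟨i, hi⟩ : ∃ i, b i < a i := by
      by_contra! hcon
      refine hab (funext fun i => ?_)
      exact (Finset.sum_eq_sum_iff_of_le fun i _ => hcon i).1 (ha.trans hb.symm) i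
        (Finset.mem_univ i)
    refine Finset.prod_eq_zero (Finset.mem_univ i) ?_
    exact Finset.prod_eq_zero (Finset.mem_range.2 hi) (by simp)

theorem isPolyFun_lagWeight (m : ℕ) (T : Tri) (a : Fin 3 → ℕ) :
    IsPolyFun (∑ i, a i) fun z => lagWeight m a fun i => bary T i z := by
  refine IsPolyFun.prod _ fun i _ => ?_
  have : IsPolyFun (∑ _k ∈ Finset.range (a i), 1) fun z => ∏ k ∈ Finset.range (a i),
      ((((m : ℝ) - 1) * bary T i z - k) / ((a i : ℝ) - k)) := by
    refine IsPolyFun.prod _ fun k _ => ?_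
    have h : IsPolyFun 1 fun z => ((a i : ℝ) - k)⁻¹ * (((m : ℝ) - 1) * bary T i z + -(k : ℝ)) :=
      (((isPolyFun_affineMap (bary T i)).const_mul _).add
        ((isPolyFun_const _).mono zero_le_one)).const_mul _
    convert h using 2
    rw [div_eq_inv_mul, sub_eq_add_neg (_ * _)]
  simpa using this

/-- Numerators are at most `m - 1` and denominators at least 1. The bound does not involve the shape
of the triangle, which is why thin triangles do no harm. -/
theorem abs_lagWeight_le {m : ℕ} (hm : 2 ≤ m) {a : Fin 3 → ℕ} (ha : ∑ i, a i = m - 1)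
    {μ : Fin 3 → ℝ} (h0 : ∀ i, 0 ≤ μ i) (h1 : ∀ i, μ i ≤ 1) :
    |lagWeight m a μ| ≤ ((m : ℝ) - 1) ^ (m - 1) := by
  have hm' : (2 : ℝ) ≤ m := by exact_mod_cast hm
  unfold lagWeight
  rw [Finset.abs_prod, ← ha, ← Finset.prod_pow_eq_pow_sum]
  refine Finset.prod_le_prod (fun i _ => abs_nonneg _) fun i _ => ?_
  rw [Finset.abs_prod]
  refine (Finset.prod_le_prod (fun k _ => abs_nonneg _) fun k hk => ?_).trans_eq
    (by rw [Finset.prod_const, Finset.card_range])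
  have hk' : (k : ℝ) + 1 ≤ a i := by exact_mod_cast Finset.mem_range.1 hk
  have hai : (a i : ℝ) ≤ (m : ℝ) - 1 := by
    have : a i ≤ m - 1 := ha ▸ Finset.single_le_sum (fun _ _ => Nat.zero_le _) (Finset.mem_univ i)
    have : a i + 1 ≤ m := by omega
    have : (a i : ℝ) + 1 ≤ m := by exact_mod_cast this
    linarith
  have hk0 : (0 : ℝ) ≤ k := Nat.cast_nonneg k
  have n0 : 0 ≤ ((m : ℝ) - 1) * μ i := mul_nonneg (by linarith) (h0 i)
  have n1 : ((m : ℝ) - 1) * μ i ≤ (m : ℝ) - 1 := by nlinarith [h1 i]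
  rw [abs_div, abs_of_pos (show (0 : ℝ) < (a i : ℝ) - k by linarith), div_le_iff₀ (by linarith)]
  have hnum : |((m : ℝ) - 1) * μ i - k| ≤ (m : ℝ) - 1 := abs_le.2 ⟨by linarith, by linarith⟩
  nlinarith

theorem exists_lagrange {m : ℕ} (hm : 2 ≤ m) (T : Tri) (v : Plane → ℝ) :
    ∃ P, IsLagrangeInterpolant m T v P ∧ ∀ z, polyVal P z =
      ∑ a ∈ nodeIndex (m - 1), v (lagrangeNode m T a) * lagWeight m a fun i => bary T i z := by
  have h : IsPolyFun (m - 1) fun z =>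
      ∑ a ∈ nodeIndex (m - 1), v (lagrangeNode m T a) * lagWeight m a fun i => bary T i z := by
    refine IsPolyFun.sum _ fun a ha => IsPolyFun.const_mul _ ?_
    rw [← mem_nodeIndex.1 ha]
    exact isPolyFun_lagWeight m T a
  obtain ⟨P, h1, h2⟩ := h
  refine ⟨P, ⟨h1, fun b hb => ?_⟩, h2⟩
  rw [h2]
  beta_reduce
  rw [Finset.sum_eq_single b]
  · rw [lagWeight_node hm T hb hb]; simp
  · intro a ha hab
    rw [lagWeight_node hm T (mem_nodeIndex.1 ha) hb]; simp [hab]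
  · intro hb'
    exact absurd (mem_nodeIndex.2 hb) hb'

theorem card_degree_le (n : ℕ) :
    Nat.card {s : Fin 2 →₀ ℕ | (s.sum fun _ e => e) ≤ n} ≤ (nodeIndex n).card := by
  have hs : ∀ s : Fin 2 →₀ ℕ, (s.sum fun _ e => e) = s 0 + s 1 := by
    intro s
    rw [Finsupp.sum_fintype _ _ (fun _ => rfl), Fin.sum_univ_two]
  rw [← Nat.card_eq_finsetCard]
  refine Nat.card_le_card_of_injective
    (fun s => (⟨![s.1 0, s.1 1, n - s.1 0 - s.1 1], ?_⟩ : nodeIndex n)) ?_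
  · rw [mem_nodeIndex, Fin.sum_univ_three]
    have := s.2
    rw [Set.mem_ofPred_eq, hs] at this
    simp
    omega
  · intro s t hst
    have h := congrArg Subtype.val hst
    have h0 := congrFun h 0
    have h1 := congrFun h 1
    simp at h0 h1
    refine Subtype.ext (Finsupp.ext fun i => ?_)
    fin_cases i
    · exact h0
    · exact h1

/-- Evaluation at the nodes is onto by the Lagrange basis, and the polynomials of degree at most `m
- 1` have dimension at most the number of nodes. Hence evaluation is also injective. -/
theorem eq_zero_of_nodes {m : ℕ} (hm : 2 ≤ m) (T : Tri) {P : MvPolynomial (Fin 2) ℝ}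
    (hP : P.totalDegree ≤ m - 1)
    (h : ∀ a : Fin 3 → ℕ, ∑ i, a i = m - 1 → polyVal P (lagrangeNode m T a) = 0) : P = 0 := by
  let ev : MvPolynomial.restrictTotalDegree (Fin 2) ℝ (m - 1) →ₗ[ℝ] (nodeIndex (m - 1) → ℝ) :=
    { toFun := fun P a => polyVal P (lagrangeNode m T a)
      map_add' := fun P Q => by funext a; simp [polyVal]
      map_smul' := fun c P => by funext a; simp [polyVal, MvPolynomial.smul_eval] }
  have hsurj : Function.Surjective ev := by
    intro w
    classical
    have hinj : ∀ a ∈ nodeIndex (m - 1), ∀ b ∈ nodeIndex (m - 1),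
        lagrangeNode m T a = lagrangeNode m T b → a = b := by
      intro a ha b hb hab
      have h1 := lagWeight_node hm T (mem_nodeIndex.1 ha) (mem_nodeIndex.1 hb)
      have h2 := lagWeight_node hm T (mem_nodeIndex.1 ha) (mem_nodeIndex.1 ha)
      rw [hab, h1] at h2
      by_contra hne
      simp [hne] at h2
    obtain ⟨P, ⟨h1, h2⟩, -⟩ := exists_lagrange hm T
      (fun z => ∑ a : nodeIndex (m - 1), if lagrangeNode m T a = z then w a else 0)
    refine ⟨⟨P, (MvPolynomial.mem_restrictTotalDegree _ _ _).2 h1⟩, ?_⟩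
    funext b
    change polyVal P (lagrangeNode m T b) = w b
    rw [h2 b (mem_nodeIndex.1 b.2)]
    change (∑ a : nodeIndex (m - 1), if lagrangeNode m T a = lagrangeNode m T b then w a else 0) = w b
    rw [Finset.sum_eq_single b]
    · simp
    · intro a _ hab
      rw [if_neg]
      exact fun h => hab (Subtype.ext (hinj a a.2 b b.2 h))
    · intro hb
      exact absurd (Finset.mem_univ b) hb
  have hrank : Module.finrank ℝ (MvPolynomial.restrictTotalDegree (Fin 2) ℝ (m - 1)) ≤
      Module.finrank ℝ (nodeIndex (m - 1) → ℝ) := by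
    rw [Module.finrank_fintype_fun_eq_card, Fintype.card_coe]
    refine le_trans (le_of_eq ?_) (card_degree_le (m - 1))
    exact Module.finrank_eq_nat_card_basis (MvPolynomial.basisRestrictSupport ℝ _)
  have hinj : Function.Injective ev := by
    have h1 := LinearMap.finrank_range_add_finrank_ker ev
    rw [LinearMap.range_eq_top.2 hsurj, finrank_top] at h1
    have h2 : Module.finrank ℝ (LinearMap.ker ev) = 0 := by omega
    exact LinearMap.ker_eq_bot.1 (Submodule.finrank_eq_zero.1 h2)
  have h0 : ev ⟨P, (MvPolynomial.mem_restrictTotalDegree _ _ _).2 hP⟩ = ev 0 := by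
    rw [map_zero]
    funext a
    exact h a (mem_nodeIndex.1 a.2)
  exact congrArg Subtype.val (hinj h0)

theorem lagrangeInterp_eq {m : ℕ} (hm : 2 ≤ m) {T : Tri} {v : Plane → ℝ}
    {P : MvPolynomial (Fin 2) ℝ} (hP : IsLagrangeInterpolant m T v P) :
    lagrangeInterp m T v = P := by
  have hex : ∃ P, IsLagrangeInterpolant m T v P := ⟨P, hP⟩
  rw [lagrangeInterp, dif_pos hex]
  have hc := hex.choose_spec
  rw [← sub_eq_zero]
  refine eq_zero_of_nodes hm T ((MvPolynomial.totalDegree_sub _ _).trans (max_le hc.1 hP.1)) ?_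
  intro a ha
  have h1 := hc.2 a ha
  have h2 := hP.2 a ha
  simp only [polyVal, map_sub] at h1 h2 ⊢
  rw [h1, h2, sub_self]

theorem polyVal_lagrangeInterp {m : ℕ} (hm : 2 ≤ m) (T : Tri) (v : Plane → ℝ) (z : Plane) :
    polyVal (lagrangeInterp m T v) z =
      ∑ a ∈ nodeIndex (m - 1), v (lagrangeNode m T a) * lagWeight m a fun i => bary T i z := by
  obtain ⟨P, h1, h2⟩ := exists_lagrange hm T v
  rw [lagrangeInterp_eq hm h1, h2]

theorem polyVal_lagrangeInterp_poly {m : ℕ} (hm : 2 ≤ m) (T : Tri) {v : Plane → ℝ}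
    (hv : IsPolyFun (m - 1) v) (z : Plane) : polyVal (lagrangeInterp m T v) z = v z := by
  obtain ⟨P, h1, h2⟩ := hv
  rw [lagrangeInterp_eq hm ⟨h1, fun a _ => h2 _⟩, h2]

/-- A bound for the norm of Lagrange interpolation with respect to the sup norm. -/
noncomputable def lebesgueConst (m : ℕ) : ℝ :=
  (nodeIndex (m - 1)).card * ((m : ℝ) - 1) ^ (m - 1)

theorem lebesgueConst_nonneg {m : ℕ} (hm : 2 ≤ m) : 0 ≤ lebesgueConst m := by
  have hm' : (2 : ℝ) ≤ m := by exact_mod_cast hm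
  exact mul_nonneg (Nat.cast_nonneg _) (pow_nonneg (by linarith) _)

theorem abs_lagrangeInterp_le {m : ℕ} (hm : 2 ≤ m) (T : Tri) {v : Plane → ℝ} {η : ℝ}
    (hv : ∀ z ∈ triSet T, |v z| ≤ η) {z : Plane} (hz : z ∈ triSet T) :
    |polyVal (lagrangeInterp m T v) z| ≤ lebesgueConst m * η := by
  rw [polyVal_lagrangeInterp hm]
  refine (Finset.abs_sum_le_sum_abs _ _).trans ?_
  have hη : 0 ≤ η := (abs_nonneg _).trans (hv z hz)
  have h0 := mem_triSet.1 hz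
  have h1 : ∀ i, bary T i z ≤ 1 := by
    intro i
    have := bary_sum T z
    have a0 := h0 0
    have a1 := h0 1
    have a2 := h0 2
    fin_cases i <;> simp <;> linarith
  calc ∑ a ∈ nodeIndex (m - 1), |v (lagrangeNode m T a) * lagWeight m a fun i => bary T i z|
      ≤ ∑ _a ∈ nodeIndex (m - 1), η * ((m : ℝ) - 1) ^ (m - 1) := by
        refine Finset.sum_le_sum fun a ha => ?_
        rw [abs_mul]
        have ha' := mem_nodeIndex.1 ha
        exact mul_le_mul (hv _ (lagrangeNode_mem hm T ha')) (abs_lagWeight_le hm ha' h0 h1)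
          (abs_nonneg _) hη
    _ = lebesgueConst m * η := by
        rw [Finset.sum_const, nsmul_eq_mul, lebesgueConst]; ring

theorem lagrangeNode_homothet {m : ℕ} (hm : 2 ≤ m) (T : Tri) (s : ℝ) (hs : s ≠ 0) (c : Plane)
    {a : Fin 3 → ℕ} (ha : ∑ i, a i = m - 1) :
    lagrangeNode m (T.homothet s hs c) a = s • lagrangeNode m T a + c := by
  refine bary_ext (T := T.homothet s hs c) fun i => ?_
  rw [bary_homothet, bary_lagrangeNode hm _ ha, bary_lagrangeNode hm _ ha]

theorem polyVal_lagrangeInterp_homothet {m : ℕ} (hm : 2 ≤ m) (T : Tri) (s : ℝ) (hs : s ≠ 0)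
    (c : Plane) (v : Plane → ℝ) (x : Plane) :
    polyVal (lagrangeInterp m (T.homothet s hs c) v) (s • x + c) =
      polyVal (lagrangeInterp m T fun y => v (s • y + c)) x := by
  rw [polyVal_lagrangeInterp hm, polyVal_lagrangeInterp hm]
  refine Finset.sum_congr rfl fun a ha => ?_
  rw [lagrangeNode_homothet hm T s hs c (mem_nodeIndex.1 ha)]
  simp_rw [bary_homothet]

/-! ### Local interpolation errors -/

theorem aestronglyMeasurable_error (m : ℕ) {T : Tri} {v : Plane → ℝ}
    (hv : ContinuousOn v (triSet T)) :
    AEStronglyMeasurable (fun z => v z - polyVal (lagrangeInterp m T v) z)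
      (volume.restrict (triSet T)) :=
  (hv.sub (continuous_polyVal _).continuousOn).aestronglyMeasurable (measurableSet_triSet T)

theorem localError_add_le {m : ℕ} (hm : 2 ≤ m) {p : ℝ≥0∞} (hp : 1 ≤ p) {T : Tri}
    {v w : Plane → ℝ} (hv : ContinuousOn v (triSet T)) (hw : ContinuousOn w (triSet T)) :
    localError m p T (fun z => v z + w z) ≤ localError m p T v + localError m p T w := by
  refine le_trans (le_of_eq ?_) (eLpNorm_add_le (aestronglyMeasurable_error m hv)
    (aestronglyMeasurable_error m hw) hp)
  unfold localError
  congr 1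
  funext z
  simp only [Pi.add_apply, polyVal_lagrangeInterp hm, add_mul, Finset.sum_add_distrib]
  ring

theorem localError_add_poly {m : ℕ} (hm : 2 ≤ m) (p : ℝ≥0∞) (T : Tri) (v : Plane → ℝ)
    {Q : Plane → ℝ} (hQ : IsPolyFun (m - 1) Q) :
    localError m p T (fun z => v z + Q z) = localError m p T v := by
  unfold localError
  congr 1
  funext z
  have h := polyVal_lagrangeInterp_poly hm T hQ z
  rw [polyVal_lagrangeInterp hm] at h ⊢
  rw [polyVal_lagrangeInterp hm]
  simp only [add_mul, Finset.sum_add_distrib]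
  rw [h]
  ring

theorem localError_const_mul {m : ℕ} (hm : 2 ≤ m) (p : ℝ≥0∞) (T : Tri) (v : Plane → ℝ) (c : ℝ) :
    localError m p T (fun z => c * v z) = ENNReal.ofReal |c| * localError m p T v := by
  unfold localError
  rw [← Real.norm_eq_abs, ofReal_norm, ← eLpNorm_const_smul]
  congr 1
  funext z
  simp only [polyVal_lagrangeInterp hm, Pi.smul_apply, smul_eq_mul, mul_sub, Finset.mul_sum,
    mul_assoc]

/-- For `p = ∞` the convention `p.toReal⁻¹ = 0` turns the area factor into 1, so one formula covers
all `p`. -/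
theorem localError_le_of_abs_le {m : ℕ} (hm : 2 ≤ m) (p : ℝ≥0∞) {T : Tri} {v : Plane → ℝ} {η : ℝ}
    (hv : ∀ z ∈ triSet T, |v z| ≤ η) :
    localError m p T v ≤
      volume (triSet T) ^ p.toReal⁻¹ * ENNReal.ofReal ((1 + lebesgueConst m) * η) := by
  have h : ∀ᵐ z ∂(volume.restrict (triSet T)),
      ‖v z - polyVal (lagrangeInterp m T v) z‖ ≤ (1 + lebesgueConst m) * η := by
    filter_upwards [ae_restrict_mem (measurableSet_triSet T)] with z hz
    rw [Real.norm_eq_abs]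
    calc _ ≤ |v z| + |polyVal (lagrangeInterp m T v) z| := abs_sub _ _
      _ ≤ η + lebesgueConst m * η := add_le_add (hv z hz) (abs_lagrangeInterp_le hm T hv hz)
      _ = _ := by ring
  have := eLpNorm_le_of_ae_bound (p := p) h
  rwa [Measure.restrict_apply_univ] at this

/-- The perturbation principle behind all later estimates: `Q` is reproduced exactly, and only the
sup norm of the remainder enters. -/
theorem localError_le_of_decomp {m : ℕ} (hm : 2 ≤ m) {p : ℝ≥0∞} (hp : 1 ≤ p) {T : Tri}
    {v w Q : Plane → ℝ} (hv : ContinuousOn v (triSet T)) (hw : ContinuousOn w (triSet T))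
    (hQ : IsPolyFun (m - 1) Q) {η : ℝ} (h : ∀ z ∈ triSet T, |v z - w z - Q z| ≤ η) :
    localError m p T v ≤ localError m p T w +
      volume (triSet T) ^ p.toReal⁻¹ * ENNReal.ofReal ((1 + lebesgueConst m) * η) := by
  have hQc : ContinuousOn Q (triSet T) := by
    obtain ⟨P, -, hP⟩ := hQ
    have : Q = polyVal P := funext fun z => (hP z).symm
    rw [this]
    exact (continuous_polyVal P).continuousOn
  have e : (fun z => (w z + Q z) + (v z - w z - Q z)) = v := by
    funext z; ring
  calc localError m p T v = localError m p T (fun z => (w z + Q z) + (v z - w z - Q z)) := by rw [e]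
    _ ≤ localError m p T (fun z => w z + Q z) + localError m p T (fun z => v z - w z - Q z) :=
        localError_add_le hm hp (hw.add hQc) ((hv.sub hw).sub hQc)
    _ ≤ _ := by
        rw [localError_add_poly hm p T w hQ]
        gcongr
        exact localError_le_of_abs_le hm p h

theorem volume_image_homothety (s : ℝ) (c : Plane) (A : Set Plane) :
    volume ((fun x : Plane => s • x + c) '' A) = ENNReal.ofReal (s ^ 2) * volume A := by
  have e : (fun x : Plane => s • x + c) '' A = (fun x => x + c) '' ((fun x => s • x) '' A) := by
    rw [Set.image_image]
  rw [e, Set.image_add_right, measure_preimage_add_right, Set.image_smul, Measure.addHaar_smul]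
  simp

theorem restrict_homothet (T : Tri) (s : ℝ) (hs : s ≠ 0) (c : Plane) :
    volume.restrict (triSet (T.homothet s hs c)) =
      ENNReal.ofReal (s ^ 2) • Measure.map (fun x : Plane => s • x + c)
        (volume.restrict (triSet T)) := by
  have hmeas : Measurable (fun x : Plane => s • x + c) := by fun_prop
  ext A hA
  rw [Measure.restrict_apply hA, Measure.smul_apply, Measure.map_apply hmeas hA,
    Measure.restrict_apply (hmeas hA), smul_eq_mul, ← volume_image_homothety, triSet_homothet,
    Set.image_preimage_inter]

theorem localError_homothet {m : ℕ} (hm : 2 ≤ m) (p : ℝ≥0∞) (T : Tri) (s : ℝ) (hs : s ≠ 0)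
    (c : Plane) (v : Plane → ℝ) :
    localError m p (T.homothet s hs c) v =
      ENNReal.ofReal (s ^ 2) ^ p.toReal⁻¹ * localError m p T fun x => v (s • x + c) := by
  have hemb : MeasurableEmbedding (fun x : Plane => s • x + c) :=
    ((Homeomorph.smulOfNeZero s hs).trans (Homeomorph.addRight c)).measurableEmbedding
  have hs2 : ENNReal.ofReal (s ^ 2) ≠ 0 := by
    rw [Ne, ENNReal.ofReal_eq_zero, not_le]
    positivity
  unfold localError
  rw [restrict_homothet, eLpNorm_smul_measure_of_ne_zero hs2, hemb.eLpNorm_map_measure]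
  simp only [one_div, ENNReal.toReal_inv, smul_eq_mul]
  congr 2
  funext x
  rw [Function.comp_apply, polyVal_lagrangeInterp_homothet hm]

/-! ### Homogeneous polynomials -/

/-- The homogeneous polynomial `u ↦ A[u, …, u] / m!`. -/
noncomputable def homPoly {m : ℕ} (A : ContinuousMultilinearMap ℝ (fun _ : Fin m => Plane) ℝ)
    (u : Plane) : ℝ := A (fun _ => u) / (m ! : ℝ)

theorem isPolyFun_multilinear {k : ℕ} (A : ContinuousMultilinearMap ℝ (fun _ : Fin k => Plane) ℝ)
    (w : Fin k → Plane → Plane) (d : Fin k → ℕ)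
    (hw : ∀ i j, IsPolyFun (d i) fun u => w i u j) :
    IsPolyFun (∑ i, d i) fun u => A fun i => w i u := by
  have e : (fun u => A fun i => w i u) = fun u => ∑ r : Fin k → Fin 2,
      A (fun i => EuclideanSpace.single (r i) (1 : ℝ)) * ∏ i, w i u (r i) := by
    funext u
    have h1 : (fun i => w i u) = fun i => ∑ j, w i u j • EuclideanSpace.single j (1 : ℝ) :=
      funext fun i => plane_eq_sum (w i u)
    rw [h1, ← ContinuousMultilinearMap.coe_coe, MultilinearMap.map_sum]
    refine Finset.sum_congr rfl fun r _ => ?_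
    rw [MultilinearMap.map_smul_univ, smul_eq_mul, mul_comm]
  rw [e]
  exact IsPolyFun.sum _ fun r _ => (IsPolyFun.prod _ fun i _ => hw i (r i)).const_mul _

/-- Expand by multilinearity over the set `S` of slots that receive `s • x`. The full set gives the
leading term, and every other `S` gives degree at most `m - 1`. -/
theorem homPoly_homothety {m : ℕ} (hm : 2 ≤ m)
    (A : ContinuousMultilinearMap ℝ (fun _ : Fin m => Plane) ℝ) (s : ℝ) (c : Plane) :
    ∃ Q, IsPolyFun (m - 1) Q ∧ ∀ x, homPoly A (s • x + c) = s ^ m * homPoly A x + Q x := by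
  classical
  refine ⟨fun x => (m ! : ℝ)⁻¹ * ∑ S ∈ (Finset.univ : Finset (Finset (Fin m))).erase Finset.univ,
    A fun i => if i ∈ S then s • x else c, ?_, fun x => ?_⟩
  · refine IsPolyFun.const_mul _ (IsPolyFun.sum _ fun S hS => ?_)
    have h := isPolyFun_multilinear A (fun i x => if i ∈ S then s • x else c)
      (fun i => if i ∈ S then 1 else 0) (by
        intro i j
        by_cases hi : i ∈ S
        · simpa [hi] using (isPolyFun_coord j).const_mul s
        · simpa [hi] using isPolyFun_const (c j))
    refine h.mono ?_
    rw [Finset.sum_ite_mem, Finset.univ_inter, Finset.sum_const, smul_eq_mul, mul_one]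
    have : S.card < m := by
      have := Finset.card_lt_card (Finset.ssubset_univ_iff.2 (Finset.ne_of_mem_erase hS))
      simpa using this
    omega
  · have h : A (fun _ => s • x + c) = ∑ S : Finset (Fin m), A fun i => if i ∈ S then s • x else c := by
      have := A.toMultilinearMap.map_add_univ (fun _ => s • x) (fun _ => c)
      exact this
    have h2 : A (fun _ => s • x) = s ^ m * A fun _ => x := by
      have := A.toMultilinearMap.map_smul_univ (fun _ => s) (fun _ => x)
      simpa using this
    unfold homPoly
    rw [h, ← Finset.add_sum_erase _ _ (Finset.mem_univ Finset.univ)]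
    simp only [Finset.mem_univ, if_true]
    rw [h2]
    ring

theorem continuous_homPoly {m : ℕ} (A : ContinuousMultilinearMap ℝ (fun _ : Fin m => Plane) ℝ) :
    Continuous (homPoly A) := by
  have : Continuous fun u : Plane => A fun _ => u := A.cont.comp (by fun_prop)
  exact this.div_const _

theorem localError_homPoly_homothet {m : ℕ} (hm : 2 ≤ m) (p : ℝ≥0∞) (T : Tri) (s : ℝ) (hs : s ≠ 0)
    (c : Plane) (A : ContinuousMultilinearMap ℝ (fun _ : Fin m => Plane) ℝ) :
    localError m p (T.homothet s hs c) (homPoly A) =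
      ENNReal.ofReal (s ^ 2) ^ p.toReal⁻¹ *
        (ENNReal.ofReal (|s| ^ m) * localError m p T (homPoly A)) := by
  obtain ⟨Q, hQ, h⟩ := homPoly_homothety hm A s c
  rw [localError_homothet hm]
  simp_rw [h]
  rw [localError_add_poly hm p T _ hQ, localError_const_mul hm, abs_pow]

theorem abs_homPoly_le {m : ℕ} (A : ContinuousMultilinearMap ℝ (fun _ : Fin m => Plane) ℝ)
    {u : Plane} {D ε : ℝ} (hA : ‖A‖ ≤ ε) (hu : ‖u‖ ≤ D) :
    |homPoly A u| ≤ ε * D ^ m := by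
  have hε : 0 ≤ ε := (norm_nonneg A).trans hA
  have h1 : |A fun _ => u| ≤ ε * D ^ m := by
    have := A.le_opNorm (fun _ => u)
    rw [Real.norm_eq_abs, Finset.prod_const, Finset.card_univ, Fintype.card_fin] at this
    exact this.trans (mul_le_mul hA (pow_le_pow_left₀ (norm_nonneg u) hu m) (by positivity) hε)
  have hfac : (1 : ℝ) ≤ (m ! : ℝ) := by exact_mod_cast Nat.factorial_pos m
  unfold homPoly
  rw [abs_div, abs_of_pos (show (0 : ℝ) < (m ! : ℝ) by linarith)]
  exact (div_le_self (abs_nonneg _) hfac).trans h1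

/-- Recentring `A - B` at a vertex changes it only by a polynomial of degree less than `m`, so the
diameter of `T` enters and its distance from the origin does not. -/
theorem localError_homPoly_le {m : ℕ} (hm : 2 ≤ m) {p : ℝ≥0∞} (hp : 1 ≤ p) (T : Tri)
    (A B : ContinuousMultilinearMap ℝ (fun _ : Fin m => Plane) ℝ) :
    localError m p T (homPoly A) ≤ localError m p T (homPoly B) +
      volume (triSet T) ^ p.toReal⁻¹ *
        ENNReal.ofReal ((1 + lebesgueConst m) * (‖A - B‖ * triDiam T ^ m)) := by
  set z₀ := T.points 0 with hz₀
  obtain ⟨Q, hQ, h⟩ := homPoly_homothety hm (A - B) 1 (-z₀)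
  refine localError_le_of_decomp (Q := fun z => - Q z) hm hp (continuous_homPoly A).continuousOn
    (continuous_homPoly B).continuousOn hQ.neg fun z hz => ?_
  have e : homPoly A z - homPoly B z - -Q z = homPoly (A - B) (z - z₀) := by
    have := h z
    rw [one_smul, one_pow, one_mul, ← sub_eq_add_neg] at this
    rw [this]
    simp only [homPoly, sub_apply]
    ring
  rw [e]
  refine abs_homPoly_le _ le_rfl ?_
  rw [← dist_eq_norm]
  exact dist_le_triDiam hz (points_mem T 0)

/-! ### Taylor expansion -/

theorem uniqueDiffOn_triSet (T : Tri) : UniqueDiffOn ℝ (triSet T) :=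
  uniqueDiffOn_convex (convex_triSet T) (interior_triSet_nonempty T)

theorem iteratedDerivWithin_segment {K : Set Plane} (hK : Convex ℝ K) (hKu : UniqueDiffOn ℝ K)
    {f : Plane → ℝ} {m : ℕ} (hf : ContDiffOn ℝ m f K) {z₀ z : Plane} (hz₀ : z₀ ∈ K) (hz : z ∈ K)
    {k : ℕ} (hk : k ≤ m) {t : ℝ} (ht : t ∈ Set.Icc (0 : ℝ) 1) :
    iteratedDerivWithin k (fun t : ℝ => f (z₀ + t • (z - z₀))) (Set.Icc 0 1) t =
      iteratedFDerivWithin ℝ k f K (z₀ + t • (z - z₀)) fun _ => z - z₀ := by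
  have hmaps : ∀ t ∈ Set.Icc (0 : ℝ) 1, z₀ + t • (z - z₀) ∈ K := fun t ht =>
    hK.add_smul_sub_mem hz₀ hz ht
  induction k generalizing t with
  | zero => simp
  | succ k ih =>
    rw [iteratedDerivWithin_succ,
      derivWithin_congr (fun s hs => ih (by omega) hs) (ih (by omega) ht)]
    have hd : DifferentiableOn ℝ (iteratedFDerivWithin ℝ k f K) K :=
      hf.differentiableOn_iteratedFDerivWithin (by exact_mod_cast hk) hKu
    have hx : HasDerivWithinAt (fun t : ℝ => z₀ + t • (z - z₀)) (z - z₀) (Set.Icc 0 1) t := by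
      have := ((hasDerivAt_id t).smul_const (z - z₀)).const_add z₀
      simpa using this.hasDerivWithinAt
    have h1 := (hd _ (hmaps t ht)).hasFDerivWithinAt.comp_hasDerivWithinAt t hx hmaps
    have h2 := ((ContinuousMultilinearMap.apply ℝ (fun _ : Fin k => Plane) ℝ
      (fun _ => z - z₀)).hasFDerivAt).comp_hasDerivWithinAt t h1
    have h3 := h2.derivWithin (uniqueDiffOn_Icc zero_lt_one t ht)
    rw [iteratedFDerivWithin_succ_apply_left]
    refine Eq.trans ?_ (h3.trans ?_)
    · rfl
    · rfl

/-- Lagrange's form of the remainder along the segment from `z₀` to `z`. The point `ξ` depends on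
`z`, but the Taylor polynomial `Q` does not. -/
theorem exists_taylor {K : Set Plane} (hK : Convex ℝ K) (hKu : UniqueDiffOn ℝ K)
    {f : Plane → ℝ} {m : ℕ} (hm : 2 ≤ m) (hf : ContDiffOn ℝ m f K) {z₀ : Plane} (hz₀ : z₀ ∈ K) :
    ∃ Q, IsPolyFun (m - 1) Q ∧ ∀ z ∈ K, ∃ ξ ∈ K,
      f z = Q z + homPoly (iteratedFDerivWithin ℝ m f K ξ) (z - z₀) := by
  refine ⟨fun z => ∑ k ∈ Finset.range m, ((k ! : ℝ)⁻¹ *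
    iteratedFDerivWithin ℝ k f K z₀ fun _ => z - z₀), ?_, fun z hz => ?_⟩
  · refine IsPolyFun.sum _ fun k hk => IsPolyFun.const_mul _ ?_
    refine (isPolyFun_multilinear _ (fun _ z => z - z₀) (fun _ => 1) fun _ j => ?_).mono ?_
    · simpa [sub_eq_add_neg] using
        (isPolyFun_coord j).add ((isPolyFun_const (-(z₀ j))).mono zero_le_one)
    · have := Finset.mem_range.1 hk
      simp
      omega
  · set g : ℝ → ℝ := fun t => f (z₀ + t • (z - z₀)) with hg
    have hmaps : ∀ t ∈ Set.Icc (0 : ℝ) 1, z₀ + t • (z - z₀) ∈ K := fun t ht =>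
      hK.add_smul_sub_mem hz₀ hz ht
    have hgc : ContDiffOn ℝ m g (Set.Icc 0 1) := by
      refine hf.comp ?_ hmaps
      exact (contDiff_const.add (contDiff_id.smul contDiff_const)).contDiffOn
    obtain ⟨n, rfl⟩ : ∃ n, m = n + 1 := ⟨m - 1, by omega⟩
    have hI : Set.uIcc (0 : ℝ) 1 = Set.Icc 0 1 := Set.uIcc_of_le zero_le_one
    have hI' : Set.uIoo (0 : ℝ) 1 = Set.Ioo 0 1 := Set.uIoo_of_le zero_le_one
    obtain ⟨t, ht, h⟩ := taylor_mean_remainder_lagrange (f := g) (x := 1) (x₀ := 0) (n := n)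
      zero_ne_one (by rw [hI]; exact hgc.of_le (by exact_mod_cast Nat.le_succ n)) (by
        rw [hI, hI']
        exact (hgc.differentiableOn_iteratedDerivWithin (by exact_mod_cast Nat.lt_succ_self n)
          (uniqueDiffOn_Icc zero_lt_one)).mono Set.Ioo_subset_Icc_self)
    rw [hI] at h
    rw [hI'] at ht
    have ht' := Set.Ioo_subset_Icc_self ht
    refine ⟨_, hmaps t ht', ?_⟩
    rw [taylor_within_apply, iteratedDerivWithin_segment hK hKu hf hz₀ hz le_rfl ht'] at h
    have h0 : (0 : ℝ) ∈ Set.Icc (0 : ℝ) 1 := ⟨le_rfl, zero_le_one⟩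
    have hsum : ∑ k ∈ Finset.range (n + 1), ((k ! : ℝ)⁻¹ * (1 - 0) ^ k) •
        iteratedDerivWithin k g (Set.Icc 0 1) 0 = ∑ k ∈ Finset.range (n + 1), ((k ! : ℝ)⁻¹ *
          iteratedFDerivWithin ℝ k f K z₀ fun _ => z - z₀) := by
      refine Finset.sum_congr rfl fun k hk => ?_
      rw [iteratedDerivWithin_segment hK hKu hf hz₀ hz (Finset.mem_range.1 hk).le h0]
      simp
    rw [hsum] at h
    have hg1 : g 1 = f z := by simp [hg]
    rw [hg1, sub_zero, one_pow, mul_one] at h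
    unfold homPoly
    linarith

/-- `Ω` need not be convex, so Taylor's formula is applied on `T`, where the derivatives within `T`
and within `Ω` agree. -/
theorem localError_le_of_deriv {m : ℕ} (hm : 2 ≤ m) {p : ℝ≥0∞} (hp : 1 ≤ p) {T : Tri}
    {Ω : Set Plane} (hΩ : UniqueDiffOn ℝ Ω) (hT : triSet T ⊆ Ω) {f : Plane → ℝ}
    (hf : ContDiffOn ℝ m f Ω) (A : ContinuousMultilinearMap ℝ (fun _ : Fin m => Plane) ℝ) {ε : ℝ}
    (hA : ∀ ξ ∈ triSet T, ‖iteratedFDerivWithin ℝ m f Ω ξ - A‖ ≤ ε) :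
    localError m p T f ≤ localError m p T (homPoly A) +
      volume (triSet T) ^ p.toReal⁻¹ *
        ENNReal.ofReal ((1 + lebesgueConst m) * (ε * triDiam T ^ m)) := by
  have hfT := hf.mono hT
  set z₀ := T.points 0 with hz₀
  obtain ⟨Q, hQ, h⟩ := exists_taylor (convex_triSet T) (uniqueDiffOn_triSet T) hm hfT
    (points_mem T 0)
  obtain ⟨Q', hQ', h'⟩ := homPoly_homothety hm A 1 (-z₀)
  refine localError_le_of_decomp (Q := fun z => Q z + Q' z) hm hp hfT.continuousOn
    (continuous_homPoly A).continuousOn (hQ.add hQ') fun z hz => ?_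
  obtain ⟨ξ, hξ, e⟩ := h z hz
  have e2 : f z - homPoly A z - (Q z + Q' z) =
      homPoly (iteratedFDerivWithin ℝ m f (triSet T) ξ - A) (z - z₀) := by
    have := h' z
    rw [one_smul, one_pow, one_mul, ← sub_eq_add_neg] at this
    have e3 : homPoly (iteratedFDerivWithin ℝ m f (triSet T) ξ - A) (z - z₀) =
        homPoly (iteratedFDerivWithin ℝ m f (triSet T) ξ) (z - z₀) - homPoly A (z - z₀) := by
      simp only [homPoly, sub_apply]
      ring
    rw [e3, this, e]
    ring
  rw [e2]
  refine abs_homPoly_le _ ?_ ?_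
  · rw [iteratedFDerivWithin_subset hT (uniqueDiffOn_triSet T) hΩ hf hξ]
    exact hA ξ hξ
  · rw [← dist_eq_norm]
    exact dist_le_triDiam hz (points_mem T 0)

/-! ### The shape function -/

/-- The shape function restricted to triangles of diameter at most `n`. -/
noncomputable def shapeTrunc {m : ℕ} (p : ℝ≥0∞) (n : ℕ)
    (A : ContinuousMultilinearMap ℝ (fun _ : Fin m => Plane) ℝ) : ℝ≥0∞ :=
  ⨅ (T : Tri) (_ : volume (triSet T) = 1 ∧ triDiam T ≤ n), localError m p T (homPoly A)

theorem shapeTrunc_antitone {m : ℕ} (p : ℝ≥0∞)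
    (A : ContinuousMultilinearMap ℝ (fun _ : Fin m => Plane) ℝ) :
    Antitone fun n => shapeTrunc p n A := by
  intro n k hnk
  refine le_iInf₂ fun T hT => iInf₂_le T ⟨hT.1, hT.2.trans (by exact_mod_cast hnk)⟩

theorem shapeFunction_eq_iInf {m : ℕ} (p : ℝ≥0∞) (n₀ : ℕ)
    (A : ContinuousMultilinearMap ℝ (fun _ : Fin m => Plane) ℝ) :
    shapeFunction m p (homPoly A) = ⨅ j : ℕ, shapeTrunc p (n₀ + j) A := by
  apply le_antisymm
  · exact le_iInf fun j => le_iInf₂ fun T hT => iInf₂_le T hT.1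
  · refine le_iInf₂ fun T hT => ?_
    obtain ⟨j, hj⟩ := exists_nat_ge (triDiam T)
    refine (iInf_le _ j).trans (iInf₂_le T ⟨hT, hj.trans ?_⟩)
    push_cast
    linarith [(Nat.cast_nonneg n₀ : (0 : ℝ) ≤ n₀)]

/-- The Lipschitz constant of `shapeTrunc p n`. -/
noncomputable def shapeLip (m n : ℕ) : ℝ := (1 + lebesgueConst m) * (n : ℝ) ^ m

theorem shapeLip_nonneg {m : ℕ} (hm : 2 ≤ m) (n : ℕ) : 0 ≤ shapeLip m n :=
  mul_nonneg (by linarith [lebesgueConst_nonneg hm]) (by positivity)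

/-- The purpose of the truncation: competitors of diameter at most `n` and area 1 all share one
Lipschitz constant, and the infimum inherits it. -/
theorem shapeTrunc_le_add {m : ℕ} (hm : 2 ≤ m) {p : ℝ≥0∞} (hp : 1 ≤ p) (n : ℕ)
    (A B : ContinuousMultilinearMap ℝ (fun _ : Fin m => Plane) ℝ) :
    shapeTrunc p n A ≤ shapeTrunc p n B + ENNReal.ofReal (shapeLip m n * ‖A - B‖) := by
  unfold shapeTrunc
  simp_rw [ENNReal.iInf_add]
  refine le_iInf₂ fun T hT => (iInf₂_le T hT).trans ?_
  refine (localError_homPoly_le hm hp T A B).trans ?_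
  rw [hT.1, ENNReal.one_rpow, one_mul]
  refine add_le_add le_rfl (ENNReal.ofReal_le_ofReal ?_)
  have := lebesgueConst_nonneg hm
  have h := pow_le_pow_left₀ (triDiam_nonneg T) hT.2 m
  calc (1 + lebesgueConst m) * (‖A - B‖ * triDiam T ^ m)
      = (1 + lebesgueConst m) * triDiam T ^ m * ‖A - B‖ := by ring
    _ ≤ shapeLip m n * ‖A - B‖ := by
        rw [shapeLip]
        gcongr

theorem continuous_shapeTrunc {m : ℕ} (hm : 2 ≤ m) {p : ℝ≥0∞} (hp : 1 ≤ p) (n : ℕ) :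
    Continuous fun A : ContinuousMultilinearMap ℝ (fun _ : Fin m => Plane) ℝ =>
      shapeTrunc p n A := by
  refine _root_.continuous_of_le_add_edist (ENNReal.ofReal (shapeLip m n)) ENNReal.ofReal_ne_top
    fun A B => ?_
  rw [edist_dist, dist_eq_norm, ← ENNReal.ofReal_mul (shapeLip_nonneg hm n)]
  exact shapeTrunc_le_add hm hp n A B

theorem homPoly_zero {m : ℕ} :
    homPoly (0 : ContinuousMultilinearMap ℝ (fun _ : Fin m => Plane) ℝ) = fun _ => 0 := by
  funext u
  simp [homPoly]

theorem localError_zero {m : ℕ} (hm : 2 ≤ m) (p : ℝ≥0∞) (T : Tri) :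
    localError m p T (homPoly (0 : ContinuousMultilinearMap ℝ (fun _ : Fin m => Plane) ℝ)) = 0 := by
  rw [homPoly_zero]
  simpa using localError_const_mul hm p T (fun _ => 0) 0

theorem exists_unit_triangle (T₀ : Tri) : ∃ T : Tri, volume (triSet T) = 1 := by
  have hpos := triArea_pos T₀
  have hs : (Real.sqrt (triArea T₀))⁻¹ ≠ 0 := inv_ne_zero (Real.sqrt_pos.2 hpos).ne'
  refine ⟨T₀.homothet _ hs 0, ?_⟩
  rw [← ofReal_triArea, triArea_homothet, inv_pow, Real.sq_sqrt hpos.le, inv_mul_cancel₀ hpos.ne',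
    ENNReal.ofReal_one]

theorem shapeTrunc_le_of_norm_le {m : ℕ} (hm : 2 ≤ m) {p : ℝ≥0∞} (hp : 1 ≤ p) {n : ℕ} {T : Tri}
    (hT : volume (triSet T) = 1) (hTn : triDiam T ≤ n)
    {A : ContinuousMultilinearMap ℝ (fun _ : Fin m => Plane) ℝ} {B : ℝ} (hA : ‖A‖ ≤ B) :
    shapeTrunc p n A ≤ ENNReal.ofReal (shapeLip m n * B) := by
  refine (shapeTrunc_le_add hm hp n A 0).trans ?_
  have h0 : shapeTrunc p n (0 : ContinuousMultilinearMap ℝ (fun _ : Fin m => Plane) ℝ) = 0 := by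
    refine le_antisymm ((iInf₂_le T ⟨hT, hTn⟩).trans (localError_zero hm p T).le) zero_le
  rw [h0, zero_add, sub_zero]
  exact ENNReal.ofReal_le_ofReal (mul_le_mul_of_nonneg_left hA (shapeLip_nonneg hm n))

/-- The reciprocal `m / 2 + 1 / p` of the dual exponent. -/
noncomputable def dualRate (m : ℕ) (p : ℝ≥0∞) : ℝ := (m : ℝ) / 2 + p.toReal⁻¹

theorem dualRate_pos {m : ℕ} (hm : 2 ≤ m) (p : ℝ≥0∞) : 0 < dualRate m p := by
  have hm' : (2 : ℝ) ≤ m := by exact_mod_cast hm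
  have : 0 ≤ p.toReal⁻¹ := inv_nonneg.2 ENNReal.toReal_nonneg
  unfold dualRate
  linarith

theorem dualExponent_toReal {m : ℕ} {p : ℝ≥0∞} (hp : 1 ≤ p) :
    (dualExponent m p).toReal = (dualRate m p)⁻¹ := by
  have hp0 : p ≠ 0 := (zero_lt_one.trans_le hp).ne'
  unfold dualExponent dualRate
  rw [ENNReal.toReal_inv, ENNReal.toReal_add (ENNReal.div_ne_top (ENNReal.natCast_ne_top m)
    two_ne_zero) (by simp [hp0]), ENNReal.toReal_div, one_div, ENNReal.toReal_inv]
  simp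

theorem eLpNorm_dualExponent {m : ℕ} (hm : 2 ≤ m) {p : ℝ≥0∞} (hp : 1 ≤ p) (g : Plane → ℝ≥0∞)
    (μ : Measure Plane) :
    eLpNorm g (dualExponent m p) μ = (∫⁻ z, g z ^ (dualRate m p)⁻¹ ∂μ) ^ dualRate m p := by
  have hr := dualRate_pos hm p
  have h1 := dualExponent_toReal (m := m) hp
  have h2 : 0 < (dualExponent m p).toReal := by rw [h1]; exact inv_pos.2 hr
  obtain ⟨h0, htop⟩ := ENNReal.toReal_pos_iff.1 h2
  rw [eLpNorm_eq_lintegral_rpow_enorm_toReal h0.ne' htop.ne, h1]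
  simp

/-! ### Derivatives on polygonal domains and convergence of the truncated integrals -/

theorem IsPolygonal.uniqueDiffOn {Ω : Set Plane} (hΩ : IsPolygonal Ω) : UniqueDiffOn ℝ Ω := by
  obtain ⟨S, -, rfl⟩ := hΩ
  intro x hx
  obtain ⟨T, hT, hxT⟩ := Set.mem_iUnion₂.1 hx
  exact (uniqueDiffOn_triSet T x hxT).mono (Set.subset_biUnion_of_mem (u := fun T => triSet T) hT)

theorem IsPolygonal.isCompact {Ω : Set Plane} (hΩ : IsPolygonal Ω) : IsCompact Ω := by
  obtain ⟨S, -, rfl⟩ := hΩ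
  exact S.finite_toSet.isCompact_biUnion fun T _ => isCompact_triSet T

theorem IsPolygonal.continuousOn_deriv {Ω : Set Plane} (hΩ : IsPolygonal Ω) {m : ℕ} {f : Plane → ℝ}
    (hf : ContDiffOn ℝ m f Ω) : ContinuousOn (iteratedFDerivWithin ℝ m f Ω) Ω :=
  hf.continuousOn_iteratedFDerivWithin le_rfl hΩ.uniqueDiffOn

theorem IsPolygonal.exists_deriv_bound {Ω : Set Plane} (hΩ : IsPolygonal Ω) {m : ℕ}
    {f : Plane → ℝ} (hf : ContDiffOn ℝ m f Ω) :
    ∃ B : ℝ, 0 ≤ B ∧ ∀ z ∈ Ω, ‖iteratedFDerivWithin ℝ m f Ω z‖ ≤ B := by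
  obtain ⟨B, hB⟩ := hΩ.isCompact.exists_bound_of_continuousOn (hΩ.continuousOn_deriv hf)
  exact ⟨max B 0, le_max_right _ _, fun z hz => (hB z hz).trans (le_max_left _ _)⟩

/-- The truncated shape functions approximate the shape function in the dual norm. -/
theorem exists_shapeTrunc_lintegral_lt {m : ℕ} (hm : 2 ≤ m) {p : ℝ≥0∞} (hp : 1 ≤ p)
    {Ω : Set Plane} (hΩ : IsPolygonal Ω) {f : Plane → ℝ} (hf : ContDiffOn ℝ m f Ω) :
    (∫⁻ z in Ω, shapeFunction m p (derivPoly m Ω f z) ^ (dualRate m p)⁻¹) ≠ ∞ ∧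
    ∀ J, (∫⁻ z in Ω, shapeFunction m p (derivPoly m Ω f z) ^ (dualRate m p)⁻¹) < J →
      ∃ (n : ℕ) (δ : ℝ), 0 < δ ∧ (∀ A : ContinuousMultilinearMap ℝ (fun _ : Fin m => Plane) ℝ,
        shapeTrunc p n A ≠ ∞) ∧
        (∫⁻ z in Ω, (shapeTrunc p n (iteratedFDerivWithin ℝ m f Ω z) + 2 * ENNReal.ofReal δ) ^
          (dualRate m p)⁻¹) < J := by
  have hq : 0 < (dualRate m p)⁻¹ := inv_pos.2 (dualRate_pos hm p)
  obtain ⟨T, hT⟩ : ∃ T : Tri, volume (triSet T) = 1 := by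
    obtain ⟨S, ⟨T, -⟩, -⟩ := hΩ
    exact exists_unit_triangle T
  -- From `n₀` on, the unit triangle `T` is an admissible competitor, so the truncated infima are
  -- finite; an infimum over no triangles would be `∞`.
  obtain ⟨n₀, hn₀⟩ := exists_nat_ge (triDiam T)
  obtain ⟨B, hB0, hB⟩ := hΩ.exists_deriv_bound hf
  set A := iteratedFDerivWithin ℝ m f Ω with hA
  set δ : ℕ → ℝ := fun j => 1 / ((j : ℝ) + 1) with hδ
  have hδpos : ∀ j, 0 < δ j := fun j => Nat.one_div_pos_of_nat
  have hfin : ∀ j A', shapeTrunc p (n₀ + j) A' ≠ (∞ : ℝ≥0∞) := fun j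
      (A' : ContinuousMultilinearMap ℝ (fun _ : Fin m => Plane) ℝ) =>
    ((shapeTrunc_le_of_norm_le hm hp hT (hn₀.trans (by push_cast; linarith
      [(Nat.cast_nonneg j : (0 : ℝ) ≤ j)])) le_rfl).trans_lt ENNReal.ofReal_lt_top).ne
  -- Of the two terms `δ`, one will pay for the slack in choosing triangles and the other for
  -- freezing the derivative.
  set g : ℕ → Plane → ℝ≥0∞ := fun j z =>
    (shapeTrunc p (n₀ + j) (A z) + 2 * ENNReal.ofReal (δ j)) ^ (dualRate m p)⁻¹ with hg
  have hmeas : ∀ j, AEMeasurable (g j) (volume.restrict Ω) := by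
    intro j
    have hc : ContinuousOn (g j) Ω := by
      refine ENNReal.continuous_rpow_const.comp_continuousOn ?_
      exact ((continuous_shapeTrunc hm hp _).comp_continuousOn (hΩ.continuousOn_deriv hf)).add
        continuousOn_const
    exact hc.aemeasurable hΩ.isCompact.isClosed.measurableSet
  have hanti : ∀ z, Antitone fun j => g j z := by
    intro z j k hjk
    refine ENNReal.rpow_le_rpow (add_le_add ?_ ?_) hq.le
    · exact shapeTrunc_antitone p (A z) (by omega)
    · exact mul_le_mul_right (ENNReal.ofReal_le_ofReal (Nat.one_div_le_one_div hjk)) 2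
  have htend : ∀ z, Tendsto (fun j => g j z) atTop
      (nhds (shapeFunction m p (derivPoly m Ω f z) ^ (dualRate m p)⁻¹)) := by
    intro z
    refine (ENNReal.continuous_rpow_const.tendsto _).comp ?_
    have e : shapeFunction m p (derivPoly m Ω f z) = shapeFunction m p (homPoly (A z)) := rfl
    rw [e, shapeFunction_eq_iInf p n₀]
    have h1 : Tendsto (fun j => shapeTrunc p (n₀ + j) (A z)) atTop
        (nhds (⨅ j, shapeTrunc p (n₀ + j) (A z))) :=
      tendsto_atTop_iInf fun j k hjk => shapeTrunc_antitone p (A z) (by omega)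
    have h2 : Tendsto (fun j => 2 * ENNReal.ofReal (δ j)) atTop (nhds 0) := by
      have h3 : Tendsto (fun j => ENNReal.ofReal (δ j)) atTop (nhds 0) := by
        have := (ENNReal.continuous_ofReal.tendsto 0).comp
          (tendsto_one_div_add_atTop_nhds_zero_nat (𝕜 := ℝ))
        simpa [hδ, Function.comp_def] using this
      simpa using ENNReal.Tendsto.const_mul h3 (Or.inr (ENNReal.ofNat_ne_top (n := 2)))
    simpa using h1.add h2
  have hg0 : ∫⁻ z in Ω, g 0 z ≠ ∞ := by
    set c : ℝ≥0∞ := (ENNReal.ofReal (shapeLip m (n₀ + 0) * B) + 2 * ENNReal.ofReal (δ 0)) ^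
      (dualRate m p)⁻¹ with hc
    have hctop : c ≠ ∞ := by
      refine ENNReal.rpow_ne_top_of_nonneg hq.le ?_
      exact ENNReal.add_ne_top.2 ⟨ENNReal.ofReal_ne_top,
        ENNReal.mul_ne_top ENNReal.ofNat_ne_top ENNReal.ofReal_ne_top⟩
    have hle : ∫⁻ z in Ω, g 0 z ≤ ∫⁻ _z in Ω, c := by
      refine setLIntegral_mono' hΩ.isCompact.isClosed.measurableSet fun z hz => ?_
      refine ENNReal.rpow_le_rpow (add_le_add ?_ le_rfl) hq.le
      exact shapeTrunc_le_of_norm_le hm hp hT (by simpa using hn₀) (hB z hz)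
    refine (hle.trans_lt ?_).ne
    rw [setLIntegral_const]
    exact ENNReal.mul_lt_top hctop.lt_top hΩ.isCompact.measure_lt_top
  -- Monotone convergence from above needs one finite integral. Measurability is needed only for the
  -- truncations, which are continuous in the derivative.
  have key := lintegral_tendsto_of_tendsto_of_antitone hmeas (Eventually.of_forall hanti) hg0
    (Eventually.of_forall htend)
  constructor
  · refine (lt_of_le_of_lt ?_ hg0.lt_top).ne
    exact lintegral_mono fun z => (hanti z).le_of_tendsto (htend z) 0
  · intro J hJ
    obtain ⟨j, hj⟩ := (key.eventually_lt_const hJ).exists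
    exact ⟨n₀ + j, δ j, hδpos j, hfin j, hj⟩

/-- The factor `|s| ^ m` from homogeneity and `|s| ^ (2/p)` from the area combine to `|s| ^ (2 *
dualRate m p)`, which also multiplies the freezing error. -/
theorem localError_le_of_shape {m : ℕ} (hm : 2 ≤ m) {p : ℝ≥0∞} (hp : 1 ≤ p)
    {Ω : Set Plane} (hΩ : UniqueDiffOn ℝ Ω) {f : Plane → ℝ}
    (hf : ContDiffOn ℝ m f Ω) (A : ContinuousMultilinearMap ℝ (fun _ : Fin m => Plane) ℝ) {ε : ℝ}
    (hε : 0 ≤ ε) {S : Tri} (hS : volume (triSet S) = 1) {n : ℕ} (hSn : triDiam S ≤ n) (s : ℝ)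
    (hs : s ≠ 0) (c : Plane) (hsub : triSet (S.homothet s hs c) ⊆ Ω)
    (hA : ∀ ξ ∈ triSet (S.homothet s hs c), ‖iteratedFDerivWithin ℝ m f Ω ξ - A‖ ≤ ε) :
    localError m p (S.homothet s hs c) f ≤ ENNReal.ofReal (|s| ^ (2 * dualRate m p)) *
      (localError m p S (homPoly A) + ENNReal.ofReal (shapeLip m n * ε)) := by
  have hs0 : 0 < |s| := abs_pos.2 hs
  have hpow : ENNReal.ofReal (|s| ^ (2 * dualRate m p)) =
      ENNReal.ofReal (s ^ 2) ^ p.toReal⁻¹ * ENNReal.ofReal (|s| ^ m) := by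
    have hp0 : 0 ≤ p.toReal⁻¹ := inv_nonneg.2 ENNReal.toReal_nonneg
    rw [ENNReal.ofReal_rpow_of_nonneg (sq_nonneg s) hp0, ← ENNReal.ofReal_mul (by positivity)]
    congr 1
    rw [← sq_abs, ← Real.rpow_natCast |s| 2, ← Real.rpow_mul hs0.le, ← Real.rpow_natCast |s| m,
      ← Real.rpow_add hs0, dualRate]
    congr 1
    push_cast
    ring
  refine (localError_le_of_deriv hm hp hΩ hsub hf A hA).trans ?_
  rw [localError_homPoly_homothet hm, volume_homothet, hS, mul_one, triDiam_homothet, hpow,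
    mul_assoc, ← mul_add]
  refine mul_le_mul_right ?_ _
  rw [mul_add, ← ENNReal.ofReal_mul (by positivity)]
  refine add_le_add le_rfl (ENNReal.ofReal_le_ofReal ?_)
  have hL := lebesgueConst_nonneg hm
  have hd := pow_le_pow_left₀ (triDiam_nonneg S) hSn m
  calc (1 + lebesgueConst m) * (ε * (|s| * triDiam S) ^ m)
      = |s| ^ m * ((1 + lebesgueConst m) * triDiam S ^ m * ε) := by ring
    _ ≤ |s| ^ m * (shapeLip m n * ε) := by
        rw [shapeLip]
        gcongr

theorem homothet_homothet (T : Tri) (s t : ℝ) (hs : s ≠ 0) (ht : t ≠ 0) (c : Plane) :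
    (T.homothet t ht 0).homothet s hs c = T.homothet (s * t) (mul_ne_zero hs ht) c := by
  unfold Tri.homothet
  congr 1
  funext i
  simp [smul_smul]

/-- A subdivision of `Ω` and triangles adapted to the `m`-th derivative of `f` on its members. -/
theorem exists_shapes {m : ℕ} (hm : 2 ≤ m) {p : ℝ≥0∞} (hp : 1 ≤ p)
    {Ω : Set Plane} (hΩ : IsPolygonal Ω) {f : Plane → ℝ} (hf : ContDiffOn ℝ m f Ω) {J : ℝ≥0∞}
    (hJ : (∫⁻ z in Ω, shapeFunction m p (derivPoly m Ω f z) ^ (dualRate m p)⁻¹) < J) :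
    ∃ (𝓡 : Finset Tri) (τ : Tri → Tri), IsTriangulation Ω 𝓡 ∧ 𝓡.Nonempty ∧
      ENNReal.ofReal (∑ R ∈ 𝓡, triArea R / triArea (τ R)) < J ∧
      ∀ R ∈ 𝓡, ∀ (s : ℝ) (hs : s ≠ 0) (c : Plane), triSet ((τ R).homothet s hs c) ⊆ triSet R →
        localError m p ((τ R).homothet s hs c) f ≤ ENNReal.ofReal (|s| ^ (2 * dualRate m p)) := by
  obtain ⟨n, δ, hδ, hfin, hint⟩ := (exists_shapeTrunc_lintegral_lt hm hp hΩ hf).2 J hJ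
  have hr := dualRate_pos hm p
  set r := dualRate m p with hrdef
  set A := iteratedFDerivWithin ℝ m f Ω with hA
  set L := shapeLip m n with hL
  have hL0 : 0 ≤ L := shapeLip_nonneg hm n
  set ε : ℝ := δ / 2 / (L + 1) with hε
  have hε0 : 0 < ε := by positivity
  have hLε : L * ε ≤ δ / 2 := by
    rw [hε, mul_div_assoc', div_le_iff₀ (by linarith)]
    nlinarith
  have huc := hΩ.isCompact.uniformContinuousOn_of_continuous (hΩ.continuousOn_deriv hf)
  obtain ⟨ρ, hρ, hunif⟩ := Metric.uniformContinuousOn_iff.1 huc ε hε0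
  obtain ⟨𝓡, h𝓡, hne, hdiam⟩ := hΩ.exists_fine_triangulation (half_pos hρ)
  have hclose : ∀ R ∈ 𝓡, ∀ z ∈ triSet R, ‖A z - A (R.points 0)‖ ≤ ε := by
    intro R hR z hz
    rw [← dist_eq_norm]
    refine (hunif z (h𝓡.subset hR hz) _ (h𝓡.subset hR (points_mem R 0)) ?_).le
    exact (dist_le_triDiam hz (points_mem R 0)).trans_lt ((hdiam R hR).trans_lt (half_lt_self hρ))
  have hshape : ∀ R : Tri, ∃ S : Tri, volume (triSet S) = 1 ∧ triDiam S ≤ n ∧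
      localError m p S (homPoly (A (R.points 0))) ≤
        shapeTrunc p n (A (R.points 0)) + ENNReal.ofReal (δ / 2) := by
    intro R
    have hlt : shapeTrunc p n (A (R.points 0)) <
        shapeTrunc p n (A (R.points 0)) + ENNReal.ofReal (δ / 2) :=
      ENNReal.lt_add_right (hfin _) (by simpa using hδ)
    conv_lhs at hlt => rw [shapeTrunc]
    simp only [iInf_lt_iff] at hlt
    obtain ⟨S, ⟨h1, h2⟩, h3⟩ := hlt
    exact ⟨S, h1, h2, h3.le⟩
  choose S hS1 hS2 hS3 using hshape
  -- Of `δ`, one half covers near-minimality of `S R` and the other the oscillation of the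
  -- derivative. It also makes `κ R` positive where the truncated shape function vanishes.
  set κ : Tri → ℝ := fun R => (shapeTrunc p n (A (R.points 0))).toReal + δ with hκ
  have hκ0 : ∀ R, 0 < κ R := fun R => add_pos_of_nonneg_of_pos ENNReal.toReal_nonneg hδ
  have hκe : ∀ R, ENNReal.ofReal (κ R) = shapeTrunc p n (A (R.points 0)) + ENNReal.ofReal δ := by
    intro R
    rw [hκ, ENNReal.ofReal_add ENNReal.toReal_nonneg hδ.le, ENNReal.ofReal_toReal (hfin _)]
  -- The dilation for which `σ R ^ (2 * r) * κ R = 1`: all adapted triangles get the same error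
  -- bound, which is the equidistribution.
  set σ : Tri → ℝ := fun R => κ R ^ (-(2 * r)⁻¹) with hσ
  have hσ0 : ∀ R, 0 < σ R := fun R => Real.rpow_pos_of_pos (hκ0 R) _
  have hσκ : ∀ R, σ R ^ (2 * r) = (κ R)⁻¹ := by
    intro R
    rw [hσ, ← Real.rpow_mul (hκ0 R).le, neg_mul, inv_mul_cancel₀ (by positivity),
      Real.rpow_neg_one]
  refine ⟨𝓡, fun R => (S R).homothet (σ R) (hσ0 R).ne' 0, h𝓡, hne, ?_, ?_⟩
  · refine lt_of_le_of_lt ?_ hint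
    -- The area of the adapted triangle is `κ R ^ (-1/r)`, so the sum of area ratios is a Riemann
    -- sum that is compared with the integral of the truncated shape function.
    have hterm : ∀ R, triArea R / triArea ((S R).homothet (σ R) (hσ0 R).ne' 0) =
        triArea R * κ R ^ r⁻¹ := by
      intro R
      have h1 : triArea (S R) = 1 := by rw [triArea, hS1, ENNReal.toReal_one]
      rw [triArea_homothet, h1, mul_one, div_eq_mul_inv]
      congr 1
      rw [hσ, ← Real.rpow_natCast, ← Real.rpow_mul (hκ0 R).le, ← Real.rpow_neg (hκ0 R).le]
      congr 1
      push_cast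
      field_simp
    rw [ENNReal.ofReal_sum_of_nonneg fun R _ => (div_pos (triArea_pos _) (triArea_pos _)).le]
    refine le_trans (Finset.sum_le_sum fun R hR => ?_)
      (sum_lintegral_triSet 𝓡 id h𝓡.nonoverlapping (fun R hR => h𝓡.subset hR) _)
    rw [hterm, ENNReal.ofReal_mul (triArea_pos R).le, ofReal_triArea, mul_comm,
      ← ENNReal.ofReal_rpow_of_pos (hκ0 R), hκe, id, ← setLIntegral_const]
    refine setLIntegral_mono' (measurableSet_triSet R) fun z hz => ?_
    refine ENNReal.rpow_le_rpow ?_ (inv_pos.2 hr).le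
    have h1 := shapeTrunc_le_add hm hp n (A (R.points 0)) (A z)
    have h2 : ENNReal.ofReal (L * ‖A (R.points 0) - A z‖) ≤ ENNReal.ofReal δ := by
      refine ENNReal.ofReal_le_ofReal ?_
      rw [norm_sub_rev]
      have := mul_le_mul_of_nonneg_left (hclose R hR z hz) hL0
      linarith
    calc shapeTrunc p n (A (R.points 0)) + ENNReal.ofReal δ
        ≤ (shapeTrunc p n (A z) + ENNReal.ofReal δ) + ENNReal.ofReal δ :=
          add_le_add (h1.trans (add_le_add le_rfl h2)) le_rfl
      _ = _ := by rw [two_mul, add_assoc]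
  · intro R hR s hs c hsub
    rw [homothet_homothet] at hsub ⊢
    have hsub' := hsub.trans (h𝓡.subset hR)
    refine (localError_le_of_shape hm hp hΩ.uniqueDiffOn hf (A (R.points 0)) hε0.le (hS1 R) (hS2 R)
      _ _ c hsub' fun ξ hξ => hclose R hR ξ (hsub hξ)).trans ?_
    have hb : localError m p (S R) (homPoly (A (R.points 0))) + ENNReal.ofReal (shapeLip m n * ε) ≤
        ENNReal.ofReal (κ R) := by
      rw [hκe]
      calc _ ≤ (shapeTrunc p n (A (R.points 0)) + ENNReal.ofReal (δ / 2)) +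
            ENNReal.ofReal (δ / 2) := add_le_add (hS3 R) (ENNReal.ofReal_le_ofReal hLε)
        _ = _ := by
            rw [add_assoc, ← ENNReal.ofReal_add (by linarith) (by linarith), add_halves]
    refine (mul_le_mul_right hb _).trans ?_
    rw [← ENNReal.ofReal_mul (by positivity), abs_mul, abs_of_pos (hσ0 R),
      Real.mul_rpow (abs_nonneg s) (hσ0 R).le, hσκ, mul_assoc, inv_mul_cancel₀ (hκ0 R).ne', mul_one]

/-! ### The error of the meshes -/

/-- Comparison with the zero polynomial: a crude bound for triangles of any shape, used outside the
adapted family. -/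
theorem localError_le_of_diam {m : ℕ} (hm : 2 ≤ m) {p : ℝ≥0∞} (hp : 1 ≤ p) {Ω : Set Plane}
    (hΩ : UniqueDiffOn ℝ Ω) {f : Plane → ℝ} (hf : ContDiffOn ℝ m f Ω) {B : ℝ} (hB0 : 0 ≤ B)
    (hB : ∀ z ∈ Ω, ‖iteratedFDerivWithin ℝ m f Ω z‖ ≤ B) {T : Tri} (hT : triSet T ⊆ Ω) {d : ℝ}
    (hd : triDiam T ≤ d) :
    localError m p T f ≤ volume (triSet T) ^ p.toReal⁻¹ *
      ENNReal.ofReal ((1 + lebesgueConst m) * B * d ^ m) := by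
  refine (localError_le_of_deriv (ε := B) hm hp hΩ hT hf 0
    fun ξ hξ => by simpa using hB ξ (hT hξ)).trans ?_
  rw [localError_zero hm, zero_add]
  refine mul_le_mul_right (ENNReal.ofReal_le_ofReal ?_) _
  have := lebesgueConst_nonneg hm
  have h := pow_le_pow_left₀ (triDiam_nonneg T) hd m
  rw [← mul_assoc]
  gcongr

/-- The scale is `h = √(b / N)`; since `h → 0`, the lower-order term `C * h` eventually fits into
the gap `b - a`. -/
theorem exists_scale {a b C : ℝ} (ha : 0 ≤ a) (hab : a < b) (hC : 0 ≤ C) :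
    ∃ N₀ : ℕ, ∀ N : ℕ, N₀ ≤ N → ∃ h : ℝ, 0 < h ∧ h ≤ 1 ∧ (N : ℝ) * h ^ 2 = b ∧ a + C * h ≤ b := by
  have hb : 0 < b := ha.trans_lt hab
  set t : ℝ := min 1 ((b - a) / (C + 1)) with ht
  have ht0 : 0 < t := lt_min one_pos (div_pos (by linarith) (by linarith))
  obtain ⟨N₀, hN₀⟩ := exists_nat_gt (b / t ^ 2)
  refine ⟨N₀, fun N hN => ?_⟩
  have hN' : b / t ^ 2 < N := hN₀.trans_le (by exact_mod_cast hN)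
  have hN0 : (0 : ℝ) < N := lt_of_le_of_lt (by positivity) hN'
  have hle : Real.sqrt (b / N) ≤ t := by
    rw [Real.sqrt_le_left ht0.le, div_le_iff₀ hN0]
    rw [div_lt_iff₀ (by positivity)] at hN'
    linarith
  refine ⟨Real.sqrt (b / N), Real.sqrt_pos.2 (div_pos hb hN0), hle.trans (min_le_left _ _), ?_, ?_⟩
  · rw [Real.sq_sqrt (div_pos hb hN0).le]
    field_simp
  · have h1 := hle.trans (min_le_right _ _)
    rw [le_div_iff₀ (by linarith)] at h1
    nlinarith [Real.sqrt_nonneg (b / N)]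

theorem card_condition {a b C h : ℝ} {N : ℕ} (h0 : 0 < h) (hN : (N : ℝ) * h ^ 2 = b)
    (hab : a + C * h ≤ b) : a / h ^ 2 + C / h ≤ N := by
  have e : a / h ^ 2 + C / h = (a + C * h) / h ^ 2 := by field_simp
  rw [e, div_le_iff₀ (by positivity), hN]
  exact hab

theorem natCast_rpow_mul {m N : ℕ} {b h c : ℝ} (h0 : 0 < h) (hb : 0 < b)
    (hN : (N : ℝ) * h ^ 2 = b) :
    (N : ℝ≥0∞) ^ ((m : ℝ) / 2) * ENNReal.ofReal (h ^ m * b ^ c) =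
      ENNReal.ofReal b ^ ((m : ℝ) / 2 + c) := by
  have hpow : (h ^ 2) ^ ((m : ℝ) / 2) = h ^ m := by
    rw [← Real.rpow_natCast h 2, ← Real.rpow_mul h0.le, ← Real.rpow_natCast h m]
    congr 1
    push_cast
    ring
  rw [← ENNReal.ofReal_natCast, ENNReal.ofReal_rpow_of_nonneg (Nat.cast_nonneg N) (by positivity),
    ← ENNReal.ofReal_mul (by positivity), ENNReal.ofReal_rpow_of_pos hb, Real.rpow_add hb,
    ← mul_assoc, ← hpow, ← Real.mul_rpow (Nat.cast_nonneg N) (by positivity), hN]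

theorem localError_le_of_good {m : ℕ} {p : ℝ≥0∞} {f : Plane → ℝ} {𝓡 : Finset Tri}
    {τ : Tri → Tri} {r h : ℝ}
    (hτ : ∀ R ∈ 𝓡, ∀ (s : ℝ) (hs : s ≠ 0) (c : Plane), triSet ((τ R).homothet s hs c) ⊆ triSet R →
      localError m p ((τ R).homothet s hs c) f ≤ ENNReal.ofReal (|s| ^ r)) {T : Tri}
    (hT : ∃ R ∈ 𝓡, triSet T ⊆ triSet R ∧
      ∃ (s : ℝ) (hs : s ≠ 0) (c : Plane), |s| = h ∧ T = (τ R).homothet s hs c) :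
    localError m p T f ≤ ENNReal.ofReal (h ^ r) := by
  obtain ⟨R, hR, hsub, s, hs, c, rfl, rfl⟩ := hT
  exact hτ R hR s hs c hsub

/-- In the max norm a small total area does not help, so the boundary pieces are refined until even
their crude error is at most `h ^ m`. Conformity is given up, since splitting tiles would lose their
sharp bound. -/
theorem exists_mesh_globalError_top {m : ℕ} (hm : 2 ≤ m) {Ω : Set Plane} (hΩ : IsPolygonal Ω)
    {f : Plane → ℝ} (hf : ContDiffOn ℝ m f Ω) {J : ℝ≥0∞} (hJtop : J ≠ ∞)
    (hJ : (∫⁻ z in Ω, shapeFunction m ∞ (derivPoly m Ω f z) ^ (dualRate m ∞)⁻¹) < J) :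
    ∃ N₀ : ℕ, ∀ N : ℕ, N₀ ≤ N → ∃ 𝒯 : Finset Tri, 𝒯.card = N ∧ IsTriangulation Ω 𝒯 ∧
      (N : ℝ≥0∞) ^ ((m : ℝ) / 2) * globalError m ∞ 𝒯 f ≤ J ^ dualRate m ∞ := by
  obtain ⟨𝓡, τ, h𝓡, hne, ha, hτ⟩ := exists_shapes hm le_top hΩ hf hJ
  obtain ⟨B, hB0, hB⟩ := hΩ.exists_deriv_bound hf
  have ha0 : 0 ≤ ∑ R ∈ 𝓡, triArea R / triArea (τ R) :=
    Finset.sum_nonneg fun R _ => (div_pos (triArea_pos _) (triArea_pos _)).le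
  set a := ∑ R ∈ 𝓡, triArea R / triArea (τ R) with ha_def
  have hab : a < J.toReal := (ENNReal.ofReal_lt_iff_lt_toReal ha0 hJtop).1 ha
  have hb0 : 0 < J.toReal := ha0.trans_lt hab
  set D := ∑ R ∈ 𝓡, triDiam (τ R) with hD
  have hD0 : 0 ≤ D := Finset.sum_nonneg fun R _ => triDiam_nonneg _
  have hL := lebesgueConst_nonneg hm
  set M := (1 + lebesgueConst m) * B with hM
  have hM0 : 0 ≤ M := by positivity
  -- This `n` does not depend on `h`, so the refined boundary pieces still number `O(1 / h)`.
  obtain ⟨n, hn⟩ := exists_nat_gt (3 * D * (M + 1))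
  have hn0 : (0 : ℝ) < n := lt_of_le_of_lt (by positivity) hn
  have hsmall : M * (3 / n * D) ^ m ≤ 1 := by
    have h1 : 3 / n * D ≤ 1 / (M + 1) := by
      rw [div_mul_eq_mul_div, div_le_div_iff₀ hn0 (by linarith)]
      linarith
    have h2 : (3 / n * D) ^ m ≤ 1 / (M + 1) := by
      refine le_trans (pow_le_of_le_one (by positivity) (h1.trans ?_) (by omega)) h1
      rw [div_le_one (by linarith)]
      linarith
    calc M * (3 / n * D) ^ m ≤ M * (1 / (M + 1)) := by gcongr
      _ ≤ 1 := by
        rw [mul_one_div, div_le_one (by linarith)]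
        linarith
  obtain ⟨C, hC0, hC⟩ := exists_mesh_card h𝓡 hne τ (n := n) (by exact_mod_cast hn0)
  obtain ⟨N₀, hN₀⟩ := exists_scale ha0 hab hC0
  refine ⟨N₀, fun N hN => ?_⟩
  obtain ⟨h, h0, h1, hNh, hle⟩ := hN₀ N hN
  obtain ⟨𝒯, 𝒢, h𝒯, hcard, hgood, hbad⟩ := hC h h0 h1 N (card_condition h0 hNh hle)
  refine ⟨𝒯, hcard, h𝒯, ?_⟩
  have hr : dualRate m ∞ = (m : ℝ) / 2 + 0 := by simp [dualRate]
  have hglob : globalError m ∞ 𝒯 f ≤ ENNReal.ofReal (h ^ m * J.toReal ^ (0 : ℝ)) := by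
    rw [globalError, if_pos rfl, Real.rpow_zero, mul_one]
    refine iSup₂_le fun T hT => ?_
    by_cases hTG : T ∈ 𝒢
    · refine (localError_le_of_good hτ (hgood T hTG)).trans_eq ?_
      rw [hr, add_zero, mul_div_cancel₀ _ two_ne_zero, Real.rpow_natCast]
    · refine (localError_le_of_diam hm le_top hΩ.uniqueDiffOn hf hB0 hB (h𝒯.subset hT)
        (hbad T hT hTG)).trans ?_
      rw [ENNReal.toReal_top, inv_zero, ENNReal.rpow_zero, one_mul]
      refine ENNReal.ofReal_le_ofReal ?_
      calc M * (3 / n * (h * D)) ^ m = h ^ m * (M * (3 / n * D) ^ m) := by ring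
        _ ≤ h ^ m * 1 := by gcongr
        _ = h ^ m := mul_one _
  refine (mul_le_mul_right hglob _).trans_eq ?_
  rw [natCast_rpow_mul h0 hb0 hNh, ENNReal.ofReal_toReal hJtop, hr]

/-- In the sum of `p`-th powers the tiles contribute at most `a * h ^ (m p)` and all other triangles
`O(h) * h ^ (m p)`, which is absorbed in the gap between `a` and `J`. -/
theorem exists_conforming_mesh_globalError {m : ℕ} (hm : 2 ≤ m) {p : ℝ≥0∞} (hp : 1 ≤ p)
    (hptop : p ≠ ∞) {Ω : Set Plane} (hΩ : IsPolygonal Ω)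
    {f : Plane → ℝ} (hf : ContDiffOn ℝ m f Ω) {J : ℝ≥0∞} (hJtop : J ≠ ∞)
    (hJ : (∫⁻ z in Ω, shapeFunction m p (derivPoly m Ω f z) ^ (dualRate m p)⁻¹) < J) :
    ∃ N₀ : ℕ, ∀ N : ℕ, N₀ ≤ N → ∃ 𝒯 : Finset Tri, 𝒯.card = N ∧ IsTriangulation Ω 𝒯 ∧
      IsConforming 𝒯 ∧
      (N : ℝ≥0∞) ^ ((m : ℝ) / 2) * globalError m p 𝒯 f ≤ J ^ dualRate m p := by
  classical
  obtain ⟨𝓡, τ, h𝓡, hne, ha, hτ⟩ := exists_shapes hm hp hΩ hf hJ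
  obtain ⟨B, hB0, hB⟩ := hΩ.exists_deriv_bound hf
  have ha0 : 0 ≤ ∑ R ∈ 𝓡, triArea R / triArea (τ R) :=
    Finset.sum_nonneg fun R _ => (div_pos (triArea_pos _) (triArea_pos _)).le
  set a := ∑ R ∈ 𝓡, triArea R / triArea (τ R) with ha_def
  have hab : a < J.toReal := (ENNReal.ofReal_lt_iff_lt_toReal ha0 hJtop).1 ha
  have hb0 : 0 < J.toReal := ha0.trans_lt hab
  -- This `q` is the exponent `p` as a real number, not the dual exponent.
  set q := p.toReal with hq
  have hq0 : 0 < q := ENNReal.toReal_pos (zero_lt_one.trans_le hp).ne' hptop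
  obtain ⟨C, hC0, hC⟩ := exists_conforming_mesh_card h𝓡 hne τ
  have hL := lebesgueConst_nonneg hm
  set M := (1 + lebesgueConst m) * B * C ^ m with hM
  have hM0 : 0 ≤ M := by positivity
  have hMq : 0 ≤ M ^ q := Real.rpow_nonneg hM0 q
  -- The enlarged constant leaves room both for the additional triangles and for their contribution
  -- to the error.
  obtain ⟨N₀, hN₀⟩ := exists_scale ha0 hab (C := C + C * M ^ q) (by positivity)
  refine ⟨N₀, fun N hN => ?_⟩
  obtain ⟨h, h0, h1, hNh, hle⟩ := hN₀ N hN
  have hle1 : a + C * h ≤ J.toReal := by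
    have : 0 ≤ C * M ^ q * h := by positivity
    linarith
  have hle2 : a + C * h * M ^ q ≤ J.toReal := by
    have : 0 ≤ C * h := by positivity
    linarith
  obtain ⟨𝒯, 𝒢, h𝒯, hconf, hcard, hgood, hcardG, hdiam, harea⟩ :=
    hC h h0 h1 N (card_condition h0 hNh hle1)
  refine ⟨𝒯, hcard, h𝒯, hconf, ?_⟩
  have hhm : (0 : ℝ) < h ^ m := by positivity
  have hrq : h ^ (2 * dualRate m p * q) = (h ^ m) ^ q * h ^ 2 := by
    rw [← Real.rpow_natCast h m, ← Real.rpow_mul h0.le, ← Real.rpow_natCast h 2,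
      ← Real.rpow_add h0, dualRate, ← hq]
    congr 1
    push_cast
    field_simp
  have hG : ∑ T ∈ 𝒯 ∩ 𝒢, localError m p T f ^ q ≤ ENNReal.ofReal ((h ^ m) ^ q * a) := by
    calc ∑ T ∈ 𝒯 ∩ 𝒢, localError m p T f ^ q
        ≤ ∑ T ∈ 𝒯 ∩ 𝒢, ENNReal.ofReal (h ^ (2 * dualRate m p * q)) := by
          refine Finset.sum_le_sum fun T hT => ?_
          have := localError_le_of_good hτ (hgood T (Finset.mem_inter.1 hT).2)
          refine (ENNReal.rpow_le_rpow this hq0.le).trans_eq ?_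
          rw [ENNReal.ofReal_rpow_of_pos (Real.rpow_pos_of_pos h0 _), ← Real.rpow_mul h0.le]
      _ = ENNReal.ofReal ((𝒯 ∩ 𝒢).card * ((h ^ m) ^ q * h ^ 2)) := by
          rw [Finset.sum_const, nsmul_eq_mul, hrq, ENNReal.ofReal_mul (Nat.cast_nonneg _),
            ENNReal.ofReal_natCast]
      _ ≤ _ := by
          refine ENNReal.ofReal_le_ofReal ?_
          have hc : ((𝒯 ∩ 𝒢).card : ℝ) ≤ a / h ^ 2 :=
            le_trans (by exact_mod_cast Finset.card_le_card Finset.inter_subset_right) hcardG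
          rw [le_div_iff₀ (by positivity)] at hc
          calc ((𝒯 ∩ 𝒢).card : ℝ) * ((h ^ m) ^ q * h ^ 2)
              = (h ^ m) ^ q * ((𝒯 ∩ 𝒢).card * h ^ 2) := by ring
            _ ≤ _ := by gcongr
  have hD : ∑ T ∈ 𝒯 \ 𝒢, localError m p T f ^ q ≤
      ENNReal.ofReal ((h ^ m) ^ q * (C * h * M ^ q)) := by
    calc ∑ T ∈ 𝒯 \ 𝒢, localError m p T f ^ q
        ≤ ∑ T ∈ 𝒯 \ 𝒢, ENNReal.ofReal (triArea T * (M * h ^ m) ^ q) := by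
          refine Finset.sum_le_sum fun T hT => ?_
          have hT' := (Finset.mem_sdiff.1 hT).1
          have := localError_le_of_diam hm hp hΩ.uniqueDiffOn hf hB0 hB (h𝒯.subset hT')
            (hdiam T hT')
          refine (ENNReal.rpow_le_rpow this hq0.le).trans_eq ?_
          rw [ENNReal.mul_rpow_of_nonneg _ _ hq0.le, ← ENNReal.rpow_mul, ← hq,
            inv_mul_cancel₀ hq0.ne', ENNReal.rpow_one, ← ofReal_triArea,
            ENNReal.ofReal_rpow_of_nonneg (by positivity) hq0.le,
            ← ENNReal.ofReal_mul (triArea_pos T).le, mul_pow, ← mul_assoc]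
      _ = ENNReal.ofReal ((∑ T ∈ 𝒯 \ 𝒢, triArea T) * (M * h ^ m) ^ q) := by
          rw [Finset.sum_mul, ENNReal.ofReal_sum_of_nonneg]
          intro T _
          have := (triArea_pos T).le
          positivity
      _ ≤ _ := by
          refine ENNReal.ofReal_le_ofReal ?_
          rw [Real.mul_rpow hM0 hhm.le]
          calc (∑ T ∈ 𝒯 \ 𝒢, triArea T) * (M ^ q * (h ^ m) ^ q)
              ≤ C * h * (M ^ q * (h ^ m) ^ q) := by gcongr
            _ = _ := by ring
  have hglob : globalError m p 𝒯 f ≤ ENNReal.ofReal (h ^ m * J.toReal ^ q⁻¹) := by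
    rw [globalError, if_neg hptop, one_div]
    have hsum : ∑ T ∈ 𝒯, localError m p T f ^ q ≤ ENNReal.ofReal ((h ^ m) ^ q * J.toReal) := by
      rw [← Finset.sum_inter_add_sum_sdiff 𝒯 𝒢]
      refine (add_le_add hG hD).trans ?_
      rw [← ENNReal.ofReal_add (by positivity) (by positivity), ← mul_add]
      exact ENNReal.ofReal_le_ofReal (by gcongr)
    refine (ENNReal.rpow_le_rpow hsum (inv_pos.2 hq0).le).trans_eq ?_
    rw [ENNReal.ofReal_rpow_of_nonneg (by positivity) (inv_pos.2 hq0).le,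
      Real.mul_rpow (by positivity) hb0.le, ← Real.rpow_mul hhm.le, mul_inv_cancel₀ hq0.ne',
      Real.rpow_one]
  refine (mul_le_mul_right hglob _).trans_eq ?_
  rw [natCast_rpow_mul h0 hb0 hNh, ENNReal.ofReal_toReal hJtop, dualRate]

theorem exists_mesh_globalError {m : ℕ} (hm : 2 ≤ m) {p : ℝ≥0∞} (hp : 1 ≤ p)
    {Ω : Set Plane} (hΩ : IsPolygonal Ω)
    {f : Plane → ℝ} (hf : ContDiffOn ℝ m f Ω) {J : ℝ≥0∞} (hJtop : J ≠ ∞)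
    (hJ : (∫⁻ z in Ω, shapeFunction m p (derivPoly m Ω f z) ^ (dualRate m p)⁻¹) < J) :
    ∃ N₀ : ℕ, ∀ N : ℕ, N₀ ≤ N → ∃ 𝒯 : Finset Tri,
      (𝒯.card = N ∧ IsTriangulation Ω 𝒯 ∧ (p ≠ ∞ → IsConforming 𝒯)) ∧
      (N : ℝ≥0∞) ^ ((m : ℝ) / 2) * globalError m p 𝒯 f ≤ J ^ dualRate m p := by
  rcases eq_or_ne p ∞ with rfl | hptop
  · obtain ⟨N₀, hN₀⟩ := exists_mesh_globalError_top hm hΩ hf hJtop hJ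
    refine ⟨N₀, fun N hN => ?_⟩
    obtain ⟨𝒯, h1, h2, h3⟩ := hN₀ N hN
    exact ⟨𝒯, ⟨h1, h2, fun h => absurd rfl h⟩, h3⟩
  · obtain ⟨N₀, hN₀⟩ := exists_conforming_mesh_globalError hm hp hptop hΩ hf hJtop hJ
    refine ⟨N₀, fun N hN => ?_⟩
    obtain ⟨𝒯, h1, h2, h3, h4⟩ := hN₀ N hN
    exact ⟨𝒯, ⟨h1, h2, fun _ => h3⟩, h4⟩

/-! ### Passage from each `J > I` to a single sequence -/

/-- Diagonal choice of near minimizers. -/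
theorem exists_limsup_le {α : Type*} [Nonempty α] (P : ℕ → α → Prop) (v : ℕ → α → ℝ≥0∞)
    {I : ℝ≥0∞} (hI : I ≠ ∞) {r : ℝ}
    (h : ∀ J : ℝ≥0∞, J ≠ ∞ → I < J → ∃ N₀, ∀ N, N₀ ≤ N → ∃ x, P N x ∧ v N x ≤ J ^ r) :
    ∃ (N₀ : ℕ) (x : ℕ → α), (∀ N, N₀ ≤ N → P N (x N)) ∧
      limsup (fun N => v N (x N)) atTop ≤ I ^ r := by
  obtain ⟨N₀, hN₀⟩ := h (I + 1) (ENNReal.add_ne_top.2 ⟨hI, ENNReal.one_ne_top⟩)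
    (ENNReal.lt_add_right hI one_ne_zero)
  -- The choice at `N` does not refer to `J`: being within `1 / (N + 1)` of the infimum, it competes
  -- with the triangulations built for every `J`.
  have hchoice : ∀ N, ∃ x, N₀ ≤ N → P N x ∧
      v N x ≤ (⨅ (y) (_ : P N y), v N y) + ENNReal.ofReal (1 / ((N : ℝ) + 1)) := by
    intro N
    by_cases hN : N₀ ≤ N
    · obtain ⟨y, hy, -⟩ := hN₀ N hN
      by_cases htop : (⨅ (y) (_ : P N y), v N y) = ∞
      · exact ⟨y, fun _ => ⟨hy, by simp [htop]⟩⟩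
      · have hlt := ENNReal.lt_add_right htop
          (ENNReal.ofReal_pos.2 (Nat.one_div_pos_of_nat (n := N) (α := ℝ))).ne'
        obtain ⟨x, hx⟩ := iInf_lt_iff.1 hlt
        obtain ⟨hPx, hx⟩ := iInf_lt_iff.1 hx
        exact ⟨x, fun _ => ⟨hPx, hx.le⟩⟩
    · exact ⟨Classical.arbitrary α, fun hN' => absurd hN' hN⟩
  choose x hx using hchoice
  refine ⟨N₀, x, fun N hN => (hx N hN).1, ?_⟩
  have hbound : ∀ J : ℝ≥0∞, J ≠ ∞ → I < J → limsup (fun N => v N (x N)) atTop ≤ J ^ r := by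
    intro J hJ hIJ
    obtain ⟨N₁, hN₁⟩ := h J hJ hIJ
    have hev : ∀ᶠ N in atTop, v N (x N) ≤ J ^ r + ENNReal.ofReal (1 / ((N : ℝ) + 1)) := by
      filter_upwards [eventually_ge_atTop N₀, eventually_ge_atTop N₁] with N h0 h1
      obtain ⟨y, hy, hyJ⟩ := hN₁ N h1
      exact (hx N h0).2.trans (add_le_add ((iInf₂_le y hy).trans hyJ) le_rfl)
    refine (limsup_le_limsup hev).trans_eq ?_
    have h3 : Tendsto (fun j : ℕ => ENNReal.ofReal (1 / ((j : ℝ) + 1))) atTop (nhds 0) := by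
      have := (ENNReal.continuous_ofReal.tendsto 0).comp
        (tendsto_one_div_add_atTop_nhds_zero_nat (𝕜 := ℝ))
      simpa [Function.comp_def] using this
    have h4 := (tendsto_const_nhds (x := J ^ r)).add h3
    rw [add_zero] at h4
    exact h4.limsup_eq
  -- Letting `J` decrease to `I` removes the slack, by continuity of the power.
  have hcont : Tendsto (fun J : ℝ≥0∞ => J ^ r) (nhdsWithin I (Set.Ioi I)) (nhds (I ^ r)) :=
    (ENNReal.continuous_rpow_const.tendsto I).mono_left nhdsWithin_le_nhds
  have : (nhdsWithin I (Set.Ioi I)).NeBot := nhdsGT_neBot_of_exists_gt ⟨∞, hI.lt_top⟩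
  refine ge_of_tendsto hcont ?_
  filter_upwards [self_mem_nhdsWithin, nhdsWithin_le_nhds (Iio_mem_nhds hI.lt_top)] with J h1 h2
  exact hbound J (ne_of_lt h2) h1

theorem mainTheorem2 (m : ℕ) (hm : 2 ≤ m) (p : ℝ≥0∞) (hp : 1 ≤ p)
    (Ω : Set Plane) (hΩ : IsPolygonal Ω)
    (f : Plane → ℝ) (hf : ContDiffOn ℝ (m : WithTop ℕ∞) f Ω) :
    ∃ (N₀ : ℕ) (𝒯 : ℕ → Finset Tri),
      (∀ N, N₀ ≤ N →
        (𝒯 N).card = N ∧ IsTriangulation Ω (𝒯 N) ∧ (p ≠ ∞ → IsConforming (𝒯 N))) ∧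
      limsup (fun N : ℕ => (N : ℝ≥0∞) ^ ((m : ℝ) / 2) * globalError m p (𝒯 N) f) atTop ≤
        eLpNorm (fun z => shapeFunction m p (derivPoly m Ω f z)) (dualExponent m p)
          (volume.restrict Ω) := by
  rw [eLpNorm_dualExponent hm hp]
  exact exists_limsup_le _ _ (exists_shapeTrunc_lintegral_lt hm hp hΩ hf).1
    fun J hJtop hJ => exists_mesh_globalError hm hp hΩ hf hJtop hJ
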